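/- **Setting.** $\|\cdot\|$ is the Euclidean norm of vectors and the induced $2$-norm of matrices; $\|z\|_{\mathcal L_\infty^{J}}=\sup_{t\in J}\|z(t)\|$ for an interval $J$, and $\|z\|_{\mathcal L_\infty}$ is the case $J=[0,\infty)$. Let $m\ge 1$. Let $\Theta,\Theta_d\subset\mathbb R^s$ be boxes with $\|v\|\le b_{\dot\theta}$ for $v\in\Theta_d$. A trajectory $\theta:[0,\infty)\to\Theta$ is *admissible* if it is differentiable with $\dot\theta(t)\in\Theta_d$. Matrices below depend continuously on $\theta\in\Theta$; $M^\dagger$ is the pseudo-inverse; for a matrix function $M$ put $b_M=\max_{\theta\in\Theta}\|M(\theta)\|$. Differential equations are understood in the Carathéodory sense. *Plant:* $\dot x=A(\theta)x+B(\theta)\omega u_{\rm total}+f(t,x)$, $y=C(\theta)x$, $x(0)=x_0$, $\|x_0\|\le\rho_0$ ($\rho_0>0$), with $x\in\mathbb R^n$, $u_{\rm total}\in\mathbb R^m$, $y\in\mathbb R^p$, and $u_{\rm total}=K_x(\theta)x+u$. Put $A_m=A+BK_x$. The reference signal $r:[0,\infty)\to\mathbb R^p$ is measurable and bounded, and $K_r(\theta)\in\mathbb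 R^{m\times p}$. *Assumptions.* (i) There are a $C^1$ symmetric $P(\theta)>0$ and $\mu_P>0$ with $A_m^\top P+PA_m+\dot P\le-\mu_PP$ on $\Theta\times\Theta_d$, where $\dot P=\sum_i\dot\theta_i\,\partial P/\partial\theta_i$. (ii) $\omega$ is strictly row-diagonally dominant and $\omega\in\Omega$, where $\Omega\subset\mathbb R^{m\times m}$ is a convex polytope containing $\mathbb I_m$. (iii) $B(\theta)$ has full column rank, and $B,B^\dagger,K_x$ are Lipschitz on $\Theta$ with positive constants $L_B,L_{B^\dagger},L_{K_x}$. $B_u(\theta)\in\mathbb R^{n\times(n-m)}$ is such that $[B,B_u]$ has rank $n$ and $B^\top B_u=0$. (iv) For $t,t_1,t_2\ge0$: $\|f(t,0)\|\le b_f^0$; for every $\delta>0$, $\|f(t,x_1)-f(t,x_2)\|\le L_f^\delta\|x_1-x_2\|$ if $\|x_1\|,\|x_2\|\le\delta$; and $\|f(t_1,x)-f(t_2,x)\|\le l_f|t_1-t_2|$ for all $x$ (with $L_f^\delta,l_f>0$). Define $\bar f(t,x)=f(t,x)+B(\theta)(\omega-\mathbb I_m)K_x(\theta)x$ and $f_1,f_2$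 by $B(\theta)f_1+B_u(\theta)f_2=\bar f$. *Adaptive controller.* Let $a>0$, let $T>0$ be the sampling time, and let $K\in\mathbb R^{m\times m}$ be such that $-wK$ is Hurwitz for every $w\in\Omega$. Predictor: $\dot{\hat x}=A_mx+Bu+\hat\sigma-a(\hat x-x)$, $\hat x(0)=\hat x_0$ arbitrary. Adaptive law: $\hat\sigma(t)=-\frac{a}{e^{aT}-1}(\hat x-x)(iT)$ for $t\in[iT,(i+1)T)$, $i=0,1,\dots$; $\hat\sigma_c=0$ on $[0,T)$ and $\hat\sigma_c=\hat\sigma$ on $[T,\infty)$; $B(\theta)\hat\sigma_m+B_u(\theta)\hat\sigma_{um}=\hat\sigma_c$. Control law: $\dot u=-K(u+\hat\sigma_m+\bar{\mathcal H}(\theta)\hat\sigma_{um}-K_r(\theta)r)$, $u(0)=0$, where $\bar{\mathcal H}(\theta)$ is a given LPV state-space system with zero initial state, $n-m$ inputs and $m$ outputs. *Reference system.* $\dot x_r=A_mx_r+B(\omega u_r+f_1(t,x_r))+B_uf_2(t,x_r)$, $x_r(0)=x_0$, $y_r=C(\theta)x_r$, $u_r=-\omega^{-1}\mathcal C\big(f_1(\cdot,x_r)+\bar{\mathcal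 H}(\theta)f_2(\cdot,x_r)-K_r(\theta)r\big)$, where $\mathcal C$ is the mapping with transfer function $\omega K(s\mathbb I_m+\omega K)^{-1}$. *Mappings (zero initial states).* $\mathcal H_{xm},\mathcal H_{xum}$ are the input-to-state mappings of $\dot x=A_mx+Bv$ and $\dot x=A_mx+B_uv$; $\mathcal G_{xm}=\mathcal H_{xm}(\mathbb I_m-\mathcal C)$, $\mathcal G_{xum}=\mathcal H_{xum}-\mathcal H_{xm}\mathcal C\bar{\mathcal H}$, $\mathcal F=\mathcal C(B^\dagger+\bar{\mathcal H}B_u^\dagger)$. For a mapping $\mathcal G$, $\|\mathcal G\|_{\bar{\mathcal L}_1}$ denotes an arbitrary fixed $\gamma>0$ such that input $v$ and output $z$ satisfy $\|z\|_{\mathcal L_\infty^{[0,\tau]}}\le\gamma\|v\|_{\mathcal L_\infty^{[0,\tau]}}$ for all $\tau\ge0$ and all admissible $\theta$; such bounds are assumed given for $\mathcal G_{xm},\mathcal G_{xum},\mathcal H_{xm}\mathcal CK_r,\mathcal H_{xm},\bar{\mathcal H},\omega^{-1}\mathcal C\bar{\mathcal H}$. $\|\omega^{-1}\mathcal C\|_{\mathcal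 L_1}$ is the exact peak-to-peak gain. (v) $\mathcal F$ has a state-space realization $(A_{\mathcal F},B_{\mathcal F},C_{\mathcal F},0)$ for which there are a $C^1$ symmetric $P_{\mathcal F}(\theta)>0$ and $\mu_{\mathcal F}>0$ with $A_{\mathcal F}^\top P_{\mathcal F}+P_{\mathcal F}A_{\mathcal F}+\dot P_{\mathcal F}\le-\mu_{\mathcal F}P_{\mathcal F}$ on $\Theta\times\Theta_d$. *Constants.* Let $\bar\lambda(\cdot),\underline\lambda(\cdot)$ be the largest and smallest eigenvalue over $\theta\in\Theta$, and $c_\Omega=\max_{w\in\Omega}\|w-\mathbb I_m\|$. Put $\rho_{\rm in}=\rho_0\sqrt{\bar\lambda(P)/\underline\lambda(P)}$, $b_{f_1}^0=b_{B^\dagger}b_f^0$, $b_{f_2}^0=b_{B_u^\dagger}b_f^0$, $L_{f_1}^\delta=L_f^\delta b_{B^\dagger}+\max_{w\in\Omega,\theta\in\Theta}\|(w-\mathbb I_m)K_x(\theta)\|$, $L_{f_2}^\delta=L_f^\delta b_{B_u^\dagger}$, $L_{\bar f}^\delta=L_f^\delta+\max_{w\in\Omega,\theta\in\Theta}\|B(\theta)(w-\mathbb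 I_m)K_x(\theta)\|$, $l_{\bar f}^\delta=l_f+c_\Omega(L_Bb_{K_x}+b_BL_{K_x})\delta b_{\dot\theta}$. For $\rho_r,\gamma_1,\bar\gamma_0>0$ put $\rho=\rho_r+\gamma_1$, $\rho_{ur}=\|\omega^{-1}\mathcal C\|_{\mathcal L_1}\big(b_{K_r}\|r\|_{\mathcal L_\infty}+L_{f_1}^{\rho_r}\rho_r+b_{f_1}^0+\|\bar{\mathcal H}\|_{\bar{\mathcal L}_1}(L_{f_2}^{\rho_r}\rho_r+b_{f_2}^0)\big)$, $\gamma_2=\big(\|\omega^{-1}\mathcal C\|_{\mathcal L_1}L_{f_1}^\rho+\|\omega^{-1}\mathcal C\bar{\mathcal H}\|_{\bar{\mathcal L}_1}L_{f_2}^\rho\big)\gamma_1+\|\omega^{-1}\|\bar\gamma_0$, $\rho_u=\rho_{ur}+\gamma_2$, and, for $T>0$, $b_\sigma=b_Bc_\Omega(\rho_u+b_{K_x}\rho)+L_f^\rho\rho+b_f^0$, $b_{\dot x}=b_{A_m}\rho+b_B\rho_u\max_{w\in\Omega}\|w\|+L_f^\rho\rho+b_f^0+b_Bc_\Omega b_{K_x}\rho$,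 $b_{\dot u}=\|K\|\big[\rho_u+(b_{B^\dagger}+\|\bar{\mathcal H}\|_{\bar{\mathcal L}_1}b_{B_u^\dagger})e^{-aT}\sqrt n\,b_\sigma+b_{K_r}\|r\|_{\mathcal L_\infty}\big]$, $b_{\tilde\sigma}=2\sqrt n\,T\big[\|\omega-\mathbb I_m\|(b_Bb_{\dot u}+L_Bb_{\dot\theta}\rho_u)+l_{\bar f}^\rho+L_{\bar f}^\rho b_{\dot x}\big]+(1-e^{-aT})\sqrt n\,b_\sigma$, $\beta(t)=\sqrt{\sqrt{\bar\lambda(P_{\mathcal F})/\underline\lambda(P_{\mathcal F})}\,(1-e^{-\mu_{\mathcal F}t})}\;\frac{2}{\mu_{\mathcal F}\underline\lambda(P_{\mathcal F})}\max_{\theta\in\Theta}\|P_{\mathcal F}(\theta)B_{\mathcal F}(\theta)\|$ for $0\le t\le\infty$, $\gamma_0(T,\rho,\rho_u)=b_{C_{\mathcal F}}\Big(\sqrt{\bar\lambda(P_{\mathcal F})/\underline\lambda(P_{\mathcal F})}\;\beta(T)\,b_\sigma+\beta(\infty)\,b_{\tilde\sigma}\Big)$. **Theorem.** Suppose (i)–(v)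 and, for some $\rho_r,\gamma_1>0$, the stability condition $$\|\mathcal G_{xm}\|_{\bar{\mathcal L}_1}(L_{f_1}^\rho\rho_r+b_{f_1}^0)+\|\mathcal G_{xum}\|_{\bar{\mathcal L}_1}(L_{f_2}^\rho\rho_r+b_{f_2}^0)<\rho_r-\|\mathcal H_{xm}\mathcal CK_r\|_{\bar{\mathcal L}_1}\|r\|_{\mathcal L_\infty}-\rho_{\rm in}.$$ 1. Let $\bar\gamma_0>0$ and $T>0$ satisfy $$\frac{\|\mathcal H_{xm}\|_{\bar{\mathcal L}_1}}{1-\|\mathcal G_{xm}\|_{\bar{\mathcal L}_1}L_{f_1}^\rho-\|\mathcal G_{xum}\|_{\bar{\mathcal L}_1}L_{f_2}^\rho}\,\bar\gamma_0<\gamma_1,\qquad \gamma_0(T,\rho,\rho_u)<\bar\gamma_0.$$ Then for every admissible $\theta$, every $f$ as in (iv), all $x_0$ with $\|x_0\|\le\rho_0$, all $\hat x_0$, and all solutions of the adaptive closed-loop system and of the reference system, $$\|x\|_{\mathcal L_\infty}\le\rho,\quad\|u\|_{\mathcal L_\infty}\le\rho_u,\quad\|x_r-x\|_{\mathcal L_\infty}\le\gamma_1,\quad\|u_r-u\|_{\mathcal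 L_\infty}\le\gamma_2,\quad\|y_r-y\|_{\mathcal L_\infty}\le b_C\gamma_1;$$ the same bounds hold on $J$ for solutions that are only given on an interval $J\subseteq[0,\infty)$ containing $0$. 2. $\gamma_0(T,\rho,\rho_u)\to0$ as $T\to0^+$, for every $\bar\gamma_0$; and for every $\varepsilon>0$ there is $T_0>0$ such that for every $T\in(0,T_0)$ and all $\theta,f,x_0,\hat x_0$ and solutions as in part 1 (including those on an interval $J$), $\|x_r-x\|_{\mathcal L_\infty}\le\varepsilon$, $\|u_r-u\|_{\mathcal L_\infty}\le\varepsilon$ and $\|y_r-y\|_{\mathcal L_\infty}\le\varepsilon$. -/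

import Mathlib

open Set Filter Topology MeasureTheory
open scoped ENNReal

noncomputable section

namespace LPV

/-- Euclidean `k`-space (with the 2-norm).  A real `k × l` matrix is represented by the continuous
linear map `Vec l →L[ℝ] Vec k`; its operator norm is the 2-norm of the matrix, its `adjoint` is the
transpose. -/
abbrev Vec (k : ℕ) := EuclideanSpace ℝ (Fin k)

/-- Real `k × l` matrices. -/
abbrev Mat (k l : ℕ) := Vec l →L[ℝ] Vec k

/-- Matrix transpose. -/
def tr {k l : ℕ} (M : Mat k l) : Mat l k := ContinuousLinearMap.adjoint M

/-- The pseudo-inverse `(Mᵀ M)⁻¹ Mᵀ` of a matrix of full column rank. -/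
def pinv {k l : ℕ} (M : Mat k l) : Mat l k := (tr M ∘L M).inverse ∘L tr M

/-- The `(i, j)` entry of a matrix. -/
def entry {k l : ℕ} (M : Mat k l) (i : Fin k) (j : Fin l) : ℝ := M (EuclideanSpace.single j 1) i

/-- Strict row diagonal dominance. -/
def StrictlyRowDiagDominant {k : ℕ} (M : Mat k k) : Prop :=
  ∀ i, ∑ j ∈ Finset.univ.erase i, |entry M i j| < |entry M i i|

/-- All complex eigenvalues of the real matrix `M` have negative real part. -/
def IsHurwitz {k : ℕ} (M : Mat k k) : Prop :=
  ∀ z ∈ ((LinearMap.charpoly (M : Vec k →ₗ[ℝ] Vec k)).map (algebraMap ℝ ℂ)).roots, z.re < 0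

/-- The box `[lo₁, hi₁] × ⋯ × [lo_s, hi_s]`. -/
def box {s : ℕ} (lo hi : Vec s) : Set (Vec s) := {v | ∀ i, lo i ≤ v i ∧ v i ≤ hi i}

/-- `max_{z ∈ S} ‖M z‖`. -/
def maxNorm {Z W : Type*} [Norm W] (S : Set Z) (M : Z → W) : ℝ := sSup ((fun z => ‖M z‖) '' S)

/-! ### Signals and input-output mappings -/

/-- `sup_{t ∈ J} ‖x t‖` in `[0, ∞]`: the `L_∞` norm for `J = [0, ∞)`, the truncated `L_∞` norm for
`J = [0, τ]`. -/
def linf {k : ℕ} (J : Set ℝ) (x : ℝ → Vec k) : ℝ≥0∞ := ⨆ t ∈ J, ‖x t‖ₑ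

/-- `x` is a (Carathéodory) solution of `ẋ(t) = g(t)`, `x(0) = x₀` on the interval `J ∋ 0`. -/
def SolvesOn {k : ℕ} (J : Set ℝ) (x : ℝ → Vec k) (x₀ : Vec k) (g : ℝ → Vec k) : Prop :=
  ∀ t ∈ J, IntervalIntegrable g volume 0 t ∧ x t = x₀ + ∫ ξ in (0 : ℝ)..t, g ξ

/-- Trajectories `θ : [0, ∞) → Θ` of the scheduling parameter with `θ̇(t) ∈ Θd`. -/
def Trajectories {s : ℕ} (Θ Θd : Set (Vec s)) : Set (ℝ → Vec s) :=
  {θ | ∃ θ' : ℝ → Vec s, ∀ t, 0 ≤ t →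
    θ t ∈ Θ ∧ θ' t ∈ Θd ∧ HasDerivWithinAt θ (θ' t) (Ici 0) t}

/-- A `θ`-dependent input-output mapping, given by its graph: `G J θ u y` says that on the time
interval `J` the input `u` produces the output `y` along the parameter trajectory `θ`. -/
abbrev IOMap (s k l : ℕ) := Set ℝ → (ℝ → Vec s) → (ℝ → Vec k) → (ℝ → Vec l) → Prop

/-- A parameter-dependent quadruple of state-space matrices (`d` states, `k` inputs,
`l` outputs). -/
structure StateSpace (s d k l : ℕ) where
  A : Vec s → Mat d d
  B : Vec s → Mat d k
  C : Vec s → Mat l d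
  D : Vec s → Mat l k

namespace StateSpace

variable {s d k l : ℕ}

/-- The input-output mapping of a state-space system with zero initial state. -/
def map (G : StateSpace s d k l) : IOMap s k l := fun J θ u y =>
  ∃ x : ℝ → Vec d,
    SolvesOn J x 0 (fun t => G.A (θ t) (x t) + G.B (θ t) (u t)) ∧
    ∀ t ∈ J, y t = G.C (θ t) (x t) + G.D (θ t) (u t)

/-- All state-space matrices depend continuously on the parameter. -/
def ContOn (G : StateSpace s d k l) (Θ : Set (Vec s)) : Prop :=
  ContinuousOn G.A Θ ∧ ContinuousOn G.B Θ ∧ ContinuousOn G.C Θ ∧ ContinuousOn G.D Θ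

end StateSpace

namespace IOMap

variable {s k l q : ℕ}

/-- The static mapping `y(t) = M(θ(t)) u(t)`. -/
def gain (M : Vec s → Mat l k) : IOMap s k l := fun J θ u y => ∀ t ∈ J, y t = M (θ t) (u t)

/-- The composition `G₂ G₁` (first `G₁`, then `G₂`). -/
def comp (G₂ : IOMap s l q) (G₁ : IOMap s k l) : IOMap s k q := fun J θ u y =>
  ∃ v, G₁ J θ u v ∧ G₂ J θ v y

/-- The sum `G₁ + G₂`. -/
def add (G₁ G₂ : IOMap s k l) : IOMap s k l := fun J θ u y =>
  ∃ y₁ y₂, G₁ J θ u y₁ ∧ G₂ J θ u y₂ ∧ ∀ t ∈ J, y t = y₁ t + y₂ t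

/-- The difference `G₁ - G₂`. -/
def sub (G₁ G₂ : IOMap s k l) : IOMap s k l := fun J θ u y =>
  ∃ y₁ y₂, G₁ J θ u y₁ ∧ G₂ J θ u y₂ ∧ ∀ t ∈ J, y t = y₁ t - y₂ t

/-- The peak-to-peak gain (for a time-invariant system: the `L₁` norm). -/
def ppg (G : IOMap s k l) (adm : Set (ℝ → Vec s)) : ℝ≥0∞ :=
  ⨆ θ ∈ adm, ⨆ (u : ℝ → Vec k) (_ : Measurable u) (_ : linf (Ici 0) u ≤ 1),
    ⨆ (y : ℝ → Vec l) (_ : G (Ici 0) θ u y), linf (Ici 0) y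

/-- `γ > 0` is a bound on the peak-to-peak gain. -/
def IsPPGBound (G : IOMap s k l) (adm : Set (ℝ → Vec s)) (γ : ℝ) : Prop :=
  0 < γ ∧ ∀ θ ∈ adm, ∀ τ : ℝ, 0 ≤ τ → ∀ u : ℝ → Vec k, Measurable u → ∀ y : ℝ → Vec l,
    G (Icc 0 τ) θ u y → linf (Icc 0 τ) y ≤ ENNReal.ofReal γ * linf (Icc 0 τ) u

end IOMap

/-- `S` is a state-space realization of the mapping `G`: along all admissible parameter
trajectories, bounded inputs produce the same outputs. -/
def Realizes {s d k l : ℕ} (S : StateSpace s d k l) (G : IOMap s k l)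
    (adm : Set (ℝ → Vec s)) : Prop :=
  ∀ θ ∈ adm, ∀ τ : ℝ, 0 ≤ τ → ∀ u : ℝ → Vec k, Measurable u → linf (Icc 0 τ) u ≠ ⊤ →
    ∀ y : ℝ → Vec l, S.map (Icc 0 τ) θ u y ↔ G (Icc 0 τ) θ u y

/-! ### Parameter-dependent Lyapunov functions -/

/-- `P(θ)` is a continuously differentiable (with derivative `P'`) parameter-dependent symmetric
matrix and `μ > 0` a constant such that `P(θ) > 0` on `Θ` and
`Aᵀ(θ) P(θ) + P(θ) A(θ) + Ṗ(θ) ≤ -μ P(θ)` for `(θ, θ̇) ∈ Θ × Θd`,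
where `Ṗ(θ) = ∑ᵢ (∂P/∂θᵢ) θ̇ᵢ`. -/
structure IsLyapunov {s d : ℕ} (Θ Θd : Set (Vec s)) (A P : Vec s → Mat d d)
    (P' : Vec s → Vec s →L[ℝ] Mat d d) (μ : ℝ) : Prop where
  mu_pos : 0 < μ
  hasDeriv : ∀ θ ∈ Θ, HasFDerivWithinAt P (P' θ) Θ θ
  deriv_cont : ContinuousOn P' Θ
  symm : ∀ θ ∈ Θ, tr (P θ) = P θ
  pos : ∀ θ ∈ Θ, ∀ x : Vec d, x ≠ 0 → 0 < inner ℝ x (P θ x)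
  lmi : ∀ θ ∈ Θ, ∀ v ∈ Θd, tr (A θ) ∘L P θ + P θ ∘L A θ + P' θ v ≤ -(μ • P θ)

/-- The largest eigenvalue of the positive definite matrices `P(θ)`, `θ ∈ Θ`. -/
def lamMax {s d : ℕ} (Θ : Set (Vec s)) (P : Vec s → Mat d d) : ℝ :=
  sSup {c | ∃ θ ∈ Θ, c ∈ spectrum ℝ (P θ)}

/-- The smallest eigenvalue of the positive definite matrices `P(θ)`, `θ ∈ Θ`. -/
def lamMin {s d : ℕ} (Θ : Set (Vec s)) (P : Vec s → Mat d d) : ℝ :=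
  sInf {c | ∃ θ ∈ Θ, c ∈ spectrum ℝ (P θ)}

/-- `β_Θ(∞, μ, P, B)`. -/
def betaInf {s d k : ℕ} (Θ : Set (Vec s)) (μ : ℝ) (P : Vec s → Mat d d) (B : Vec s → Mat d k) :
    ℝ :=
  Real.sqrt (Real.sqrt (lamMax Θ P / lamMin Θ P)) * (2 / (μ * lamMin Θ P)) *
    maxNorm Θ (fun θ => P θ ∘L B θ)

/-- `β_Θ(t, μ, P, B)`. -/
def beta {s d k : ℕ} (Θ : Set (Vec s)) (t μ : ℝ) (P : Vec s → Mat d d) (B : Vec s → Mat d k) :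
    ℝ :=
  Real.sqrt (Real.sqrt (lamMax Θ P / lamMin Θ P) * (1 - Real.exp (-(μ * t)))) *
    (2 / (μ * lamMin Θ P)) * maxNorm Θ (fun θ => P θ ∘L B θ)

/-! ### The control problem -/

/-- The data of the problem.  Dimensions: `n` states, `m` inputs, `p` outputs, `s` scheduling
parameters, `nH` states of the feedforward mapping, `nF` states of the realization of `𝓕`. -/
structure Setup (n m p s nH nF : ℕ) where
  /-- vertices of the box `Θ` -/
  θlo : Vec s
  θhi : Vec s
  /-- vertices of the box `Θd` -/
  νlo : Vec s
  νhi : Vec s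
  /-- bound on `‖θ̇‖` -/
  bθ' : ℝ
  A : Vec s → Mat n n
  B : Vec s → Mat n m
  /-- the complementary input matrix -/
  Bu : Vec s → Mat n (n - m)
  C : Vec s → Mat p n
  /-- baseline feedback gain -/
  Kx : Vec s → Mat m n
  /-- feedforward gain -/
  Kr : Vec s → Mat m p
  /-- set of possible input gains, and the true input gain -/
  Ω : Set (Mat m m)
  ω : Mat m m
  /-- Lipschitz constants of `B`, `B†`, `Kx` -/
  LB : ℝ
  LBd : ℝ
  LKx : ℝ
  /-- constants of the uncertainty `f` -/
  bf0 : ℝ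
  Lf : ℝ → ℝ
  lf : ℝ
  /-- bound on the initial state -/
  ρ0 : ℝ
  /-- reference signal -/
  r : ℝ → Vec p
  /-- filter gain -/
  K : Mat m m
  /-- predictor gain -/
  a : ℝ
  /-- the feedforward mapping for the unmatched uncertainty -/
  Hbar : StateSpace s nH (n - m) m
  /-- Lyapunov matrix of the ideal closed loop -/
  P : Vec s → Mat n n
  P' : Vec s → Vec s →L[ℝ] Mat n n
  μP : ℝ
  /-- state-space matrices of `𝓕(θ)` -/
  AF : Vec s → Mat nF nF
  BF : Vec s → Mat nF n
  CF : Vec s → Mat m nF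
  /-- Lyapunov matrix of `𝓕(θ)` -/
  PF : Vec s → Mat nF nF
  PF' : Vec s → Vec s →L[ℝ] Mat nF nF
  μF : ℝ
  /-- PPG bounds of `𝓖xm`, `𝓖xum`, `𝓗xm 𝓒 Kr`, `𝓗xm`, `𝓗bar`, `ω⁻¹ 𝓒 𝓗bar` -/
  gGxm : ℝ
  gGxum : ℝ
  gHxmCKr : ℝ
  gHxm : ℝ
  gHbar : ℝ
  gCHbar : ℝ
  /-- bound `ρ_r` for the reference system, and the user-selected `γ₁` -/
  ρr : ℝ
  γ1 : ℝ

namespace Setup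

variable {n m p s nH nF : ℕ} (S : Setup n m p s nH nF)

def Θ : Set (Vec s) := box S.θlo S.θhi

def Θd : Set (Vec s) := box S.νlo S.νhi

/-- Admissible parameter trajectories. -/
def adm : Set (ℝ → Vec s) := Trajectories S.Θ S.Θd

def Am (θ : Vec s) : Mat n n := S.A θ + S.B θ ∘L S.Kx θ

/-- `B†(θ)`. -/
def Bd (θ : Vec s) : Mat m n := pinv (S.B θ)

/-- `Bu†(θ)`. -/
def Bud (θ : Vec s) : Mat (n - m) n := pinv (S.Bu θ)

/-- `ω⁻¹`. -/
def ωinv : Mat m m := S.ω.inverse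

/-! #### Mappings -/

/-- The filter `𝓒(s) = ωK (s I + ωK)⁻¹`. -/
def filter : StateSpace s m m m where
  A := fun _ => -(S.ω ∘L S.K)
  B := fun _ => ContinuousLinearMap.id ℝ (Vec m)
  C := fun _ => S.ω ∘L S.K
  D := fun _ => 0

def mapC : IOMap s m m := S.filter.map

def mapHbar : IOMap s (n - m) m := S.Hbar.map

/-- Input-to-state mapping of `ẋ = Am(θ) x + B(θ) u`. -/
def mapHxm : IOMap s m n :=
  (⟨S.Am, S.B, fun _ => ContinuousLinearMap.id ℝ (Vec n), fun _ => 0⟩ : StateSpace s n m n).map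

/-- Input-to-state mapping of `ẋ = Am(θ) x + Bu(θ) u`. -/
def mapHxum : IOMap s (n - m) n :=
  (⟨S.Am, S.Bu, fun _ => ContinuousLinearMap.id ℝ (Vec n), fun _ => 0⟩ :
    StateSpace s n (n - m) n).map

/-- `𝓖xm = 𝓗xm (I - 𝓒)`. -/
def mapGxm : IOMap s m n :=
  IOMap.comp S.mapHxm (IOMap.sub (IOMap.gain fun _ => ContinuousLinearMap.id ℝ (Vec m)) S.mapC)

/-- `𝓖xum = 𝓗xum - 𝓗xm 𝓒 𝓗bar`. -/
def mapGxum : IOMap s (n - m) n :=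
  IOMap.sub S.mapHxum (IOMap.comp S.mapHxm (IOMap.comp S.mapC S.mapHbar))

/-- `𝓗xm 𝓒 Kr`. -/
def mapHxmCKr : IOMap s p n :=
  IOMap.comp S.mapHxm (IOMap.comp S.mapC (IOMap.gain S.Kr))

/-- `ω⁻¹ 𝓒`. -/
def mapωC : IOMap s m m := IOMap.comp (IOMap.gain fun _ => S.ωinv) S.mapC

/-- `ω⁻¹ 𝓒 𝓗bar`. -/
def mapωCHbar : IOMap s (n - m) m := IOMap.comp S.mapωC S.mapHbar

/-- `𝓕 = 𝓒 (B† + 𝓗bar Bu†)`. -/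
def mapF : IOMap s n m :=
  IOMap.comp S.mapC
    (IOMap.add (IOMap.gain S.Bd) (IOMap.comp S.mapHbar (IOMap.gain S.Bud)))

/-- The system with the state-space matrices `(AF, BF, CF, 0)`. -/
def sysF : StateSpace s nF n m := ⟨S.AF, S.BF, S.CF, fun _ => 0⟩

/-! #### Constants -/

def bAm : ℝ := maxNorm S.Θ S.Am
def bB : ℝ := maxNorm S.Θ S.B
def bBd : ℝ := maxNorm S.Θ S.Bd
def bBud : ℝ := maxNorm S.Θ S.Bud
def bC : ℝ := maxNorm S.Θ S.C
def bKx : ℝ := maxNorm S.Θ S.Kx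
def bKr : ℝ := maxNorm S.Θ S.Kr

/-- `max_{ω ∈ Ω} ‖ω‖`. -/
def maxω : ℝ := maxNorm S.Ω (fun w => w)

/-- `max_{ω ∈ Ω} ‖ω - I‖`. -/
def maxωI : ℝ := maxNorm S.Ω (fun w => w - ContinuousLinearMap.id ℝ (Vec m))

/-- `‖r‖` in `L_∞`. -/
def rNorm : ℝ := (linf (Ici 0) S.r).toReal

def bf10 : ℝ := S.bBd * S.bf0
def bf20 : ℝ := S.bBud * S.bf0

/-- Lipschitz constant in `x` of the matched component `f₁` on the ball of radius `δ`. -/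
def Lf1 (δ : ℝ) : ℝ :=
  S.Lf δ * S.bBd +
    maxNorm (S.Ω ×ˢ S.Θ) (fun z => (z.1 - ContinuousLinearMap.id ℝ (Vec m)) ∘L S.Kx z.2)

/-- Lipschitz constant in `x` of the unmatched component `f₂` on the ball of radius `δ`. -/
def Lf2 (δ : ℝ) : ℝ := S.Lf δ * S.bBud

/-- Lipschitz constant in `x` of `f + B(θ)(ω - I)Kx(θ)x` on the ball of radius `δ`. -/
def Lfbar (δ : ℝ) : ℝ :=
  S.Lf δ + maxNorm (S.Ω ×ˢ S.Θ)
    (fun z => S.B z.2 ∘L (z.1 - ContinuousLinearMap.id ℝ (Vec m)) ∘L S.Kx z.2)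

/-- Lipschitz constant in `t` of `f + B(θ(t))(ω - I)Kx(θ(t))x` on the ball of radius `δ`. -/
def lfbar (δ : ℝ) : ℝ :=
  S.lf + S.maxωI * (S.LB * S.bKx + S.bB * S.LKx) * δ * S.bθ'

def ρin : ℝ := S.ρ0 * Real.sqrt (lamMax S.Θ S.P / lamMin S.Θ S.P)

def ρ : ℝ := S.ρr + S.γ1

/-- The `L₁` norm of `ω⁻¹ 𝓒(s)`. -/
def l1ωC : ℝ := (IOMap.ppg S.mapωC S.adm).toReal

def ρur : ℝ :=
  S.l1ωC * (S.bKr * S.rNorm + S.Lf1 S.ρr * S.ρr + S.bf10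
    + S.gHbar * (S.Lf2 S.ρr * S.ρr + S.bf20))

def γ2 (γ0bar : ℝ) : ℝ :=
  (S.l1ωC * S.Lf1 S.ρ + S.gCHbar * S.Lf2 S.ρ) * S.γ1 + ‖S.ωinv‖ * γ0bar

def ρu (γ0bar : ℝ) : ℝ := S.ρur + S.γ2 γ0bar

/-- `b_σ(ρ, ρ_u)`. -/
def bσ (ρ ρu : ℝ) : ℝ := S.bB * S.maxωI * (ρu + S.bKx * ρ) + S.Lf ρ * ρ + S.bf0

/-- `b_ẋ(ρ, ρ_u)`. -/
def bx' (ρ ρu : ℝ) : ℝ :=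
  S.bAm * ρ + S.bB * ρu * S.maxω + S.Lf ρ * ρ + S.bf0 + S.bB * S.maxωI * S.bKx * ρ

/-- `b_{σ̂c}(ρ, ρ_u)`. -/
def bσhatc (T ρ ρu : ℝ) : ℝ := Real.exp (-(S.a * T)) * Real.sqrt n * S.bσ ρ ρu

/-- `b_u̇(ρ, ρ_u)`. -/
def bu' (T ρ ρu : ℝ) : ℝ :=
  ‖S.K‖ * (ρu + (S.bBd + S.gHbar * S.bBud) * S.bσhatc T ρ ρu + S.bKr * S.rNorm)

/-- `b_{σ̃}(ρ, ρ_u)`. -/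
def bσtil (T ρ ρu : ℝ) : ℝ :=
  2 * Real.sqrt n * T *
      (‖S.ω - ContinuousLinearMap.id ℝ (Vec m)‖ * (S.bB * S.bu' T ρ ρu + S.LB * S.bθ' * ρu)
        + S.lfbar ρ + S.Lfbar ρ * S.bx' ρ ρu)
    + (1 - Real.exp (-(S.a * T))) * Real.sqrt n * S.bσ ρ ρu

/-- `γ₀(T, ρ, ρ_u)`. -/
def γ0 (T ρ ρu : ℝ) : ℝ :=
  maxNorm S.Θ S.CF *
    (Real.sqrt (lamMax S.Θ S.PF / lamMin S.Θ S.PF) * beta S.Θ T S.μF S.PF S.BF * S.bσ ρ ρu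
      + betaInf S.Θ S.μF S.PF S.BF * S.bσtil T ρ ρu)

/-! #### Assumptions -/

/-- The standing assumptions on the plant, the baseline controller and the design. -/
structure Assumptions : Prop where
  /-- bound on the parameter rate -/
  rate_bound : ∀ v ∈ S.Θd, ‖v‖ ≤ S.bθ'
  /-- continuity of the parameter-dependent matrices -/
  A_cont : ContinuousOn S.A S.Θ
  Bu_cont : ContinuousOn S.Bu S.Θ
  C_cont : ContinuousOn S.C S.Θ
  Kr_cont : ContinuousOn S.Kr S.Θ
  Hbar_cont : S.Hbar.ContOn S.Θ
  sysF_cont : S.sysF.ContOn S.Θ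
  /-- Lyapunov stability of the ideal closed-loop system -/
  lyap : IsLyapunov S.Θ S.Θd S.Am S.P S.P' S.μP
  /-- partial knowledge of the input gain; `Ω` is a convex polytope containing `ω` and `I` -/
  ω_dom : StrictlyRowDiagDominant S.ω
  ω_mem : S.ω ∈ S.Ω
  Ω_polytope : ∃ V : Set (Mat m m), V.Finite ∧ S.Ω = convexHull ℝ V
  id_mem : ContinuousLinearMap.id ℝ (Vec m) ∈ S.Ω
  /-- `B` has full column rank; `B`, `B†` and `Kx` are Lipschitz -/
  B_inj : ∀ θ ∈ S.Θ, Function.Injective (S.B θ)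
  LB_pos : 0 < S.LB
  LBd_pos : 0 < S.LBd
  LKx_pos : 0 < S.LKx
  B_lip : ∀ θ₁ ∈ S.Θ, ∀ θ₂ ∈ S.Θ, ‖S.B θ₁ - S.B θ₂‖ ≤ S.LB * ‖θ₁ - θ₂‖
  Bd_lip : ∀ θ₁ ∈ S.Θ, ∀ θ₂ ∈ S.Θ, ‖S.Bd θ₁ - S.Bd θ₂‖ ≤ S.LBd * ‖θ₁ - θ₂‖
  Kx_lip : ∀ θ₁ ∈ S.Θ, ∀ θ₂ ∈ S.Θ, ‖S.Kx θ₁ - S.Kx θ₂‖ ≤ S.LKx * ‖θ₁ - θ₂‖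
  /-- `[B, Bu]` has rank `n` and `Bᵀ Bu = 0` -/
  Bbar_rank : ∀ θ ∈ S.Θ, ∀ z : Vec n, ∃ v w, S.B θ v + S.Bu θ w = z
  B_orth : ∀ θ ∈ S.Θ, tr (S.B θ) ∘L S.Bu θ = 0
  /-- positivity of the constants of the uncertainty -/
  Lf_pos : ∀ δ, 0 < δ → 0 < S.Lf δ
  lf_pos : 0 < S.lf
  ρ0_pos : 0 < S.ρ0
  /-- the reference signal is measurable and bounded -/
  r_meas : Measurable S.r
  r_bdd : linf (Ici 0) S.r ≠ ⊤
  /-- the filter is stable for every possible input gain; the predictor gain is positive -/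
  filter_stable : ∀ w ∈ S.Ω, IsHurwitz (-(w ∘L S.K))
  a_pos : 0 < S.a
  /-- `(AF, BF, CF)` realizes `𝓕(θ)` and admits a parameter-dependent Lyapunov function -/
  realF : Realizes S.sysF S.mapF S.adm
  lyapF : IsLyapunov S.Θ S.Θd S.AF S.PF S.PF' S.μF
  /-- PPG bounds -/
  ppg_Gxm : IOMap.IsPPGBound S.mapGxm S.adm S.gGxm
  ppg_Gxum : IOMap.IsPPGBound S.mapGxum S.adm S.gGxum
  ppg_HxmCKr : IOMap.IsPPGBound S.mapHxmCKr S.adm S.gHxmCKr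
  ppg_Hxm : IOMap.IsPPGBound S.mapHxm S.adm S.gHxm
  ppg_Hbar : IOMap.IsPPGBound S.mapHbar S.adm S.gHbar
  ppg_CHbar : IOMap.IsPPGBound S.mapωCHbar S.adm S.gCHbar

/-- The stability condition. -/
def StabilityCondition : Prop :=
  S.gGxm * (S.Lf1 S.ρ * S.ρr + S.bf10) + S.gGxum * (S.Lf2 S.ρ * S.ρr + S.bf20) <
    S.ρr - S.gHxmCKr * S.rNorm - S.ρin

/-- The constraint linking `γ̄₀` and `γ₁`. -/
def GammaConstraint (γ0bar : ℝ) : Prop :=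
  S.gHxm / (1 - S.gGxm * S.Lf1 S.ρ - S.gGxum * S.Lf2 S.ρ) * γ0bar < S.γ1

/-- The assumptions on the unknown nonlinearity `f(t, x)`: uniform boundedness of `f(t, 0)`,
semiglobal Lipschitz continuity in `x`, and Lipschitz continuity in `t`. -/
structure Uncertainty (f : ℝ → Vec n → Vec n) : Prop where
  zero_bound : ∀ t, 0 ≤ t → ‖f t 0‖ ≤ S.bf0
  lip_x : ∀ δ, 0 < δ → ∀ t, 0 ≤ t → ∀ x₁ x₂, ‖x₁‖ ≤ δ → ‖x₂‖ ≤ δ →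
    ‖f t x₁ - f t x₂‖ ≤ S.Lf δ * ‖x₁ - x₂‖
  lip_t : ∀ x t₁ t₂, 0 ≤ t₁ → 0 ≤ t₂ → ‖f t₁ x - f t₂ x‖ ≤ S.lf * |t₁ - t₂|

/-! #### The closed-loop systems -/

/-- `(x, u, y)` are the state, the adaptive input and the output on the time interval `J` of the
plant under `u_total = Kx(θ) x + u`, where `u` is generated by the state predictor (state `xh`,
initial state `xh₀`), the piecewise-constant adaptive law with sampling time `T` (estimate `σh`),
and the filtered control law. -/
def AdaptiveSolution (T : ℝ) (f : ℝ → Vec n → Vec n) (θ : ℝ → Vec s) (x₀ xh₀ : Vec n) (J : Set ℝ)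
    (x : ℝ → Vec n) (u : ℝ → Vec m) (y : ℝ → Vec p) : Prop :=
  ∃ (xh σh σc : ℝ → Vec n) (σm : ℝ → Vec m) (σum : ℝ → Vec (n - m)) (ηh₂ : ℝ → Vec m),
    -- plant
    SolvesOn J x x₀ (fun t =>
      S.A (θ t) (x t) + S.B (θ t) (S.ω (S.Kx (θ t) (x t) + u t)) + f t (x t)) ∧
    (∀ t ∈ J, y t = S.C (θ t) (x t)) ∧
    -- state predictor
    SolvesOn J xh xh₀ (fun t =>
      S.Am (θ t) (x t) + S.B (θ t) (u t) + σh t - S.a • (xh t - x t)) ∧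
    -- adaptive law
    (∀ i : ℕ, ∀ t ∈ J, i * T ≤ t → t < (i + 1) * T →
      σh t = -((S.a / (Real.exp (S.a * T) - 1)) • (xh (i * T) - x (i * T)))) ∧
    (∀ t ∈ J, t < T → σc t = 0) ∧
    (∀ t ∈ J, T ≤ t → σc t = σh t) ∧
    -- matched and unmatched components: `[σm; σum] = [B, Bu]⁻¹ σc`
    (∀ t ∈ J, S.B (θ t) (σm t) + S.Bu (θ t) (σum t) = σc t) ∧
    -- control law
    S.mapHbar J θ σum ηh₂ ∧
    SolvesOn J u 0 (fun t => -(S.K (u t + σm t + ηh₂ t - S.Kr (θ t) (S.r t))))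

/-- `(xr, ur, yr)` are the state, input and output on `J` of the non-adaptive reference system;
`η₁(t) = f₁(t, xr(t))` and `η₂(t) = f₂(t, xr(t))` are defined by
`B(θ) f₁ + Bu(θ) f₂ = f + B(θ)(ω - I)Kx(θ)x`, and
`ur = -ω⁻¹ 𝓒 (η₁ + 𝓗bar(θ) η₂ - Kr(θ) r)`. -/
def ReferenceSolution (f : ℝ → Vec n → Vec n) (θ : ℝ → Vec s) (x₀ : Vec n) (J : Set ℝ)
    (xr : ℝ → Vec n) (ur : ℝ → Vec m) (yr : ℝ → Vec p) : Prop :=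
  ∃ (η₁ : ℝ → Vec m) (η₂ : ℝ → Vec (n - m)) (h c : ℝ → Vec m),
    (∀ t ∈ J, S.B (θ t) (η₁ t) + S.Bu (θ t) (η₂ t) =
      f t (xr t) + S.B (θ t) (S.ω (S.Kx (θ t) (xr t)) - S.Kx (θ t) (xr t))) ∧
    SolvesOn J xr x₀ (fun t =>
      S.Am (θ t) (xr t) + S.B (θ t) (S.ω (ur t) + η₁ t) + S.Bu (θ t) (η₂ t)) ∧
    S.mapHbar J θ η₂ h ∧
    S.mapC J θ (fun t => η₁ t + h t - S.Kr (θ t) (S.r t)) c ∧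
    (∀ t ∈ J, ur t = -(S.ωinv (c t))) ∧
    (∀ t ∈ J, yr t = S.C (θ t) (xr t))

/-- For sampling time `T`, the property `Q J x u y xr ur yr` holds for every admissible parameter
trajectory, uncertainty, initial state with `‖x₀‖ ≤ ρ₀`, predictor initial state, interval `J` with
left end `0` (in particular `J = [0, ∞)`), and all solutions of the adaptive closed-loop system and
of the reference system on `J`. -/
def ForAllRuns (T : ℝ) (Q : Set ℝ → (ℝ → Vec n) → (ℝ → Vec m) → (ℝ → Vec p) →
    (ℝ → Vec n) → (ℝ → Vec m) → (ℝ → Vec p) → Prop) : Prop :=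
  ∀ θ ∈ S.adm, ∀ f : ℝ → Vec n → Vec n, S.Uncertainty f →
    ∀ x₀ xh₀ : Vec n, ‖x₀‖ ≤ S.ρ0 →
    ∀ J : Set ℝ, J.OrdConnected → 0 ∈ J → J ⊆ Ici 0 →
    ∀ (x : ℝ → Vec n) (u : ℝ → Vec m) (y : ℝ → Vec p), S.AdaptiveSolution T f θ x₀ xh₀ J x u y →
    ∀ (xr : ℝ → Vec n) (ur : ℝ → Vec m) (yr : ℝ → Vec p), S.ReferenceSolution f θ x₀ J xr ur yr →
    Q J x u y xr ur yr

end Setup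

end LPV

end

namespace LPV

/-! ### Carathéodory solutions -/

section Solutions

variable {k l : ℕ} {J : Set ℝ} {τ : ℝ}

/-! The loop sees the lumped uncertainty σ = B(ω − I)u + f̄(t, x) (`Setup.sigma`). The prediction
error x̃ = x̂ − x obeys x̃' = −a x̃ + σ̂ − σ, and the gain a/(e^{aT} − 1) is the one for which the
held estimate cancels the inherited error e^{−aT} x̃(iT) exactly. Whatever x̂₀ was, x̃ at the end of
a period therefore depends only on σ during that period, and the next estimate is an average of σ
with total weight e^{−aT} (`norm_estimate_sub_le`). As long as ‖x‖ ≤ ρ and ‖u‖ ≤ ρ_u, σ is bounded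
by b_σ and Lipschitz in time, so σ − σ̂_c is at most b_σ on [0, T), where σ̂_c = 0, and at most b_σ̃
afterwards.

Writing σ̂_c = σ − (σ − σ̂_c) in the control law gives −ωu = 𝓒(f₁ + 𝓗bar f₂ − K_r r − φ). This is
the reference law except for φ, and 𝓒φ = 𝓕(σ − σ̂_c). The Lyapunov function of 𝓕 shows that an input
acting only for a time T has an effect of order β(T); hence ‖𝓒φ‖ ≤ γ₀ (`norm_F_le`,
`AdaptiveSolution.exists_response`).

The deviation e = x_r − x starts at zero and equals 𝓖xm Δf₁ + 𝓖xum Δf₂ − 𝓗xm 𝓒φ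
(`exists_decomposition`). Since Δf₁ and Δf₂ are Lipschitz in e and the stability condition makes the
loop gain smaller than 1, a small-gain argument bounds e, and then u_r − u, by multiples of γ₀
(`norm_error_le`).

These estimates presuppose bounds on x and u. A continuation argument supplies them
(`forall_lt_of_self_improving`): the stability condition confines x_r below ρ_r, and while the
deviations do not exceed γ₁ and γ₂, the estimates give strictly smaller values because γ₀ < γ̄₀. For
the second part, γ₀ is continuous in T and vanishes at T = 0.

Everything is proved on compact intervals [0, τ]. One preliminary fact has its own proof: the L₁
norm of ω⁻¹𝓒 enters through `toReal`, so its finiteness has to be derived from the Hurwitz property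
(`IsHurwitz.exists_bound`). -/

theorem SolvesOn.mono {J' : Set ℝ} {x g : ℝ → Vec k} {x₀ : Vec k} (h : SolvesOn J x x₀ g)
    (hJ : J' ⊆ J) : SolvesOn J' x x₀ g := fun t ht => h t (hJ ht)

theorem SolvesOn.congr_rhs {x g g' : ℝ → Vec k} {x₀ : Vec k}
    (h : SolvesOn (Icc 0 τ) x x₀ g) (hg : ∀ t ∈ Icc 0 τ, g t = g' t) :
    SolvesOn (Icc 0 τ) x x₀ g' := by
  intro t ht
  have hsub : ∀ ξ ∈ uIcc 0 t, g ξ = g' ξ := by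
    intro ξ hξ
    rw [uIcc_of_le ht.1] at hξ
    exact hg ξ ⟨hξ.1, hξ.2.trans ht.2⟩
  refine ⟨(h t ht).1.congr ?_, ?_⟩
  · intro ξ hξ
    exact hsub ξ (uIoc_subset_uIcc hξ)
  · rw [(h t ht).2, intervalIntegral.integral_congr hsub]

theorem SolvesOn.congr_state {x x' g : ℝ → Vec k} {x₀ : Vec k}
    (h : SolvesOn J x x₀ g) (hx : ∀ t ∈ J, x' t = x t) : SolvesOn J x' x₀ g :=
  fun t ht => ⟨(h t ht).1, (hx t ht).trans (h t ht).2⟩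

theorem SolvesOn.clm {x g : ℝ → Vec k} {x₀ : Vec k} (h : SolvesOn J x x₀ g) (L : Mat l k) :
    SolvesOn J (fun t => L (x t)) (L x₀) (fun t => L (g t)) := by
  intro t ht
  have hi := (h t ht).1
  refine ⟨⟨L.integrable_comp hi.1, L.integrable_comp hi.2⟩, ?_⟩
  simp only
  rw [(h t ht).2, map_add, ContinuousLinearMap.intervalIntegral_comp_comm L hi]

theorem SolvesOn.neg {x g : ℝ → Vec k} {x₀ : Vec k} (h : SolvesOn J x x₀ g) :
    SolvesOn J (fun t => -x t) (-x₀) (fun t => -g t) := by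
  simpa using h.clm (-(ContinuousLinearMap.id ℝ (Vec k)))

theorem SolvesOn.add {x g y h : ℝ → Vec k} {x₀ y₀ : Vec k} (hx : SolvesOn J x x₀ g)
    (hy : SolvesOn J y y₀ h) :
    SolvesOn J (fun t => x t + y t) (x₀ + y₀) (fun t => g t + h t) := by
  intro t ht
  refine ⟨(hx t ht).1.add (hy t ht).1, ?_⟩
  rw [intervalIntegral.integral_add (hx t ht).1 (hy t ht).1]
  simp only
  rw [(hx t ht).2, (hy t ht).2]
  abel

theorem SolvesOn.sub {x g y h : ℝ → Vec k} {x₀ y₀ : Vec k} (hx : SolvesOn J x x₀ g)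
    (hy : SolvesOn J y y₀ h) :
    SolvesOn J (fun t => x t - y t) (x₀ - y₀) (fun t => g t - h t) := by
  simpa [sub_eq_add_neg] using hx.add hy.neg

theorem SolvesOn.continuousOn {x g : ℝ → Vec k} {x₀ : Vec k} (hτ : 0 ≤ τ)
    (h : SolvesOn (Icc 0 τ) x x₀ g) : ContinuousOn x (Icc 0 τ) := by
  have hi := (h τ ⟨hτ, le_rfl⟩).1
  have hc : ContinuousOn (fun t => x₀ + ∫ ξ in (0 : ℝ)..t, g ξ) (Icc 0 τ) := by
    refine continuousOn_const.add ?_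
    have := intervalIntegral.continuousOn_primitive_interval (f := g) (μ := volume) (a := 0)
      (b := τ) (by
        rw [uIcc_of_le hτ, integrableOn_Icc_iff_integrableOn_Ioc]
        exact hi.1)
    rwa [uIcc_of_le hτ] at this
  exact hc.congr fun t ht => (h t ht).2

theorem SolvesOn.zero_apply {x g : ℝ → Vec k} {x₀ : Vec k} (h : SolvesOn J x x₀ g)
    (h0 : 0 ∈ J) : x 0 = x₀ := by
  simpa using (h 0 h0).2

theorem SolvesOn.sub_eq_integral {x g : ℝ → Vec k} {x₀ : Vec k}
    (h : SolvesOn (Icc 0 τ) x x₀ g) {t₁ t₂ : ℝ} (h₁ : t₁ ∈ Icc 0 τ) (h₂ : t₂ ∈ Icc 0 τ) :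
    IntervalIntegrable g volume t₁ t₂ ∧ x t₂ - x t₁ = ∫ ξ in t₁..t₂, g ξ := by
  refine ⟨(h t₁ h₁).1.symm.trans (h t₂ h₂).1, ?_⟩
  rw [(h t₁ h₁).2, (h t₂ h₂).2,
    ← intervalIntegral.integral_interval_sub_left (h t₂ h₂).1 (h t₁ h₁).1]
  abel

/-- A bound on the right-hand side is a Lipschitz constant of the solution. -/
theorem SolvesOn.norm_sub_le {x g : ℝ → Vec k} {x₀ : Vec k} {c : ℝ}
    (h : SolvesOn (Icc 0 τ) x x₀ g) (hc : ∀ t ∈ Icc 0 τ, ‖g t‖ ≤ c)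
    {t₁ t₂ : ℝ} (h₁ : t₁ ∈ Icc 0 τ) (h₂ : t₂ ∈ Icc 0 τ) : ‖x t₂ - x t₁‖ ≤ c * |t₂ - t₁| := by
  rw [(h.sub_eq_integral h₁ h₂).2]
  refine intervalIntegral.norm_integral_le_of_norm_le_const fun ξ hξ => hc ξ ?_
  have := uIoc_subset_uIcc hξ
  exact (ordConnected_Icc.uIcc_subset h₁ h₂) this

/-- A solution is right differentiable where its right-hand side is right continuous. -/
theorem SolvesOn.hasDerivWithinAt_right {x g : ℝ → Vec k} {x₀ : Vec k}
    (h : SolvesOn (Icc 0 τ) x x₀ g) {t : ℝ} (ht : t ∈ Ico 0 τ)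
    (hg : ContinuousWithinAt g (Ici t) t) : HasDerivWithinAt x (g t) (Ici t) t := by
  have hτ : 0 ≤ τ := ht.1.trans ht.2.le
  have hi := (h t ⟨ht.1, ht.2.le⟩).1
  have hiτ := (h τ ⟨hτ, le_rfl⟩).1
  have hd : HasDerivWithinAt (fun s => x₀ + ∫ ξ in (0 : ℝ)..s, g ξ) (g t) (Ici t) t := by
    refine HasDerivWithinAt.const_add _ ?_
    refine intervalIntegral.integral_hasDerivWithinAt_right hi ?_ (hg.mono Ioi_subset_Ici_self)
    refine ⟨Ioc t τ, Ioc_mem_nhdsGT ht.2, ?_⟩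
    exact hiτ.1.aestronglyMeasurable.mono_measure
      (Measure.restrict_mono (Ioc_subset_Ioc_left ht.1) le_rfl)
  refine hd.congr_of_eventuallyEq ?_ (h t ⟨ht.1, ht.2.le⟩).2
  have : Icc t τ ∈ 𝓝[≥] t := Icc_mem_nhdsGE ht.2
  filter_upwards [this] with s hs
  exact (h s ⟨ht.1.trans hs.1, hs.2⟩).2

end Solutions

/-- Solutions constrain signals only on `[0, τ]`, while the gain bounds ask for inputs that are
measurable on the whole line. Replacing a signal by such an extension closes this gap. -/
theorem exists_continuous_extension {W : Type*} [TopologicalSpace W] {τ : ℝ} (hτ : 0 ≤ τ)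
    {u : ℝ → W} (hu : ContinuousOn u (Icc 0 τ)) :
    ∃ u' : ℝ → W, Continuous u' ∧ ∀ t ∈ Icc 0 τ, u' t = u t :=
  ⟨IccExtend hτ ((Icc 0 τ).domRestrict u),
    (continuousOn_iff_continuous_domRestrict.1 hu).Icc_extend',
    fun t ht => by simp [IccExtend_of_mem hτ _ ht]⟩

/-! ### Linear equations -/

section Linear

variable {E : Type*} [NormedAddCommGroup E] [NormedSpace ℝ E] [CompleteSpace E]

/-- Linear Volterra equations with a bounded continuous kernel are solvable. -/
theorem exists_volterra_solution {τ : ℝ} (hτ : 0 ≤ τ) {A : ℝ → E →L[ℝ] E} {y : ℝ → E}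
    (hA : Continuous A) (hy : Continuous y) :
    ∃ x : ℝ → E, Continuous x ∧ ∀ t ∈ Icc 0 τ, x t = y t + ∫ ξ in (0 : ℝ)..t, A ξ (x ξ) := by
  obtain ⟨L, hL⟩ := isCompact_Icc.exists_bound_of_continuousOn (s := Icc (0 : ℝ) τ)
    hA.continuousOn
  have hL0 : 0 ≤ L := (norm_nonneg _).trans (hL 0 ⟨le_rfl, hτ⟩)
  -- Substituting `x = exp(q t) w` weights the sup norm exponentially. The integral operator then
  -- has Lipschitz constant at most `L / q < 1 / 2`, so one contraction covers the whole interval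
  -- whatever its length.
  set q : ℝ := 2 * L + 1 with hq
  have hq0 : 0 < q := by positivity
  let pr : ℝ → Icc (0 : ℝ) τ := projIcc 0 τ hτ
  have hpr : Continuous pr := continuous_projIcc
  let Φ : C(Icc (0 : ℝ) τ, E) → C(Icc (0 : ℝ) τ, E) := fun w =>
    { toFun := fun t => Real.exp (-(q * t)) •
        (y t + ∫ ξ in (0 : ℝ)..t, Real.exp (q * ξ) • A ξ (w (pr ξ)))
      continuous_toFun := by
        have hc : Continuous fun ξ : ℝ => Real.exp (q * ξ) • A ξ (w (pr ξ)) := by fun_prop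
        have h2 : Continuous fun t : ℝ => ∫ ξ in (0 : ℝ)..t, Real.exp (q * ξ) • A ξ (w (pr ξ)) :=
          intervalIntegral.continuous_primitive (fun a b => hc.intervalIntegrable a b) 0
        fun_prop }
  have hΦ : ContractingWith (1 / 2) Φ := by
    refine ⟨by rw [← NNReal.coe_lt_coe]; norm_num, LipschitzWith.of_dist_le_mul fun w v => ?_⟩
    rw [ContinuousMap.dist_le (by positivity)]
    rintro ⟨t, ht⟩
    have hcw : ∀ w : C(Icc (0 : ℝ) τ, E),
        Continuous fun ξ : ℝ => Real.exp (q * ξ) • A ξ (w (pr ξ)) := fun w => by fun_prop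
    have hdiff : Φ w ⟨t, ht⟩ - Φ v ⟨t, ht⟩ = Real.exp (-(q * t)) •
        ∫ ξ in (0 : ℝ)..t, Real.exp (q * ξ) • A ξ (w (pr ξ) - v (pr ξ)) := by
      simp only [Φ, ContinuousMap.coe_mk]
      rw [← smul_sub, add_sub_add_left_eq_sub, ← intervalIntegral.integral_sub
        ((hcw w).intervalIntegrable _ _) ((hcw v).intervalIntegrable _ _)]
      simp only [map_sub, smul_sub]
    have hint : ‖∫ ξ in (0 : ℝ)..t, Real.exp (q * ξ) • A ξ (w (pr ξ) - v (pr ξ))‖ ≤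
        ∫ ξ in (0 : ℝ)..t, L * dist w v * Real.exp (q * ξ) := by
      refine intervalIntegral.norm_integral_le_of_norm_le ht.1 ?_ ?_
      · refine Eventually.of_forall fun ξ hξ => ?_
        have h1 : ‖A ξ (w (pr ξ) - v (pr ξ))‖ ≤ L * dist w v := by
          refine (A ξ).le_of_opNorm_le_of_le (hL ξ ⟨hξ.1.le, hξ.2.trans ht.2⟩) ?_
          rw [← dist_eq_norm]
          exact ContinuousMap.dist_apply_le_dist _
        rw [norm_smul, Real.norm_of_nonneg (Real.exp_pos _).le, mul_comm]
        exact mul_le_mul_of_nonneg_right h1 (Real.exp_pos _).le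
      · exact Continuous.intervalIntegrable (by fun_prop) _ _
    have hval : ∫ ξ in (0 : ℝ)..t, L * dist w v * Real.exp (q * ξ) =
        L * dist w v * ((Real.exp (q * t) - 1) / q) := by
      rw [intervalIntegral.integral_const_mul, intervalIntegral.integral_comp_mul_left
        (fun x => Real.exp x) hq0.ne']
      simp
      left
      field_simp
    rw [dist_eq_norm, hdiff, norm_smul, Real.norm_of_nonneg (Real.exp_pos _).le]
    calc Real.exp (-(q * t)) * _ ≤ Real.exp (-(q * t)) *
          (L * dist w v * ((Real.exp (q * t) - 1) / q)) := by
          rw [← hval]; exact mul_le_mul_of_nonneg_left hint (Real.exp_pos _).le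
      _ = L / q * (1 - Real.exp (-(q * t))) * dist w v := by
          rw [Real.exp_neg]
          have := (Real.exp_pos (q * t)).ne'
          field_simp
      _ ≤ (1 / 2) * 1 * dist w v := by
          have h1 : L / q ≤ 1 / 2 := by rw [div_le_div_iff₀ hq0 two_pos]; linarith
          have h2 : 1 - Real.exp (-(q * t)) ≤ 1 := by linarith [Real.exp_pos (-(q * t))]
          have h3 : 0 ≤ 1 - Real.exp (-(q * t)) := by
            have : Real.exp (-(q * t)) ≤ 1 := Real.exp_le_one_iff.2 (by nlinarith [ht.1])
            linarith
          exact mul_le_mul_of_nonneg_right (mul_le_mul h1 h2 h3 (by norm_num)) dist_nonneg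
      _ = ((1 / 2 : NNReal) : ℝ) * dist w v := by push_cast; ring
  set w := ContractingWith.fixedPoint Φ hΦ with hw
  have hfix : Φ w = w := hΦ.fixedPoint_isFixedPt
  refine ⟨fun t => Real.exp (q * t) • w (pr t), by fun_prop, fun t ht => ?_⟩
  have h1 : w (pr t) = Real.exp (-(q * t)) •
        (y t + ∫ ξ in (0 : ℝ)..t, Real.exp (q * ξ) • A ξ (w (pr ξ))) := by
    have h2 : pr t = ⟨t, ht⟩ := projIcc_of_mem hτ ht
    conv_lhs => rw [← hfix, h2]
    rfl
  simp only [map_smul]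
  rw [h1, smul_smul, ← Real.exp_add]
  simp

variable {k : ℕ}

/-- Global solvability of linear equations with continuous coefficients. -/
theorem exists_solvesOn_linear {τ : ℝ} (hτ : 0 ≤ τ) {A : ℝ → Mat k k} {g : ℝ → Vec k}
    (hA : ContinuousOn A (Icc 0 τ)) (hg : ContinuousOn g (Icc 0 τ)) (x₀ : Vec k) :
    ∃ x, SolvesOn (Icc 0 τ) x x₀ (fun t => A t (x t) + g t) := by
  obtain ⟨A', hA', hAe⟩ := exists_continuous_extension hτ hA
  obtain ⟨g', hg', hge⟩ := exists_continuous_extension hτ hg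
  obtain ⟨x, hxc, hx⟩ := exists_volterra_solution hτ (A := A')
    (y := fun t => x₀ + ∫ ξ in (0 : ℝ)..t, g' ξ) hA'
    (continuous_const.add
      (intervalIntegral.continuous_primitive (fun a b => hg'.intervalIntegrable a b) 0))
  have hc1 : Continuous fun ξ => A' ξ (x ξ) := by fun_prop
  have hs : SolvesOn (Icc 0 τ) x x₀ (fun t => A' t (x t) + g' t) := by
    intro t ht
    refine ⟨(hc1.add hg').intervalIntegrable _ _, ?_⟩
    rw [hx t ht, intervalIntegral.integral_add (hc1.intervalIntegrable _ _)
      (hg'.intervalIntegrable _ _)]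
    abel
  exact ⟨x, hs.congr_rhs fun t ht => by rw [hAe t ht, hge t ht]⟩

end Linear

/-! ### Input-output mappings -/

theorem Trajectories.continuousOn {s : ℕ} {Θ Θd : Set (Vec s)} {θ : ℝ → Vec s}
    (h : θ ∈ Trajectories Θ Θd) : ContinuousOn θ (Ici 0) := by
  obtain ⟨θ', h⟩ := h
  exact fun t ht => (h t ht).2.2.continuousWithinAt

theorem Trajectories.continuousOn_comp {s : ℕ} {W : Type*} [TopologicalSpace W]
    {Θ Θd : Set (Vec s)} {θ : ℝ → Vec s} (h : θ ∈ Trajectories Θ Θd) {M : Vec s → W}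
    (hM : ContinuousOn M Θ) (τ : ℝ) : ContinuousOn (fun t => M (θ t)) (Icc 0 τ) := by
  have h0 := Trajectories.continuousOn h
  obtain ⟨θ', h⟩ := h
  exact hM.comp (h0.mono Icc_subset_Ici_self) fun t ht => (h t ht.1).1

namespace StateSpace

variable {s d k l : ℕ} {G : StateSpace s d k l} {J : Set ℝ} {τ : ℝ} {θ : ℝ → Vec s}

theorem map_mono {J' : Set ℝ} {u : ℝ → Vec k} {y : ℝ → Vec l} (h : G.map J θ u y)
    (hJ : J' ⊆ J) : G.map J' θ u y := by
  obtain ⟨x, hx, hy⟩ := h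
  exact ⟨x, hx.mono hJ, fun t ht => hy t (hJ ht)⟩

theorem map_congr {u u' : ℝ → Vec k} {y y' : ℝ → Vec l} (h : G.map (Icc 0 τ) θ u y)
    (hu : ∀ t ∈ Icc 0 τ, u t = u' t) (hy : ∀ t ∈ Icc 0 τ, y t = y' t) :
    G.map (Icc 0 τ) θ u' y' := by
  obtain ⟨x, hx, hxy⟩ := h
  exact ⟨x, hx.congr_rhs fun t ht => by rw [hu t ht],
    fun t ht => by rw [← hy t ht, hxy t ht, hu t ht]⟩

theorem map_add {u v : ℝ → Vec k} {y z : ℝ → Vec l} (hy : G.map (Icc 0 τ) θ u y)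
    (hz : G.map (Icc 0 τ) θ v z) :
    G.map (Icc 0 τ) θ (fun t => u t + v t) (fun t => y t + z t) := by
  obtain ⟨x₁, hx₁, hy₁⟩ := hy
  obtain ⟨x₂, hx₂, hy₂⟩ := hz
  refine ⟨fun t => x₁ t + x₂ t, ?_, fun t ht => ?_⟩
  · have := hx₁.add hx₂
    rw [add_zero] at this
    exact this.congr_rhs fun t _ => by simp only [_root_.map_add]; abel
  · simp only [_root_.map_add, hy₁ t ht, hy₂ t ht]; abel

theorem map_smul {u : ℝ → Vec k} {y : ℝ → Vec l} (hy : G.map (Icc 0 τ) θ u y) (c : ℝ) :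
    G.map (Icc 0 τ) θ (fun t => c • u t) (fun t => c • y t) := by
  obtain ⟨x₁, hx₁, hy₁⟩ := hy
  refine ⟨fun t => c • x₁ t, ?_, fun t ht => ?_⟩
  · have := hx₁.clm (c • ContinuousLinearMap.id ℝ (Vec d))
    simp only [smul_apply, ContinuousLinearMap.id_apply, smul_zero] at this
    exact this.congr_rhs fun t _ => by simp only [_root_.map_smul, smul_add]
  · simp only [_root_.map_smul, hy₁ t ht, smul_add]

theorem map_neg {u : ℝ → Vec k} {y : ℝ → Vec l} (hy : G.map (Icc 0 τ) θ u y) :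
    G.map (Icc 0 τ) θ (fun t => -u t) (fun t => -y t) := by
  simpa using map_smul hy (-1)

theorem map_sub {u v : ℝ → Vec k} {y z : ℝ → Vec l} (hy : G.map (Icc 0 τ) θ u y)
    (hz : G.map (Icc 0 τ) θ v z) :
    G.map (Icc 0 τ) θ (fun t => u t - v t) (fun t => y t - z t) := by
  simpa [sub_eq_add_neg] using map_add hy (map_neg hz)

variable {Θ Θd : Set (Vec s)}

/-- A continuous input has a continuous output. -/
theorem exists_map (hτ : 0 ≤ τ) (hG : G.ContOn Θ) (hθ : θ ∈ Trajectories Θ Θd) {u : ℝ → Vec k}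
    (hu : ContinuousOn u (Icc 0 τ)) : ∃ y, G.map (Icc 0 τ) θ u y ∧ Continuous y := by
  obtain ⟨hA, hB, hC, hD⟩ := hG
  have hA' := Trajectories.continuousOn_comp hθ hA τ
  have hB' := Trajectories.continuousOn_comp hθ hB τ
  have hC' := Trajectories.continuousOn_comp hθ hC τ
  have hD' := Trajectories.continuousOn_comp hθ hD τ
  obtain ⟨x, hx⟩ := exists_solvesOn_linear hτ hA' (hB'.clm_apply hu) 0
  obtain ⟨y, hyc, hy⟩ := exists_continuous_extension hτ
    ((hC'.clm_apply (hx.continuousOn hτ)).add (hD'.clm_apply hu))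
  exact ⟨y, ⟨x, hx, hy⟩, hyc⟩

/-- The state is an integral, hence continuous; only the feedthrough can transmit jumps of the
input. The filter `𝓒` has no feedthrough, so its output is continuous even for a discontinuous
input. -/
theorem continuousOn_of_map (hτ : 0 ≤ τ) (hG : G.ContOn Θ) (hθ : θ ∈ Trajectories Θ Θd)
    {u : ℝ → Vec k} {y : ℝ → Vec l} (h : G.map (Icc 0 τ) θ u y)
    (hu : (∀ ϑ, G.D ϑ = 0) ∨ ContinuousOn u (Icc 0 τ)) : ContinuousOn y (Icc 0 τ) := by
  obtain ⟨x, hx, hy⟩ := h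
  obtain ⟨hA, hB, hC, hD⟩ := hG
  have hC' := Trajectories.continuousOn_comp hθ hC τ
  have hD' := Trajectories.continuousOn_comp hθ hD τ
  refine ContinuousOn.congr ?_ hy
  refine (hC'.clm_apply (hx.continuousOn hτ)).add ?_
  rcases hu with h0 | hu
  · simp only [h0]
    exact continuousOn_const
  · exact hD'.clm_apply hu

end StateSpace

end LPV

namespace LPV

/-! ### Compact parameter sets and extreme eigenvalues -/

theorem isCompact_box {s : ℕ} (lo hi : Vec s) : IsCompact (box lo hi) := by
  have h : box lo hi = (PiLp.continuousLinearEquiv 2 ℝ (fun _ : Fin s => ℝ)).toHomeomorph ⁻¹'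
      (Icc (fun i => lo i) (fun i => hi i)) := by
    ext v
    simp [box, Pi.le_def, forall_and]
  rw [h]
  exact (Homeomorph.isCompact_preimage _).2 isCompact_Icc

theorem maxNorm_nonneg {Z W : Type*} [SeminormedAddCommGroup W] (S : Set Z) (M : Z → W) :
    0 ≤ maxNorm S M := by
  apply Real.sSup_nonneg
  rintro _ ⟨z, _, rfl⟩
  exact norm_nonneg _

theorem norm_le_maxNorm {Z W : Type*} [TopologicalSpace Z] [SeminormedAddCommGroup W]
    {S : Set Z} {M : Z → W} (hS : IsCompact S) (hM : ContinuousOn M S) {z : Z} (hz : z ∈ S) :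
    ‖M z‖ ≤ maxNorm S M :=
  le_csSup (hS.image_of_continuousOn hM.norm).bddAbove (mem_image_of_mem _ hz)

section Spectrum

variable {s d : ℕ} {Θ Θd : Set (Vec s)} {A P : Vec s → Mat d d}
  {P' : Vec s → Vec s →L[ℝ] Mat d d} {μ : ℝ}

theorem exists_eigenvector_of_mem_spectrum {M : Mat d d} {c : ℝ} (hc : c ∈ spectrum ℝ M) :
    ∃ v : Vec d, v ≠ 0 ∧ M v = c • v := by
  have h : c ∈ spectrum ℝ (M : Module.End ℝ (Vec d)) := by
    rwa [← AlgEquiv.spectrum_eq (Module.End.toContinuousLinearMap (Vec d))]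
  obtain ⟨v, hv⟩ := (Module.End.hasEigenvalue_iff_mem_spectrum.2 h).exists_hasEigenvector
  exact ⟨v, hv.2, hv.apply_eq_smul⟩

theorem isSymmetric_of_tr_eq {M : Mat d d} (hM : tr M = M) :
    (M : Vec d →ₗ[ℝ] Vec d).IsSymmetric := by
  intro x y
  have := ContinuousLinearMap.adjoint_inner_left M y x
  change inner ℝ (tr M x) y = _ at this
  rwa [hM] at this

/-- The quadratic form of a symmetric matrix is a weighted sum of its eigenvalues. -/
theorem exists_spectral_weights {M : Mat d d} (hM : tr M = M) (x : Vec d) :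
    ∃ (lam wt : Fin d → ℝ), (∀ i, lam i ∈ spectrum ℝ M) ∧ (∀ i, 0 ≤ wt i) ∧
      ∑ i, wt i = ‖x‖ ^ 2 ∧ inner ℝ x (M x) = ∑ i, lam i * wt i := by
  have hs := isSymmetric_of_tr_eq hM
  have hd : Module.finrank ℝ (Vec d) = d := finrank_euclideanSpace_fin
  let b := hs.eigenvectorBasis hd
  refine ⟨hs.eigenvalues hd, fun i => inner ℝ (b i) x ^ 2, fun i => ?_, fun i => sq_nonneg _,
    ?_, ?_⟩
  · have h := Module.End.hasEigenvalue_iff_mem_spectrum.1 (hs.hasEigenvalue_eigenvalues hd i)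
    rw [← AlgEquiv.spectrum_eq (Module.End.toContinuousLinearMap (Vec d))] at h
    exact h
  · rw [← real_inner_self_eq_norm_sq, ← b.sum_inner_mul_inner x x]
    refine Finset.sum_congr rfl fun i _ => ?_
    rw [real_inner_comm (b i) x]; ring
  · rw [← b.sum_inner_mul_inner x (M x)]
    refine Finset.sum_congr rfl fun i _ => ?_
    have h1 : inner ℝ (b i) (M x) = hs.eigenvalues hd i * inner ℝ (b i) x := by
      have h2 := hs (b i) x
      simp only [ContinuousLinearMap.coe_coe] at h2
      have h3 : M (b i) = hs.eigenvalues hd i • b i := hs.apply_eigenvectorBasis hd i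
      rw [← h2, h3, real_inner_smul_left]
    rw [h1, real_inner_comm (b i) x]; ring

theorem eigenvalue_ge_of_inner_ge {c : ℝ} (hc : ∀ θ ∈ Θ, ∀ x : Vec d, c * ‖x‖ ^ 2 ≤ inner ℝ x (P θ x))
    {lam : ℝ} {θ : Vec s} (hθ : θ ∈ Θ) (hl : lam ∈ spectrum ℝ (P θ)) : c ≤ lam := by
  obtain ⟨v, hv, hPv⟩ := exists_eigenvector_of_mem_spectrum hl
  have h1 := hc θ hθ v
  rw [hPv, real_inner_smul_right, real_inner_self_eq_norm_sq] at h1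
  exact le_of_mul_le_mul_right h1 (by positivity)

namespace IsLyapunov

variable (h : IsLyapunov Θ Θd A P P' μ)

include h

theorem continuousOn : ContinuousOn P Θ := fun θ hθ => (h.hasDeriv θ hθ).continuousWithinAt

/-- Compactness of `Θ` times the unit sphere makes positivity uniform; homogeneity extends it to all
vectors. It bounds the set of eigenvalues away from zero, so that the infimum in `lamMin` is
meaningful. -/
theorem exists_lower_bound (hΘ : IsCompact Θ) :
    ∃ c > 0, ∀ θ ∈ Θ, ∀ x : Vec d, c * ‖x‖ ^ 2 ≤ inner ℝ x (P θ x) := by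
  have hK : IsCompact (Θ ×ˢ Metric.sphere (0 : Vec d) 1) := hΘ.prod (isCompact_sphere _ _)
  have hcont : ContinuousOn (fun z : Vec s × Vec d => inner ℝ z.2 (P z.1 z.2))
      (Θ ×ˢ Metric.sphere (0 : Vec d) 1) := by
    have h1 : ContinuousOn (fun z : Vec s × Vec d => P z.1) (Θ ×ˢ Metric.sphere (0 : Vec d) 1) :=
      h.continuousOn.comp continuousOn_fst fun z hz => hz.1
    exact continuousOn_snd.inner (h1.clm_apply continuousOn_snd)
  rcases (Θ ×ˢ Metric.sphere (0 : Vec d) 1).eq_empty_or_nonempty with he | hne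
  · refine ⟨1, one_pos, fun θ hθ x => ?_⟩
    by_cases hx : x = 0
    · simp [hx]
    · exfalso
      have : (θ, (‖x‖⁻¹ • x)) ∈ Θ ×ˢ Metric.sphere (0 : Vec d) 1 := by
        refine ⟨hθ, ?_⟩
        simp [norm_smul, hx]
      rw [he] at this
      exact this
  · obtain ⟨⟨θ₀, x₀⟩, hz, hmin⟩ := hK.exists_isMinOn hne hcont
    have hx₀ : x₀ ≠ 0 := by
      rintro rfl
      simpa using hz.2
    refine ⟨inner ℝ x₀ (P θ₀ x₀), h.pos θ₀ hz.1 x₀ hx₀, fun θ hθ x => ?_⟩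
    by_cases hx : x = 0
    · simp [hx]
    · have hmem : (θ, (‖x‖⁻¹ • x)) ∈ Θ ×ˢ Metric.sphere (0 : Vec d) 1 := by
        refine ⟨hθ, ?_⟩
        simp [norm_smul, hx]
      have h2 : inner ℝ x₀ (P θ₀ x₀) ≤ inner ℝ (‖x‖⁻¹ • x) (P θ (‖x‖⁻¹ • x)) := hmin hmem
      rw [map_smul, real_inner_smul_left, real_inner_smul_right] at h2
      have hn : 0 < ‖x‖ := norm_pos_iff.2 hx
      calc inner ℝ x₀ (P θ₀ x₀) * ‖x‖ ^ 2
          ≤ (‖x‖⁻¹ * (‖x‖⁻¹ * inner ℝ x (P θ x))) * ‖x‖ ^ 2 :=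
            mul_le_mul_of_nonneg_right h2 (sq_nonneg _)
        _ = inner ℝ x (P θ x) := by field_simp

theorem eigenvalue_le (hΘ : IsCompact Θ) {lam : ℝ} {θ : Vec s} (hθ : θ ∈ Θ)
    (hl : lam ∈ spectrum ℝ (P θ)) : lam ≤ maxNorm Θ P := by
  obtain ⟨v, hv, hPv⟩ := exists_eigenvector_of_mem_spectrum hl
  have h1 := (P θ).le_opNorm v
  rw [hPv, norm_smul] at h1
  have h2 : |lam| ≤ ‖P θ‖ := le_of_mul_le_mul_right h1 (norm_pos_iff.2 hv)
  exact (le_abs_self _).trans (h2.trans (norm_le_maxNorm hΘ h.continuousOn hθ))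

theorem exists_mem_spectrum (hd : 0 < d) {θ : Vec s} (hθ : θ ∈ Θ) :
    ∃ c, c ∈ spectrum ℝ (P θ) := by
  obtain ⟨lam, _, hl, -⟩ := exists_spectral_weights (h.symm θ hθ) 0
  exact ⟨lam ⟨0, hd⟩, hl _⟩

/-- Nonemptiness of `Θ` and `0 < d` are essential: otherwise the set of eigenvalues is empty and its
`sInf` has the default value 0. -/
theorem lamMin_pos (hΘ : IsCompact Θ) (hne : Θ.Nonempty) (hd : 0 < d) : 0 < lamMin Θ P := by
  obtain ⟨c, hc, hlow⟩ := h.exists_lower_bound hΘ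
  obtain ⟨θ, hθ⟩ := hne
  obtain ⟨l, hl⟩ := h.exists_mem_spectrum hd hθ
  refine hc.trans_le (le_csInf ⟨l, θ, hθ, hl⟩ ?_)
  rintro _ ⟨θ', hθ', hl'⟩
  exact eigenvalue_ge_of_inner_ge hlow hθ' hl'

theorem lamMin_le (hΘ : IsCompact Θ) {θ : Vec s} (hθ : θ ∈ Θ) (x : Vec d) :
    lamMin Θ P * ‖x‖ ^ 2 ≤ inner ℝ x (P θ x) := by
  obtain ⟨c, hc, hlow⟩ := h.exists_lower_bound hΘ
  obtain ⟨lam, wt, hl, hw, hsum, hq⟩ := exists_spectral_weights (h.symm θ hθ) x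
  rw [hq, ← hsum, Finset.mul_sum]
  refine Finset.sum_le_sum fun i _ => mul_le_mul_of_nonneg_right (csInf_le ⟨c, ?_⟩ ⟨θ, hθ, hl i⟩)
    (hw i)
  rintro _ ⟨θ', hθ', hl'⟩
  exact eigenvalue_ge_of_inner_ge hlow hθ' hl'

theorem le_lamMax (hΘ : IsCompact Θ) {θ : Vec s} (hθ : θ ∈ Θ) (x : Vec d) :
    inner ℝ x (P θ x) ≤ lamMax Θ P * ‖x‖ ^ 2 := by
  obtain ⟨lam, wt, hl, hw, hsum, hq⟩ := exists_spectral_weights (h.symm θ hθ) x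
  rw [hq, ← hsum, Finset.mul_sum]
  refine Finset.sum_le_sum fun i _ => mul_le_mul_of_nonneg_right
    (le_csSup ⟨maxNorm Θ P, ?_⟩ ⟨θ, hθ, hl i⟩) (hw i)
  rintro _ ⟨θ', hθ', hl'⟩
  exact h.eigenvalue_le hΘ hθ' hl'

theorem lamMin_le_lamMax (hΘ : IsCompact Θ) (hne : Θ.Nonempty) (hd : 0 < d) :
    lamMin Θ P ≤ lamMax Θ P := by
  obtain ⟨θ, hθ⟩ := hne
  obtain ⟨v, hv⟩ : ∃ v : Vec d, v ≠ 0 :=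
    ⟨EuclideanSpace.single ⟨0, hd⟩ 1, by simp⟩
  have h1 := (h.lamMin_le hΘ hθ v).trans (h.le_lamMax hΘ hθ v)
  exact le_of_mul_le_mul_right h1 (by positivity)

/-- The differential inequality for the quadratic form along a perturbed solution. -/
theorem inner_deriv_le {θ : Vec s} (hθ : θ ∈ Θ) {v : Vec s} (hv : v ∈ Θd) (x w : Vec d) {c : ℝ}
    (hc : ‖P θ w‖ ≤ c) :
    inner ℝ x (P' θ v x + P θ (A θ x + w)) + inner ℝ (A θ x + w) (P θ x) ≤
      -(μ * inner ℝ x (P θ x)) + 2 * (c * ‖x‖) := by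
  have hl := (ContinuousLinearMap.le_def _ _).1 (h.lmi θ hθ v hv)
  have hl2 := hl.inner_nonneg_right x
  have hadj : inner ℝ x (tr (A θ) (P θ x)) = inner ℝ (A θ x) (P θ x) :=
    ContinuousLinearMap.adjoint_inner_right (A θ) x (P θ x)
  have hsym : inner ℝ w (P θ x) = inner ℝ x (P θ w) := by
    have := isSymmetric_of_tr_eq (h.symm θ hθ) w x
    simp only [ContinuousLinearMap.coe_coe] at this
    rw [← this, real_inner_comm]
  have hw : inner ℝ x (P θ w) ≤ c * ‖x‖ := by
    refine (real_inner_le_norm _ _).trans ?_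
    rw [mul_comm]
    exact mul_le_mul_of_nonneg_right hc (norm_nonneg _)
  simp only [sub_apply, neg_apply, smul_apply, add_apply,
    ContinuousLinearMap.comp_apply, inner_sub_right, inner_neg_right, inner_add_right,
    real_inner_smul_right, hadj] at hl2
  rw [map_add, inner_add_right, inner_add_right, inner_add_left, hsym]
  linarith

/-- Decay of the state of a perturbed linear parameter-varying system. -/
theorem norm_le (hΘ : IsCompact Θ) (hd : 0 < d) {θ : ℝ → Vec s} (hθ : θ ∈ Trajectories Θ Θd)
    {t₀ τ : ℝ} (ht₀ : 0 ≤ t₀) {x w : ℝ → Vec d} {c : ℝ}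
    (hx : ContinuousOn x (Icc t₀ τ))
    (hx' : ∀ t ∈ Ico t₀ τ, HasDerivWithinAt x (A (θ t) (x t) + w t) (Ici t) t)
    (hw : ∀ t ∈ Ico t₀ τ, ‖P (θ t) (w t)‖ ≤ c) (hc : 0 ≤ c) {t : ℝ} (ht : t ∈ Icc t₀ τ) :
    ‖x t‖ ≤ Real.sqrt (lamMax Θ P / lamMin Θ P) * Real.exp (-(μ / 2 * (t - t₀))) * ‖x t₀‖ +
      (1 - Real.exp (-(μ / 2 * (t - t₀)))) * (2 / (μ * lamMin Θ P)) * c := by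
  have hθc := Trajectories.continuousOn_comp hθ h.continuousOn τ
  have hθ2 := hθ
  obtain ⟨θ', hθ'⟩ := hθ
  have hne : Θ.Nonempty := ⟨θ 0, (hθ' 0 le_rfl).1⟩
  set lm := lamMin Θ P with hlm
  set lM := lamMax Θ P with hlM
  have hlm0 : 0 < lm := h.lamMin_pos hΘ hne hd
  have hlM0 : 0 < lM := hlm0.trans_le (h.lamMin_le_lamMax hΘ hne hd)
  have hμ := h.mu_pos
  have hsq : 0 < Real.sqrt lm := Real.sqrt_pos.2 hlm0
  set V : ℝ → ℝ := fun t => inner ℝ (x t) (P (θ t) (x t)) with hV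
  have hVlow : ∀ t, 0 ≤ t → lm * ‖x t‖ ^ 2 ≤ V t := fun t ht => h.lamMin_le hΘ (hθ' t ht).1 _
  have hV0 : ∀ t, 0 ≤ t → 0 ≤ V t := fun t ht => le_trans (by positivity) (hVlow t ht)
  have hxV : ∀ t, 0 ≤ t → Real.sqrt lm * ‖x t‖ ≤ Real.sqrt (V t) := by
    intro t ht
    apply Real.le_sqrt_of_sq_le
    rw [mul_pow, Real.sq_sqrt hlm0.le]
    exact hVlow t ht
  have hVc : ContinuousOn V (Icc t₀ τ) :=
    hx.inner ((hθc.mono (Icc_subset_Icc_left ht₀)).clm_apply hx)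
  set E := Real.exp (-(μ / 2 * (t - t₀))) with hE
  have hE0 : 0 < E := Real.exp_pos _
  have hE1 : E ≤ 1 := Real.exp_le_one_iff.2 (by
    have : 0 ≤ t - t₀ := sub_nonneg.2 ht.1
    have := mul_nonneg (half_pos hμ).le this
    linarith)
  -- The square root of `V` need not be differentiable where `V = 0`. The regularization `φ = √(V +
  -- ε²)` is positive and satisfies `φ' ≤ -(μ/2) φ + c/√lm + (μ/2) ε`; the extra terms vanish as `ε
  -- → 0`.
  have key : ∀ ε > 0, Real.sqrt (V t) ≤
      Real.sqrt (V t₀) * E + (1 - E) * (2 / μ) * (c / Real.sqrt lm) + ε := by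
    intro ε hε
    set φ : ℝ → ℝ := fun t => Real.sqrt (V t + ε ^ 2) with hφ
    have hφpos : ∀ t, 0 ≤ t → ε ≤ φ t := fun t ht =>
      Real.le_sqrt_of_sq_le (by linarith [hV0 t ht])
    have hφsq : ∀ t, 0 ≤ t → φ t ^ 2 = V t + ε ^ 2 := fun t ht =>
      Real.sq_sqrt (by have := hV0 t ht; positivity)
    have hVd : ∀ t ∈ Ico t₀ τ, ∃ V', HasDerivWithinAt V V' (Ici t) t ∧
        V' ≤ -(μ * V t) + 2 * (c * ‖x t‖) := by
      intro t ht
      have ht0 : 0 ≤ t := ht₀.trans ht.1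
      have hP : HasDerivWithinAt (fun t => P (θ t)) (P' (θ t) (θ' t)) (Ici t) t := by
        have h1 : HasDerivWithinAt θ (θ' t) (Ici t) t :=
          (hθ' t ht0).2.2.mono (Ici_subset_Ici.2 ht0)
        exact (h.hasDeriv (θ t) (hθ' t ht0).1).comp_hasDerivWithinAt t h1
          fun r hr => (hθ' r (ht0.trans hr)).1
      refine ⟨_, (hx' t ht).inner ℝ (hP.clm_apply (hx' t ht)), ?_⟩
      exact h.inner_deriv_le (hθ' t ht0).1 (hθ' t ht0).2.1 (x t) (w t) (hw t ht)
    choose! V' hV'd hV'le using hVd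
    -- Right derivatives suffice here, which admits inputs that jump at the sampling instants.
    have hg := le_gronwallBound_of_liminf_deriv_right_le (f := φ)
      (f' := fun t => V' t / (2 * φ t)) (δ := φ t₀) (K := -(μ / 2))
      (ε := c / Real.sqrt lm + μ / 2 * ε) (a := t₀) (b := τ)
      ((hVc.add continuousOn_const).sqrt)
      (fun t ht r hr => by
        have hd : HasDerivWithinAt φ (V' t / (2 * φ t)) (Ici t) t :=
          ((hV'd t ht).add_const (ε ^ 2)).sqrt
            (by have := hV0 t (ht₀.trans ht.1); positivity)
        have := hd.liminf_right_slope_le hr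
        simpa only [slope_def_field, div_eq_inv_mul] using this)
      le_rfl
      (fun t ht => by
        have ht0 : 0 ≤ t := ht₀.trans ht.1
        have hp : 0 < φ t := hε.trans_le (hφpos t ht0)
        rw [div_le_iff₀ (by positivity)]
        have hxφ : ‖x t‖ ≤ φ t / Real.sqrt lm := by
          rw [le_div_iff₀ hsq, mul_comm]
          exact (hxV t ht0).trans (Real.sqrt_le_sqrt (by have := sq_nonneg ε; linarith))
        have h2 : c * ‖x t‖ ≤ c / Real.sqrt lm * φ t := by
          calc c * ‖x t‖ ≤ c * (φ t / Real.sqrt lm) := mul_le_mul_of_nonneg_left hxφ hc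
            _ = _ := by ring
        have h3 := hV'le t ht
        have h4 := hφsq t ht0
        have h5 : μ * ε ^ 2 ≤ μ * (ε * φ t) :=
          mul_le_mul_of_nonneg_left (by nlinarith [hφpos t ht0]) hμ.le
        have h6 : V t = φ t ^ 2 - ε ^ 2 := by linarith
        rw [h6] at h3
        nlinarith)
      t ht
    rw [gronwallBound_of_K_ne_0 (by linarith [half_pos hμ])] at hg
    have hE' : Real.exp (-(μ / 2) * (t - t₀)) = E := by rw [hE]; congr 1; ring
    simp only [hE'] at hg
    have h7 : Real.sqrt (V t) ≤ φ t := Real.sqrt_le_sqrt (by have := sq_nonneg ε; linarith)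
    have h8 : φ t₀ ≤ Real.sqrt (V t₀) + ε := by
      refine (Real.sqrt_le_left (add_nonneg (Real.sqrt_nonneg _) hε.le)).2 ?_
      have := Real.sq_sqrt (hV0 t₀ ht₀)
      nlinarith [mul_nonneg (Real.sqrt_nonneg (V t₀)) hε.le]
    have h9 : (c / Real.sqrt lm + μ / 2 * ε) / -(μ / 2) * (E - 1) =
        (1 - E) * (2 / μ) * (c / Real.sqrt lm) + (1 - E) * ε := by
      field_simp
      ring
    rw [h9] at hg
    have h10 : φ t₀ * E ≤ (Real.sqrt (V t₀) + ε) * E := mul_le_mul_of_nonneg_right h8 hE0.le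
    nlinarith
  have key' := le_of_forall_pos_le_add key
  have hV1 : Real.sqrt (V t₀) ≤ Real.sqrt lM * ‖x t₀‖ := by
    refine (Real.sqrt_le_left (by positivity)).2 ?_
    rw [mul_pow, Real.sq_sqrt hlM0.le]
    exact h.le_lamMax hΘ (hθ' t₀ ht₀).1 _
  have h11 : ‖x t‖ ≤ Real.sqrt (V t) / Real.sqrt lm := by
    rw [le_div_iff₀ hsq, mul_comm]; exact hxV t (ht₀.trans ht.1)
  refine h11.trans ?_
  rw [div_le_iff₀ hsq]
  refine key'.trans ?_
  have h12 : (1 - E) * (2 / (μ * lm)) * c * Real.sqrt lm =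
      (1 - E) * (2 / μ) * (c / Real.sqrt lm) := by
    have := Real.mul_self_sqrt hlm0.le
    nth_rw 1 [← this]
    field_simp
  rw [add_mul, h12, Real.sqrt_div hlM0.le]
  have h13 : Real.sqrt lM / Real.sqrt lm * E * ‖x t₀‖ * Real.sqrt lm =
      (Real.sqrt lM * ‖x t₀‖) * E := by field_simp
  rw [h13]
  linarith [mul_le_mul_of_nonneg_right hV1 hE0.le]

end IsLyapunov

end Spectrum

end LPV

namespace LPV

/-! ### Pseudo-inverses -/

section PseudoInverse

variable {k l q : ℕ}

theorem exists_equiv_of_injective {M : Mat l l} (hM : Function.Injective M) :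
    ∃ e : Vec l ≃L[ℝ] Vec l, (e : Mat l l) = M := by
  refine ⟨(LinearEquiv.ofInjectiveEndo (M : Vec l →ₗ[ℝ] Vec l) hM).toContinuousLinearEquiv, ?_⟩
  ext x : 1
  rfl

theorem gram_injective {M : Mat k l} (hM : Function.Injective M) :
    Function.Injective (tr M ∘L M) := by
  rw [injective_iff_map_eq_zero]
  intro x hx
  have h1 : inner ℝ x ((tr M ∘L M) x) = inner ℝ (M x) (M x) :=
    ContinuousLinearMap.adjoint_inner_right M x (M x)
  rw [hx, inner_zero_right] at h1
  have h2 : M x = 0 := inner_self_eq_zero.1 h1.symm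
  exact hM (by rw [h2, map_zero])

theorem pinv_apply_self {M : Mat k l} (hM : Function.Injective M) (x : Vec l) :
    pinv M (M x) = x := by
  obtain ⟨e, he⟩ := exists_equiv_of_injective (gram_injective hM)
  have h1 : pinv M (M x) = (tr M ∘L M).inverse ((tr M ∘L M) x) := rfl
  rw [h1, ← he, ContinuousLinearMap.inverse_equiv]
  simp

theorem pinv_apply_of_orthogonal {M : Mat k l} {N : Mat k q} (h : tr M ∘L N = 0) (x : Vec q) :
    pinv M (N x) = 0 := by
  have h1 : tr M (N x) = 0 := by
    rw [← ContinuousLinearMap.comp_apply, h]; rfl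
  simp [pinv, h1]

theorem continuous_tr : Continuous (tr : Mat k l → Mat l k) :=
  (ContinuousLinearMap.adjoint (𝕜 := ℝ) (E := Vec l) (F := Vec k)).continuous

theorem continuousOn_pinv {Z : Type*} [TopologicalSpace Z] {S : Set Z} {M : Z → Mat k l}
    (hM : ContinuousOn M S) (hinj : ∀ z ∈ S, Function.Injective (M z)) :
    ContinuousOn (fun z => pinv (M z)) S := by
  have ht : ContinuousOn (fun z => tr (M z)) S := continuous_tr.comp_continuousOn hM
  refine ContinuousOn.clm_comp ?_ ht
  intro z hz
  obtain ⟨e, he⟩ := exists_equiv_of_injective (gram_injective (hinj z hz))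
  have h1 : ContinuousAt ContinuousLinearMap.inverse (tr (M z) ∘L M z) := by
    rw [← he]
    exact (contDiffAt_map_inverse (𝕜 := ℝ) (n := 0) e).continuousAt
  exact ContinuousAt.comp_continuousWithinAt (f := fun z => tr (M z) ∘L M z) h1
    (ht.clm_comp hM z hz)

theorem tr_comp_eq_zero_symm {M : Mat k l} {N : Mat k q} (h : tr M ∘L N = 0) :
    tr N ∘L M = 0 := by
  have h1 : tr (tr M ∘L N) = tr N ∘L M := by
    simp only [tr, ContinuousLinearMap.adjoint_comp, ContinuousLinearMap.adjoint_adjoint]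
  rw [← h1, h]
  exact map_zero _

end PseudoInverse

theorem continuousOn_of_lipschitz {s : ℕ} {W : Type*} [SeminormedAddCommGroup W]
    {Θ : Set (Vec s)} {M : Vec s → W} {L : ℝ}
    (h : ∀ θ₁ ∈ Θ, ∀ θ₂ ∈ Θ, ‖M θ₁ - M θ₂‖ ≤ L * ‖θ₁ - θ₂‖) : ContinuousOn M Θ := by
  intro θ hθ
  rw [ContinuousWithinAt, tendsto_iff_norm_sub_tendsto_zero]
  have h1 : Tendsto (fun θ' => L * ‖θ' - θ‖) (𝓝[Θ] θ) (𝓝 0) := by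
    have : Continuous fun θ' : Vec s => L * ‖θ' - θ‖ := by fun_prop
    have h2 := (this.tendsto θ).mono_left (nhdsWithin_le_nhds (s := Θ))
    simpa using h2
  refine squeeze_zero' (Eventually.of_forall fun _ => norm_nonneg _) ?_ h1
  filter_upwards [self_mem_nhdsWithin] with θ' hθ' using h θ' hθ' θ hθ

theorem Trajectories.norm_sub_le {s : ℕ} {Θ Θd : Set (Vec s)} {θ : ℝ → Vec s}
    (h : θ ∈ Trajectories Θ Θd) {b : ℝ} (hb : ∀ v ∈ Θd, ‖v‖ ≤ b) {t₁ t₂ : ℝ}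
    (h₁ : 0 ≤ t₁) (h₂ : 0 ≤ t₂) : ‖θ t₁ - θ t₂‖ ≤ b * |t₁ - t₂| := by
  obtain ⟨θ', h⟩ := h
  exact (convex_Ici (0 : ℝ)).norm_image_sub_le_of_norm_hasDerivWithin_le
    (fun t ht => (h t ht).2.2) (fun t ht => hb _ (h t ht).2.1) h₂ h₁

/-! ### The control problem: splitting along `B` and `Bu`, bounds by the constants -/

namespace Setup

variable {n m p s nH nF : ℕ} {S : Setup n m p s nH nF}

theorem isCompact_Θ : IsCompact S.Θ := isCompact_box _ _

theorem mem_Θ {θ : ℝ → Vec s} (hθ : θ ∈ S.adm) {t : ℝ} (ht : 0 ≤ t) : θ t ∈ S.Θ := by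
  obtain ⟨θ', h⟩ := hθ
  exact (h t ht).1

theorem maxωI_nonneg : 0 ≤ S.maxωI := maxNorm_nonneg _ _
theorem bB_nonneg : 0 ≤ S.bB := maxNorm_nonneg _ _
theorem bBd_nonneg : 0 ≤ S.bBd := maxNorm_nonneg _ _
theorem bBud_nonneg : 0 ≤ S.bBud := maxNorm_nonneg _ _
theorem bKx_nonneg : 0 ≤ S.bKx := maxNorm_nonneg _ _

/-- The uncertainty of the closed loop, `f(t, x) + B(θ)(ω - I)Kx(θ)x`. -/
noncomputable def fbar (S : Setup n m p s nH nF) (f : ℝ → Vec n → Vec n) (θ : ℝ → Vec s) (t : ℝ)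
    (x : Vec n) : Vec n :=
  f t x + S.B (θ t) (S.ω (S.Kx (θ t) x) - S.Kx (θ t) x)

namespace Assumptions

variable (hS : S.Assumptions)

include hS

theorem isCompact_Ω : IsCompact S.Ω := by
  obtain ⟨V, hV, h⟩ := hS.Ω_polytope
  rw [h]
  exact hV.isCompact_convexHull (𝕜 := ℝ)

theorem B_cont : ContinuousOn S.B S.Θ := continuousOn_of_lipschitz hS.B_lip
theorem Bd_cont : ContinuousOn S.Bd S.Θ := continuousOn_of_lipschitz hS.Bd_lip
theorem Kx_cont : ContinuousOn S.Kx S.Θ := continuousOn_of_lipschitz hS.Kx_lip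
theorem Am_cont : ContinuousOn S.Am S.Θ := hS.A_cont.add (hS.B_cont.clm_comp hS.Kx_cont)

theorem m_le_n {θ : Vec s} (hθ : θ ∈ S.Θ) : m ≤ n := by
  have h := LinearMap.finrank_le_finrank_of_injective (f := (S.B θ : Vec m →ₗ[ℝ] Vec n))
    (hS.B_inj θ hθ)
  simpa using h

/-- The map `[B, Bu]` is onto a space of dimension `n` and its domain has dimension `m + (n - m) =
n`, so it is also injective. The inequality `m ≤ n` makes the natural-number subtraction harmless.
-/
theorem Bu_inj (θ : Vec s) (hθ : θ ∈ S.Θ) : Function.Injective (S.Bu θ) := by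
  have hmn := hS.m_le_n hθ
  let F : Vec m × Vec (n - m) →ₗ[ℝ] Vec n :=
    LinearMap.coprod (S.B θ : Vec m →ₗ[ℝ] Vec n) (S.Bu θ : Vec (n - m) →ₗ[ℝ] Vec n)
  have hsurj : Function.Surjective F := by
    intro z
    obtain ⟨v, w, h⟩ := hS.Bbar_rank θ hθ z
    exact ⟨(v, w), by simpa [F] using h⟩
  have hinj : Function.Injective F :=
    (LinearMap.injective_iff_surjective_of_finrank_eq_finrank (by simp; omega)).2 hsurj
  intro w₁ w₂ h
  have h2 : F (0, w₁) = F (0, w₂) := by simpa [F] using h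
  simpa using hinj h2

theorem Bud_cont : ContinuousOn S.Bud S.Θ := continuousOn_pinv hS.Bu_cont hS.Bu_inj

theorem Bd_decomp {θ : Vec s} (hθ : θ ∈ S.Θ) (v : Vec m) (w : Vec (n - m)) :
    S.Bd θ (S.B θ v + S.Bu θ w) = v := by
  rw [map_add, Bd, pinv_apply_self (hS.B_inj θ hθ), pinv_apply_of_orthogonal (hS.B_orth θ hθ),
    add_zero]

theorem Bud_decomp {θ : Vec s} (hθ : θ ∈ S.Θ) (v : Vec m) (w : Vec (n - m)) :
    S.Bud θ (S.B θ v + S.Bu θ w) = w := by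
  rw [map_add, Bud, pinv_apply_self (hS.Bu_inj θ hθ),
    pinv_apply_of_orthogonal (tr_comp_eq_zero_symm (hS.B_orth θ hθ)), zero_add]

theorem Bd_B {θ : Vec s} (hθ : θ ∈ S.Θ) (v : Vec m) : S.Bd θ (S.B θ v) = v := by
  simpa using hS.Bd_decomp hθ v 0

theorem Bud_B {θ : Vec s} (hθ : θ ∈ S.Θ) (v : Vec m) : S.Bud θ (S.B θ v) = 0 := by
  simpa using hS.Bud_decomp hθ v 0

theorem B_Bd_add_Bu_Bud {θ : Vec s} (hθ : θ ∈ S.Θ) (z : Vec n) :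
    S.B θ (S.Bd θ z) + S.Bu θ (S.Bud θ z) = z := by
  obtain ⟨v, w, rfl⟩ := hS.Bbar_rank θ hθ z
  rw [hS.Bd_decomp hθ, hS.Bud_decomp hθ]

theorem norm_B_le {θ : Vec s} (hθ : θ ∈ S.Θ) : ‖S.B θ‖ ≤ S.bB :=
  norm_le_maxNorm isCompact_Θ hS.B_cont hθ
theorem norm_Bd_le {θ : Vec s} (hθ : θ ∈ S.Θ) : ‖S.Bd θ‖ ≤ S.bBd :=
  norm_le_maxNorm isCompact_Θ hS.Bd_cont hθ
theorem norm_Bud_le {θ : Vec s} (hθ : θ ∈ S.Θ) : ‖S.Bud θ‖ ≤ S.bBud :=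
  norm_le_maxNorm isCompact_Θ hS.Bud_cont hθ
theorem norm_Kx_le {θ : Vec s} (hθ : θ ∈ S.Θ) : ‖S.Kx θ‖ ≤ S.bKx :=
  norm_le_maxNorm isCompact_Θ hS.Kx_cont hθ
theorem norm_Kr_le {θ : Vec s} (hθ : θ ∈ S.Θ) : ‖S.Kr θ‖ ≤ S.bKr :=
  norm_le_maxNorm isCompact_Θ hS.Kr_cont hθ
theorem norm_C_le {θ : Vec s} (hθ : θ ∈ S.Θ) : ‖S.C θ‖ ≤ S.bC :=
  norm_le_maxNorm isCompact_Θ hS.C_cont hθ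
theorem norm_Am_le {θ : Vec s} (hθ : θ ∈ S.Θ) : ‖S.Am θ‖ ≤ S.bAm :=
  norm_le_maxNorm isCompact_Θ hS.Am_cont hθ

theorem norm_ω_le : ‖S.ω‖ ≤ S.maxω :=
  norm_le_maxNorm hS.isCompact_Ω (M := fun w : Mat m m => w) continuousOn_id hS.ω_mem

theorem norm_ωI_le : ‖S.ω - ContinuousLinearMap.id ℝ (Vec m)‖ ≤ S.maxωI :=
  norm_le_maxNorm hS.isCompact_Ω
    (M := fun w : Mat m m => w - ContinuousLinearMap.id ℝ (Vec m)) (by fun_prop) hS.ω_mem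

theorem norm_ωI_Kx_le {θ : Vec s} (hθ : θ ∈ S.Θ) :
    ‖(S.ω - ContinuousLinearMap.id ℝ (Vec m)) ∘L S.Kx θ‖ ≤ maxNorm (S.Ω ×ˢ S.Θ)
      (fun z => (z.1 - ContinuousLinearMap.id ℝ (Vec m)) ∘L S.Kx z.2) := by
  refine norm_le_maxNorm (z := (S.ω, θ)) (hS.isCompact_Ω.prod isCompact_Θ)
    (M := fun z => (z.1 - ContinuousLinearMap.id ℝ (Vec m)) ∘L S.Kx z.2) ?_ ⟨hS.ω_mem, hθ⟩
  exact ContinuousOn.clm_comp (by fun_prop) (hS.Kx_cont.comp continuousOn_snd fun z hz => hz.2)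

theorem norm_B_ωI_Kx_le {θ : Vec s} (hθ : θ ∈ S.Θ) :
    ‖S.B θ ∘L (S.ω - ContinuousLinearMap.id ℝ (Vec m)) ∘L S.Kx θ‖ ≤ maxNorm (S.Ω ×ˢ S.Θ)
      (fun z => S.B z.2 ∘L (z.1 - ContinuousLinearMap.id ℝ (Vec m)) ∘L S.Kx z.2) := by
  have hB : ContinuousOn (fun z : Mat m m × Vec s => S.B z.2) (S.Ω ×ˢ S.Θ) :=
    hS.B_cont.comp continuousOn_snd fun z hz => hz.2
  have hK : ContinuousOn (fun z : Mat m m × Vec s => S.Kx z.2) (S.Ω ×ˢ S.Θ) :=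
    hS.Kx_cont.comp continuousOn_snd fun z hz => hz.2
  have hW : ContinuousOn (fun z : Mat m m × Vec s => z.1 - ContinuousLinearMap.id ℝ (Vec m))
      (S.Ω ×ˢ S.Θ) := by fun_prop
  have hM := hB.clm_comp (hW.clm_comp hK)
  have hz : (S.ω, θ) ∈ S.Ω ×ˢ S.Θ := ⟨hS.ω_mem, hθ⟩
  have hle := norm_le_maxNorm (hS.isCompact_Ω.prod (isCompact_Θ (S := S))) hM hz
  beta_reduce at hle
  exact hle

theorem norm_r_le {t : ℝ} (ht : 0 ≤ t) : ‖S.r t‖ ≤ S.rNorm := by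
  have h1 : ‖S.r t‖ₑ ≤ linf (Ici 0) S.r := le_iSup₂ (f := fun t (_ : t ∈ Ici (0 : ℝ)) => ‖S.r t‖ₑ)
    t ht
  have h2 := ENNReal.toReal_mono hS.r_bdd h1
  simpa [rNorm] using h2

theorem rate_nonneg {θ : ℝ → Vec s} (hθ : θ ∈ S.adm) : 0 ≤ S.bθ' := by
  obtain ⟨θ', h⟩ := hθ
  exact (norm_nonneg _).trans (hS.rate_bound _ (h 0 le_rfl).2.1)

theorem Lf1_nonneg {δ : ℝ} (hδ : 0 < δ) : 0 ≤ S.Lf1 δ :=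
  add_nonneg (mul_nonneg (hS.Lf_pos δ hδ).le bBd_nonneg) (maxNorm_nonneg _ _)

theorem Lf2_nonneg {δ : ℝ} (hδ : 0 < δ) : 0 ≤ S.Lf2 δ :=
  mul_nonneg (hS.Lf_pos δ hδ).le bBud_nonneg

theorem Lfbar_nonneg {δ : ℝ} (hδ : 0 < δ) : 0 ≤ S.Lfbar δ :=
  add_nonneg (hS.Lf_pos δ hδ).le (maxNorm_nonneg _ _)

end Assumptions

/-! ### Bounds on the uncertainty -/

section Uncertain

variable {f : ℝ → Vec n → Vec n} {θ : ℝ → Vec s}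

theorem Uncertainty.bf0_nonneg (hf : S.Uncertainty f) : 0 ≤ S.bf0 :=
  (norm_nonneg _).trans (hf.zero_bound 0 le_rfl)

theorem Uncertainty.bf10_nonneg (hf : S.Uncertainty f) : 0 ≤ S.bf10 :=
  mul_nonneg bBd_nonneg hf.bf0_nonneg

theorem Uncertainty.bf20_nonneg (hf : S.Uncertainty f) : 0 ≤ S.bf20 :=
  mul_nonneg bBud_nonneg hf.bf0_nonneg

theorem fbar_sub (t : ℝ) (x₁ x₂ : Vec n) : S.fbar f θ t x₁ - S.fbar f θ t x₂ =
    (f t x₁ - f t x₂) +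
      S.B (θ t) (((S.ω - ContinuousLinearMap.id ℝ (Vec m)) ∘L S.Kx (θ t)) (x₁ - x₂)) := by
  simp only [fbar, ContinuousLinearMap.comp_apply, sub_apply, ContinuousLinearMap.id_apply,
    map_sub]
  abel

theorem norm_B_ωI_le (hS : S.Assumptions) (hθ : θ ∈ S.adm) {t : ℝ} (ht : 0 ≤ t) (v : Vec m) :
    ‖S.B (θ t) (S.ω v - v)‖ ≤ S.bB * S.maxωI * ‖v‖ := by
  have h1 : ‖S.ω v - v‖ ≤ S.maxωI * ‖v‖ :=
    ContinuousLinearMap.le_of_opNorm_le (S.ω - ContinuousLinearMap.id ℝ (Vec m)) hS.norm_ωI_le v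
  refine (ContinuousLinearMap.le_of_opNorm_le_of_le _ (hS.norm_B_le (mem_Θ hθ ht)) h1).trans_eq ?_
  ring

theorem norm_f_le (hS : S.Assumptions) (hf : S.Uncertainty f) {δ t : ℝ} (hδ : 0 < δ) (ht : 0 ≤ t) {x : Vec n} (hx : ‖x‖ ≤ δ) :
    ‖f t x‖ ≤ S.Lf δ * δ + S.bf0 := by
  have h1 := hf.lip_x δ hδ t ht x 0 hx (by simpa using hδ.le)
  rw [sub_zero] at h1
  have h2 := mul_le_mul_of_nonneg_left hx (hS.Lf_pos δ hδ).le
  linarith [norm_le_norm_sub_add (f t x) (f t 0), hf.zero_bound t ht]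

variable (hS : S.Assumptions) (hf : S.Uncertainty f) (hθ : θ ∈ S.adm)

include hS hf hθ

/-- Since `B† B = I`, the matched part of `B (ω - I) Kx x` is `(ω - I) Kx x` itself; only the
contribution of `f` pays the factor `‖B†‖`. -/
theorem norm_Bd_fbar_sub_le {δ t : ℝ} (hδ : 0 < δ) (ht : 0 ≤ t) {x₁ x₂ : Vec n}
    (h₁ : ‖x₁‖ ≤ δ) (h₂ : ‖x₂‖ ≤ δ) :
    ‖S.Bd (θ t) (S.fbar f θ t x₁ - S.fbar f θ t x₂)‖ ≤ S.Lf1 δ * ‖x₁ - x₂‖ := by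
  rw [fbar_sub, map_add, hS.Bd_B (mem_Θ hθ ht)]
  refine (norm_add_le _ _).trans ?_
  rw [Lf1, add_mul]
  refine add_le_add ?_ (ContinuousLinearMap.le_of_opNorm_le _ (hS.norm_ωI_Kx_le (mem_Θ hθ ht)) _)
  refine (ContinuousLinearMap.le_of_opNorm_le_of_le _ (hS.norm_Bd_le (mem_Θ hθ ht))
    (hf.lip_x δ hδ t ht _ _ h₁ h₂)).trans_eq ?_
  ring

/-- Here `Bu† B = 0` removes the input-gain term altogether, so only `f` contributes. -/
theorem norm_Bud_fbar_sub_le {δ t : ℝ} (hδ : 0 < δ) (ht : 0 ≤ t) {x₁ x₂ : Vec n}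
    (h₁ : ‖x₁‖ ≤ δ) (h₂ : ‖x₂‖ ≤ δ) :
    ‖S.Bud (θ t) (S.fbar f θ t x₁ - S.fbar f θ t x₂)‖ ≤ S.Lf2 δ * ‖x₁ - x₂‖ := by
  rw [fbar_sub, map_add, hS.Bud_B (mem_Θ hθ ht), add_zero]
  refine (ContinuousLinearMap.le_of_opNorm_le_of_le _ (hS.norm_Bud_le (mem_Θ hθ ht))
    (hf.lip_x δ hδ t ht _ _ h₁ h₂)).trans_eq ?_
  rw [Lf2]; ring

theorem norm_fbar_sub_le {δ t : ℝ} (hδ : 0 < δ) (ht : 0 ≤ t) {x₁ x₂ : Vec n}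
    (h₁ : ‖x₁‖ ≤ δ) (h₂ : ‖x₂‖ ≤ δ) :
    ‖S.fbar f θ t x₁ - S.fbar f θ t x₂‖ ≤ S.Lfbar δ * ‖x₁ - x₂‖ := by
  rw [fbar_sub]
  refine (norm_add_le _ _).trans ?_
  rw [Lfbar, add_mul]
  exact add_le_add (hf.lip_x δ hδ t ht _ _ h₁ h₂)
    (ContinuousLinearMap.le_of_opNorm_le _ (hS.norm_B_ωI_Kx_le (mem_Θ hθ ht)) _)

theorem norm_Bd_fbar_le {δ t : ℝ} (hδ : 0 < δ) (ht : 0 ≤ t) {x : Vec n} (hx : ‖x‖ ≤ δ) :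
    ‖S.Bd (θ t) (S.fbar f θ t x)‖ ≤ S.Lf1 δ * ‖x‖ + S.bf10 := by
  have h1 := norm_Bd_fbar_sub_le hS hf hθ hδ ht hx (x₂ := 0) (by simpa using hδ.le)
  have h2 : ‖S.Bd (θ t) (S.fbar f θ t 0)‖ ≤ S.bf10 := by
    have : S.fbar f θ t 0 = f t 0 := by simp [fbar]
    rw [this]
    exact ContinuousLinearMap.le_of_opNorm_le_of_le _ (hS.norm_Bd_le (mem_Θ hθ ht))
      (hf.zero_bound t ht)
  rw [sub_zero, map_sub] at h1
  linarith [norm_le_norm_sub_add (S.Bd (θ t) (S.fbar f θ t x)) (S.Bd (θ t) (S.fbar f θ t 0))]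

theorem norm_Bud_fbar_le {δ t : ℝ} (hδ : 0 < δ) (ht : 0 ≤ t) {x : Vec n} (hx : ‖x‖ ≤ δ) :
    ‖S.Bud (θ t) (S.fbar f θ t x)‖ ≤ S.Lf2 δ * ‖x‖ + S.bf20 := by
  have h1 := norm_Bud_fbar_sub_le hS hf hθ hδ ht hx (x₂ := 0) (by simpa using hδ.le)
  have h2 : ‖S.Bud (θ t) (S.fbar f θ t 0)‖ ≤ S.bf20 := by
    have : S.fbar f θ t 0 = f t 0 := by simp [fbar]
    rw [this]
    exact ContinuousLinearMap.le_of_opNorm_le_of_le _ (hS.norm_Bud_le (mem_Θ hθ ht))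
      (hf.zero_bound t ht)
  rw [sub_zero, map_sub] at h1
  linarith [norm_le_norm_sub_add (S.Bud (θ t) (S.fbar f θ t x)) (S.Bud (θ t) (S.fbar f θ t 0))]

theorem norm_fbar_le {δ t : ℝ} (hδ : 0 < δ) (ht : 0 ≤ t) {x : Vec n} (hx : ‖x‖ ≤ δ) :
    ‖S.fbar f θ t x‖ ≤ S.Lf δ * δ + S.bf0 + S.bB * S.maxωI * S.bKx * δ := by
  refine (norm_add_le _ _).trans (add_le_add (norm_f_le hS hf hδ ht hx) ?_)
  refine (norm_B_ωI_le hS hθ ht _).trans ?_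
  have h1 : ‖S.Kx (θ t) x‖ ≤ S.bKx * δ :=
    ContinuousLinearMap.le_of_opNorm_le_of_le _ (hS.norm_Kx_le (mem_Θ hθ ht)) hx
  calc _ ≤ S.bB * S.maxωI * (S.bKx * δ) :=
        mul_le_mul_of_nonneg_left h1 (mul_nonneg bB_nonneg maxωI_nonneg)
    _ = _ := by ring

/-- A product rule in increments: first `B`, then `Kx` is moved from `θ t₁` to `θ t₂`, and `θ`
itself is Lipschitz with constant `bθ'` because its derivative stays in `Θd`. -/
theorem norm_fbar_time_sub_le {δ t₁ t₂ : ℝ} (h₁ : 0 ≤ t₁) (h₂ : 0 ≤ t₂) {x : Vec n}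
    (hx : ‖x‖ ≤ δ) :
    ‖S.fbar f θ t₁ x - S.fbar f θ t₂ x‖ ≤ S.lfbar δ * |t₁ - t₂| := by
  have hθd := Trajectories.norm_sub_le hθ hS.rate_bound h₁ h₂
  have hδ : 0 ≤ δ := (norm_nonneg _).trans hx
  have e1 := mem_Θ hθ h₁
  have e2 := mem_Θ hθ h₂
  set W := S.ω - ContinuousLinearMap.id ℝ (Vec m) with hW
  have hdec : S.fbar f θ t₁ x - S.fbar f θ t₂ x = (f t₁ x - f t₂ x) +
      ((S.B (θ t₁) - S.B (θ t₂)) (W (S.Kx (θ t₁) x)) +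
        S.B (θ t₂) (W ((S.Kx (θ t₁) - S.Kx (θ t₂)) x))) := by
    simp only [fbar, hW, sub_apply, ContinuousLinearMap.id_apply, map_sub]
    abel
  have hWn : ‖W‖ ≤ S.maxωI := hS.norm_ωI_le
  have a1 : ‖(S.B (θ t₁) - S.B (θ t₂)) (W (S.Kx (θ t₁) x))‖ ≤
      (S.LB * (S.bθ' * |t₁ - t₂|)) * (S.maxωI * (S.bKx * δ)) := by
    refine ContinuousLinearMap.le_of_opNorm_le_of_le _
      ((hS.B_lip _ e1 _ e2).trans (mul_le_mul_of_nonneg_left hθd hS.LB_pos.le)) ?_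
    refine ContinuousLinearMap.le_of_opNorm_le_of_le _ hWn ?_
    exact ContinuousLinearMap.le_of_opNorm_le_of_le _ (hS.norm_Kx_le e1) hx
  have a2 : ‖S.B (θ t₂) (W ((S.Kx (θ t₁) - S.Kx (θ t₂)) x))‖ ≤
      S.bB * (S.maxωI * ((S.LKx * (S.bθ' * |t₁ - t₂|)) * δ)) := by
    refine ContinuousLinearMap.le_of_opNorm_le_of_le _ (hS.norm_B_le e2) ?_
    refine ContinuousLinearMap.le_of_opNorm_le_of_le _ hWn ?_
    exact ContinuousLinearMap.le_of_opNorm_le_of_le _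
      ((hS.Kx_lip _ e1 _ e2).trans (mul_le_mul_of_nonneg_left hθd hS.LKx_pos.le)) hx
  rw [hdec]
  refine (norm_add_le _ _).trans ((add_le_add (hf.lip_t x t₁ t₂ h₁ h₂)
    ((norm_add_le _ _).trans (add_le_add a1 a2))).trans_eq ?_)
  rw [lfbar]; ring

/-- The uncertainty is continuous along continuous curves. -/
theorem continuousOn_fbar {τ : ℝ} {x : ℝ → Vec n} (hx : ContinuousOn x (Icc 0 τ)) :
    ContinuousOn (fun t => S.fbar f θ t (x t)) (Icc 0 τ) := by
  obtain ⟨c, hc⟩ := isCompact_Icc.exists_bound_of_continuousOn hx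
  -- The Lipschitz constant of `f` in the state is available only for positive radii, so the bound
  -- on `x` is enlarged to at least 1.
  set δ := max c 1 with hδ
  have hδ0 : 0 < δ := lt_max_of_lt_right one_pos
  intro t ht
  rw [ContinuousWithinAt, tendsto_iff_norm_sub_tendsto_zero]
  have h1 : Tendsto (fun r => S.Lfbar δ * ‖x r - x t‖ + S.lfbar δ * |r - t|) (𝓝[Icc 0 τ] t)
      (𝓝 0) := by
    have e1 : Tendsto (fun r => ‖x r - x t‖) (𝓝[Icc 0 τ] t) (𝓝 0) :=
      tendsto_iff_norm_sub_tendsto_zero.1 (hx t ht)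
    have e2 : Tendsto (fun r => |r - t|) (𝓝[Icc 0 τ] t) (𝓝 0) := by
      have : Continuous fun r : ℝ => |r - t| := by fun_prop
      have h2 := (this.tendsto t).mono_left (nhdsWithin_le_nhds (s := Icc 0 τ))
      simpa using h2
    simpa using (e1.const_mul (S.Lfbar δ)).add (e2.const_mul (S.lfbar δ))
  refine squeeze_zero' (Eventually.of_forall fun _ => norm_nonneg _) ?_ h1
  filter_upwards [self_mem_nhdsWithin] with r hr
  have hxr : ‖x r‖ ≤ δ := (hc r hr).trans (le_max_left _ _)
  have hxt : ‖x t‖ ≤ δ := (hc t ht).trans (le_max_left _ _)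
  have h3 := norm_fbar_sub_le hS hf hθ hδ0 hr.1 hxr hxt
  have h4 := norm_fbar_time_sub_le hS hf hθ hr.1 ht.1 hxt
  linarith [norm_sub_le_norm_sub_add_norm_sub (S.fbar f θ r (x r)) (S.fbar f θ r (x t))
    (S.fbar f θ t (x t))]

end Uncertain

end Setup

end LPV

namespace LPV

/-! ### Bounded inputs of Hurwitz systems -/

section Hurwitz

/-- This is `√(1 + y) ≤ 1 + y / 2` with `y = 2 h Re z + h² ‖z‖²`. It says that multiplication by `1
+ z h` stretches at the rate `Re z` to first order, in every complex norm. -/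
theorem norm_one_add_mul_le (z : ℂ) (h : ℝ) :
    ‖1 + z * h‖ ≤ 1 + h * z.re + h ^ 2 * ‖z‖ ^ 2 / 2 := by
  have h1 : ‖z‖ ^ 2 = z.re ^ 2 + z.im ^ 2 := by
    rw [← Complex.normSq_eq_norm_sq, Complex.normSq_apply]; ring
  have h2 : ‖1 + z * h‖ ^ 2 = 1 + 2 * (h * z.re) + h ^ 2 * ‖z‖ ^ 2 := by
    rw [h1, ← Complex.normSq_eq_norm_sq, Complex.normSq_apply]
    simp
    ring
  refine abs_le_of_sq_le_sq' ?_ ?_ |>.2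
  · rw [h2]
    nlinarith [sq_nonneg (h * z.re + h ^ 2 * ‖z‖ ^ 2 / 2)]
  · rw [h1]
    nlinarith [sq_nonneg (1 + h * z.re), sq_nonneg (h * z.im)]

variable {V : Type*} [NormedAddCommGroup V] [NormedSpace ℂ V]

/-- The norm of `w` grows at most at the rate `Re lam · ‖w‖ + b`, and Gronwall's inequality with a
negative rate gives the equilibrium value `b / -Re lam`. As `h` is only bounded and integrable and
the norm is arbitrary, the derivative of `‖w‖` is replaced by an estimate of difference quotients.
-/
theorem norm_le_of_scalar_equation [CompleteSpace V] {τ b : ℝ} {lam : ℂ} (hlam : lam.re < 0) (hb : 0 ≤ b)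
    {w h : ℝ → V} (hw : ContinuousOn w (Icc 0 τ)) (hh : ∀ t ∈ Icc 0 τ, ‖h t‖ ≤ b)
    (hi : ∀ t ∈ Icc 0 τ, IntervalIntegrable h volume 0 t)
    (hs : ∀ t ∈ Icc 0 τ, w t = ∫ ξ in (0 : ℝ)..t, (lam • w ξ + h ξ))
    {t : ℝ} (ht : t ∈ Icc 0 τ) : ‖w t‖ ≤ b / -lam.re := by
  have hw0 : w 0 = 0 := by simpa using hs 0 ⟨le_rfl, ht.1.trans ht.2⟩
  have hint : ∀ t ∈ Icc 0 τ, IntervalIntegrable (fun ξ => lam • w ξ + h ξ) volume 0 t := by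
    intro t ht
    refine IntervalIntegrable.add ?_ (hi t ht)
    refine ContinuousOn.intervalIntegrable ?_
    rw [uIcc_of_le ht.1]
    exact (hw.mono (Icc_subset_Icc_right ht.2)).const_smul lam
  have hg := le_gronwallBound_of_liminf_deriv_right_le (f := fun t => ‖w t‖)
      (f' := fun t => lam.re * ‖w t‖ + b) (δ := 0) (K := lam.re) (ε := b) (a := 0) (b := τ)
      hw.norm ?_ (by simp [hw0]) (fun _ _ => le_rfl) t ht
  · rw [gronwallBound_of_K_ne_0 hlam.ne] at hg
    refine hg.trans ?_
    have h1 : 0 < Real.exp (lam.re * (t - 0)) := Real.exp_pos _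
    have h2 : b / lam.re * (Real.exp (lam.re * (t - 0)) - 1) =
        b / -lam.re * (1 - Real.exp (lam.re * (t - 0))) := by
      rw [div_neg]; ring
    have h3 : 0 ≤ b / -lam.re := div_nonneg hb (by linarith)
    beta_reduce
    rw [zero_mul, zero_add, h2]
    nlinarith
  · intro x hx r hr
    refine Eventually.frequently ?_
    set η := r - (lam.re * ‖w x‖ + b) with hη
    have hη0 : 0 < η := sub_pos.2 hr
    -- The margin `η` in the slope is shared: one half pays for the oscillation of `w` near `x`,
    -- through `‖lam‖ q < η / 2`, the other for the quadratic term of `norm_one_add_mul_le`.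
    set q := η / (2 * (‖lam‖ + 1)) with hq
    have hq0 : 0 < q := by positivity
    have hcw : ∀ᶠ y in 𝓝[≥] x, ‖w y - w x‖ < q := by
      have h1 : ContinuousWithinAt w (Ici x) x :=
        (hw x ⟨hx.1, hx.2.le⟩).mono_of_mem_nhdsWithin
          (mem_of_superset (Icc_mem_nhdsGE hx.2) (Icc_subset_Icc_left hx.1))
      have h2 := tendsto_iff_norm_sub_tendsto_zero.1 h1
      exact h2.eventually (gt_mem_nhds hq0)
    obtain ⟨y₀, hy₀, hy₀'⟩ := mem_nhdsGE_iff_exists_Icc_subset.1 hcw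
    have hqw : ∀ᶠ y in 𝓝[>] x, (y - x) * (‖lam‖ ^ 2 / 2 * ‖w x‖) < η / 2 := by
      have h1 : Continuous fun y : ℝ => (y - x) * (‖lam‖ ^ 2 / 2 * ‖w x‖) := by fun_prop
      have h2 := (h1.tendsto x).mono_left (nhdsWithin_le_nhds (s := Ioi x))
      refine h2.eventually (gt_mem_nhds ?_)
      simpa using hη0
    filter_upwards [hqw, Ioc_mem_nhdsGT hx.2, Ioc_mem_nhdsGT (mem_Ioi.1 hy₀)] with y h1 h2 h3
    have hyx : 0 < y - x := sub_pos.2 h2.1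
    have hxm : x ∈ Icc 0 τ := ⟨hx.1, hx.2.le⟩
    have hym : y ∈ Icc 0 τ := ⟨hx.1.trans h2.1.le, h2.2⟩
    have hinc : w y - w x = ∫ ξ in x..y, (lam • w ξ + h ξ) := by
      rw [hs y hym, hs x hxm, intervalIntegral.integral_interval_sub_left (hint y hym)
        (hint x hxm)]
    have hxy : IntervalIntegrable (fun ξ => lam • w ξ + h ξ) volume x y :=
      (hint x hxm).symm.trans (hint y hym)
    have hrem : ‖∫ ξ in x..y, ((lam • w ξ + h ξ) - lam • w x)‖ ≤ (‖lam‖ * q + b) * |y - x| := by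
      refine intervalIntegral.norm_integral_le_of_norm_le_const fun ξ hξ => ?_
      rw [uIoc_of_le h2.1.le] at hξ
      have e1 : ‖w ξ - w x‖ < q := hy₀' ⟨hξ.1.le, hξ.2.trans h3.2⟩
      have e2 : lam • w ξ + h ξ - lam • w x = lam • (w ξ - w x) + h ξ := by
        rw [smul_sub]; abel
      rw [e2]
      refine (norm_add_le _ _).trans (add_le_add ?_ (hh ξ ⟨hx.1.trans hξ.1.le, hξ.2.trans h2.2⟩))
      rw [norm_smul]
      exact mul_le_mul_of_nonneg_left e1.le (norm_nonneg _)
    have hdec : w y = (1 + lam * ((y - x : ℝ) : ℂ)) • w x +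
        ∫ ξ in x..y, ((lam • w ξ + h ξ) - lam • w x) := by
      rw [intervalIntegral.integral_sub hxy intervalIntegrable_const, ← hinc,
        intervalIntegral.integral_const, add_smul, one_smul, mul_comm, mul_smul]
      simp only [Complex.coe_smul]
      abel
    have hn : ‖w y‖ ≤ (1 + (y - x) * lam.re + (y - x) ^ 2 * ‖lam‖ ^ 2 / 2) * ‖w x‖ +
        (‖lam‖ * q + b) * (y - x) := by
      rw [hdec]
      refine (norm_add_le _ _).trans (add_le_add ?_ ?_)
      · rw [norm_smul]
        exact mul_le_mul_of_nonneg_right (norm_one_add_mul_le lam (y - x)) (norm_nonneg _)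
      · rwa [abs_of_pos hyx] at hrem
    have hlq : ‖lam‖ * q < η / 2 := by
      rw [hq, ← mul_div_assoc, div_lt_div_iff₀ (by positivity) two_pos]
      nlinarith [norm_nonneg lam]
    rw [inv_mul_lt_iff₀ hyx]
    have h5 : r = η + (lam.re * ‖w x‖ + b) := by rw [hη]; ring
    have h6 : (y - x) * ((y - x) * (‖lam‖ ^ 2 / 2 * ‖w x‖)) < (y - x) * (η / 2) :=
      mul_lt_mul_of_pos_left h1 hyx
    have h7 : (y - x) * (‖lam‖ * q) < (y - x) * (η / 2) := mul_lt_mul_of_pos_left hlq hyx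
    rw [h5]
    nlinarith

/-- `z` solves `z' = L z + g`, `z(0) = 0` on `[0, τ]` with an input bounded by one. -/
def IsUnitResponse (L : V →L[ℂ] V) (τ : ℝ) (z : ℝ → V) : Prop :=
  ContinuousOn z (Icc 0 τ) ∧ ∃ g : ℝ → V, (∀ t ∈ Icc 0 τ, ‖g t‖ ≤ 1) ∧
    (∀ t ∈ Icc 0 τ, IntervalIntegrable g volume 0 t) ∧
    ∀ t ∈ Icc 0 τ, z t = ∫ ξ in (0 : ℝ)..t, (L (z ξ) + g ξ)

/-- One factor is peeled off at a time. If `Q` is the product of the remaining factors, then `w = Q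
z` solves the scalar equation `w' = a w + ((L - a) w + Q g)`, in which `(L - a) w` is bounded by
assumption; as `Re a < 0`, `w` is bounded as well. No diagonalization or Jordan form is needed. -/
theorem exists_bound_of_bound_prod [CompleteSpace V] (L : V →L[ℂ] V) (Λ : List ℂ)
    (hΛ : ∀ z ∈ Λ, z.re < 0) (c : ℝ)
    (hc : ∀ τ z, IsUnitResponse L τ z → ∀ t ∈ Icc 0 τ,
      ‖(Λ.map fun a => L - algebraMap ℂ (V →L[ℂ] V) a).prod (z t)‖ ≤ c) :
    ∃ c', ∀ τ z, IsUnitResponse L τ z → ∀ t ∈ Icc 0 τ, ‖z t‖ ≤ c' := by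
  induction Λ generalizing c with
  | nil => exact ⟨c, by simpa using hc⟩
  | cons a Λ ih =>
    set Q := (Λ.map fun a => L - algebraMap ℂ (V →L[ℂ] V) a).prod with hQ
    have hcomm : Commute L Q := by
      refine Commute.list_prod_right _ _ fun y hy => ?_
      obtain ⟨d, -, rfl⟩ := List.mem_map.1 hy
      exact (Commute.refl L).sub_right (Algebra.commutes d L).symm
    refine ih (fun z hz => hΛ z (List.mem_cons_of_mem _ hz)) ((|c| + ‖Q‖) / -a.re) ?_
    rintro τ z ⟨hz, g, hg1, hgi, hzs⟩ t ht
    have hbd := hc τ z ⟨hz, g, hg1, hgi, hzs⟩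
    simp only [List.map_cons, List.prod_cons, ← hQ] at hbd
    have hLz : ∀ t ∈ Icc 0 τ, IntervalIntegrable (fun ξ => L (z ξ)) volume 0 t := by
      intro t ht
      refine ContinuousOn.intervalIntegrable ?_
      rw [uIcc_of_le ht.1]
      exact L.continuous.comp_continuousOn (hz.mono (Icc_subset_Icc_right ht.2))
    have hQc : ContinuousOn (fun t => Q (z t)) (Icc 0 τ) := Q.continuous.comp_continuousOn hz
    refine norm_le_of_scalar_equation (h := fun ξ =>
      (L - algebraMap ℂ (V →L[ℂ] V) a) (Q (z ξ)) + Q (g ξ))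
      (hΛ a List.mem_cons_self) (by positivity) hQc ?_ ?_ ?_ ht
    · intro t ht
      refine (norm_add_le _ _).trans (add_le_add ((hbd t ht).trans (le_abs_self c)) ?_)
      exact (Q.le_opNorm_of_le (hg1 t ht)).trans_eq (mul_one _)
    · intro t ht
      refine IntervalIntegrable.add ?_ ?_
      · refine ContinuousOn.intervalIntegrable ?_
        rw [uIcc_of_le ht.1]
        exact ContinuousLinearMap.continuous _ |>.comp_continuousOn
          (hQc.mono (Icc_subset_Icc_right ht.2))
      · exact ⟨Q.integrable_comp (hgi t ht).1, Q.integrable_comp (hgi t ht).2⟩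
    · intro t ht
      nth_rewrite 1 [hzs t ht]
      rw [← ContinuousLinearMap.intervalIntegral_comp_comm Q ((hLz t ht).add (hgi t ht))]
      refine intervalIntegral.integral_congr fun ξ _ => ?_
      have h1 : Q (L (z ξ)) = L (Q (z ξ)) := by
        have := congrArg (fun T : V →L[ℂ] V => T (z ξ)) hcomm.eq
        exact this.symm
      simp only [map_add, h1, sub_apply, Algebra.algebraMap_eq_smul_one, smul_apply,
        one_apply_eq_self]
      abel

/-- The polynomial splits over `ℂ`, so the product over all its roots annihilates `z`; this is the
bound with constant 0 from which the factors are peeled off. -/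
theorem exists_bound_of_aeval_eq_zero [CompleteSpace V] (L : V →L[ℂ] V) {q : Polynomial ℂ}
    (hq : q.Monic) (hroots : ∀ z ∈ q.roots, z.re < 0) (hL : Polynomial.aeval L q = 0) :
    ∃ c, ∀ τ z, IsUnitResponse L τ z → ∀ t ∈ Icc 0 τ, ‖z t‖ ≤ c := by
  refine exists_bound_of_bound_prod L q.roots.toList (fun z hz => hroots z (by simpa using hz)) 0 ?_
  intro τ z _ t _
  have h1 : q = (q.roots.toList.map fun a => Polynomial.X - Polynomial.C a).prod := by
    conv_lhs => rw [(IsAlgClosed.splits q).eq_prod_roots_of_monic hq]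
    conv_lhs => rw [← Multiset.coe_toList q.roots]
    rw [Multiset.map_coe, Multiset.prod_coe]
  have h2 : (q.roots.toList.map fun a => L - algebraMap ℂ (V →L[ℂ] V) a).prod = 0 := by
    have h3 := hL
    rw [h1, map_list_prod, List.map_map] at h3
    rw [← h3]
    congr 1
    refine List.map_congr_left fun a _ => ?_
    simp
  rw [h2]
  simp

end Hurwitz

variable {k : ℕ}

/-- Bounded inputs of a Hurwitz system with zero initial state produce bounded states. -/
theorem IsHurwitz.exists_bound {M : Mat k k} (hM : IsHurwitz M) :
    ∃ c, ∀ (τ : ℝ) (x u : ℝ → Vec k), 0 ≤ τ → (∀ t ∈ Icc 0 τ, ‖u t‖ ≤ 1) →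
      SolvesOn (Icc 0 τ) x 0 (fun t => M (x t) + u t) → ∀ t ∈ Icc 0 τ, ‖x t‖ ≤ c := by
  let b := (EuclideanSpace.basisFun (Fin k) ℝ).toBasis
  let A : Matrix (Fin k) (Fin k) ℝ := LinearMap.toMatrix b b (M : Vec k →ₗ[ℝ] Vec k)
  -- Complexification: the real system is embedded by `ι` in `ℂ^k` with the sup norm. The embedding
  -- does not increase norms, so unit inputs stay unit inputs, and it is antilipschitz, so a bound
  -- on the image returns to `x` with the factor `κ`. The Cayley–Hamilton theorem provides the
  -- annihilating polynomial.
  let AC : Matrix (Fin k) (Fin k) ℂ := A.map (algebraMap ℝ ℂ)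
  let Φ : Matrix (Fin k) (Fin k) ℂ →ₐ[ℂ] ((Fin k → ℂ) →L[ℂ] (Fin k → ℂ)) :=
    (Module.End.toContinuousLinearMap (Fin k → ℂ)).toAlgHom.comp
      (Matrix.toLinAlgEquiv' : Matrix (Fin k) (Fin k) ℂ ≃ₐ[ℂ] _).toAlgHom
  let L := Φ AC
  have hLapp : ∀ v, L v = AC.mulVec v := fun v => rfl
  let ι₀ : Vec k →ₗ[ℝ] (Fin k → ℂ) :=
    { toFun := fun x i => (x i : ℂ)
      map_add' := fun x y => by ext i; simp
      map_smul' := fun c x => by ext i; simp }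
  let ι : Vec k →L[ℝ] (Fin k → ℂ) := LinearMap.toContinuousLinearMap ι₀
  have hιapp : ∀ x i, ι x i = (x i : ℂ) := fun x i => rfl
  have hιn : ∀ x : Vec k, ‖ι x‖ ≤ ‖x‖ := by
    intro x
    refine (pi_norm_le_iff_of_nonneg (norm_nonneg _)).2 fun i => ?_
    rw [hιapp, Complex.norm_real]
    exact PiLp.norm_apply_le x i
  have hker : LinearMap.ker ι₀ = ⊥ := by
    rw [LinearMap.ker_eq_bot']
    intro x hx
    ext i
    have := congrFun hx i
    have h2 : (x i : ℂ) = 0 := this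
    simpa using h2
  obtain ⟨κ, -, hκ⟩ := LinearMap.exists_antilipschitzWith ι₀ hker
  have hMι : ∀ x, ι (M x) = L (ι x) := by
    intro x
    ext i
    rw [hLapp, hιapp]
    have h1 : (M x) i = A.mulVec (fun j => x j) i := by
      have := congrFun (LinearMap.toMatrix_mulVec_repr b b (M : Vec k →ₗ[ℝ] Vec k) x) i
      have h2 : (b.repr x : Fin k → ℝ) = fun j => x j := by
        ext j
        simp [b]
      rw [h2] at this
      simpa [b, A] using this.symm
    rw [h1]
    simp [Matrix.mulVec, dotProduct, AC, hιapp]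
  have hchar : AC.charpoly = (LinearMap.charpoly (M : Vec k →ₗ[ℝ] Vec k)).map
      (algebraMap ℝ ℂ) := by
    rw [Matrix.charpoly_map, LinearMap.charpoly_toMatrix]
  have hL : Polynomial.aeval L AC.charpoly = 0 := by
    rw [Polynomial.aeval_algHom_apply, Matrix.aeval_self_charpoly, map_zero]
  obtain ⟨c, hc⟩ := exists_bound_of_aeval_eq_zero L AC.charpoly_monic
    (by rw [hchar]; exact hM) hL
  refine ⟨κ * c, fun τ x u hτ hu hx t ht => ?_⟩
  have hxc := hx.continuousOn hτ
  have hui : ∀ t ∈ Icc 0 τ, IntervalIntegrable u volume 0 t := by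
    intro t ht
    have h1 : IntervalIntegrable (fun ξ => M (x ξ)) volume 0 t := by
      refine ContinuousOn.intervalIntegrable ?_
      rw [uIcc_of_le ht.1]
      exact M.continuous.comp_continuousOn (hxc.mono (Icc_subset_Icc_right ht.2))
    simpa using (hx t ht).1.sub h1
  have hr : IsUnitResponse L τ (fun t => ι (x t)) := by
    refine ⟨ι.continuous.comp_continuousOn hxc, fun t => ι (u t),
      fun t ht => (hιn _).trans (hu t ht),
      fun t ht => ⟨ι.integrable_comp (hui t ht).1, ι.integrable_comp (hui t ht).2⟩,
      fun t ht => ?_⟩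
    beta_reduce
    nth_rewrite 1 [(hx t ht).2]
    rw [zero_add, ← ContinuousLinearMap.intervalIntegral_comp_comm ι (hx t ht).1]
    simp only [map_add, hMι]
  have h1 := hκ.le_mul_dist (x t) 0
  rw [map_zero, dist_zero_right, dist_zero_right] at h1
  exact h1.trans (mul_le_mul_of_nonneg_left (hc τ _ hr t ht) κ.2)

/-- A nonzero kernel vector would make 0 a root of the characteristic polynomial, and its real part
is not negative. -/
theorem IsHurwitz.injective {M : Mat k k} (hM : IsHurwitz M) : Function.Injective M := by
  rw [injective_iff_map_eq_zero]
  intro v hv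
  by_contra hne
  have h1 : Module.End.HasEigenvalue (M : Vec k →ₗ[ℝ] Vec k) 0 :=
    Module.End.hasEigenvalue_of_hasEigenvector (x := v)
      ⟨Module.End.mem_eigenspace_iff.2 (by simpa using hv), hne⟩
  have h2 := (Module.End.hasEigenvalue_iff_isRoot_charpoly _ _).1 h1
  have h3 : (0 : ℂ) ∈ ((LinearMap.charpoly (M : Vec k →ₗ[ℝ] Vec k)).map
      (algebraMap ℝ ℂ)).roots := by
    rw [Polynomial.mem_roots ((LinearMap.charpoly_monic _).map _).ne_zero]
    have := h2.map (f := algebraMap ℝ ℂ)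
    simpa using this
  simpa using hM 0 h3

end LPV

namespace LPV

/-! ### Gains -/

section Gains

variable {s k l : ℕ} {τ : ℝ}

theorem linf_le_ofReal {J : Set ℝ} {x : ℝ → Vec k} {b : ℝ} (h : ∀ t ∈ J, ‖x t‖ ≤ b) :
    linf J x ≤ ENNReal.ofReal b := by
  refine iSup₂_le fun t ht => ?_
  rw [← ofReal_norm]
  exact ENNReal.ofReal_le_ofReal (h t ht)

theorem norm_le_of_linf_le {J : Set ℝ} {x : ℝ → Vec k} {b : ℝ} (hb : 0 ≤ b)
    (h : linf J x ≤ ENNReal.ofReal b) {t : ℝ} (ht : t ∈ J) : ‖x t‖ ≤ b := by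
  have h1 : ‖x t‖ₑ ≤ ENNReal.ofReal b :=
    (le_iSup₂ (f := fun t (_ : t ∈ J) => ‖x t‖ₑ) t ht).trans h
  rw [← ofReal_norm] at h1
  exact (ENNReal.ofReal_le_ofReal_iff hb).1 h1

theorem IOMap.IsPPGBound.norm_le {G : IOMap s k l} {adm : Set (ℝ → Vec s)} {γ : ℝ}
    (hG : G.IsPPGBound adm γ) {θ : ℝ → Vec s} (hθ : θ ∈ adm) (hτ : 0 ≤ τ) {u : ℝ → Vec k}
    (hu : Measurable u) {y : ℝ → Vec l} (hy : G (Icc 0 τ) θ u y) {b : ℝ}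
    (hb : ∀ t ∈ Icc 0 τ, ‖u t‖ ≤ b) {t : ℝ} (ht : t ∈ Icc 0 τ) : ‖y t‖ ≤ γ * b := by
  have hb0 : 0 ≤ b := (norm_nonneg _).trans (hb t ht)
  refine norm_le_of_linf_le (mul_nonneg hG.1.le hb0) ?_ ht
  refine (hG.2 θ hθ τ hτ u hu y hy).trans ?_
  rw [ENNReal.ofReal_mul hG.1.le]
  gcongr
  exact linf_le_ofReal hb

theorem measurable_clm_apply {W : ℝ → Mat l k} (hW : Continuous W) {v : ℝ → Vec k}
    (hv : Measurable v) : Measurable fun t => W t (v t) :=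
  ContinuousLinearMap.measurable_apply₂.comp (hW.measurable.prodMk hv)

end Gains

section Extension

variable {k : ℕ}

/-- A solution of a time-invariant system is continued by free motion. -/
theorem exists_solvesOn_Ici {M : Mat k k} {τ : ℝ} (hτ : 0 ≤ τ) {x u : ℝ → Vec k} {x₀ : Vec k}
    (hx : SolvesOn (Icc 0 τ) x x₀ (fun t => M (x t) + u t)) :
    ∃ x' : ℝ → Vec k, (∀ t ∈ Icc 0 τ, x' t = x t) ∧
      SolvesOn (Ici 0) x' x₀ (fun t => M (x' t) + (Icc 0 τ).indicator u t) := by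
  let e : ℝ → Vec k := fun t => NormedSpace.exp ((t - τ) • M) (x τ)
  have he : ∀ t, HasDerivAt e (M (e t)) t := by
    intro t
    have h1 := (hasDerivAt_exp_smul_const' (𝕂 := ℝ) M (t - τ)).comp_sub_const t τ
    have h2 := h1.clm_apply (hasDerivAt_const t (x τ))
    simpa [e] using h2
  have hec : Continuous e := continuous_iff_continuousAt.2 fun t => (he t).continuousAt
  have heτ : e τ = x τ := by
    have h0 : (τ - τ) • M = 0 := by rw [sub_self]; exact zero_smul ℝ M
    change NormedSpace.exp ((τ - τ) • M) (x τ) = x τ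
    rw [h0, NormedSpace.exp_zero]
    rfl
  let x' : ℝ → Vec k := fun t => if t ≤ τ then x t else e t
  have hx1 : ∀ t ∈ Icc 0 τ, x' t = x t := fun t ht => if_pos ht.2
  have hx2 : ∀ t, τ ≤ t → x' t = e t := by
    intro t ht
    rcases ht.eq_or_lt with rfl | h
    · simp [x', heτ]
    · exact if_neg (not_le.2 h)
  refine ⟨x', hx1, ?_⟩
  have hs : SolvesOn (Icc 0 τ) x' x₀ (fun t => M (x' t) + (Icc 0 τ).indicator u t) :=
    (hx.congr_state hx1).congr_rhs fun t ht => by rw [hx1 t ht, indicator_of_mem ht]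
  intro t ht
  rcases le_or_gt t τ with htτ | htτ
  · exact hs t ⟨ht, htτ⟩
  · obtain ⟨hi, hxτ⟩ := hs τ ⟨hτ, le_rfl⟩
    have hcongr : ∀ ξ ∈ uIoc τ t, M (x' ξ) + (Icc 0 τ).indicator u ξ = M (e ξ) := by
      intro ξ hξ
      rw [uIoc_of_le htτ.le] at hξ
      rw [hx2 ξ hξ.1.le, indicator_of_notMem (fun h => not_le.2 hξ.1 h.2), add_zero]
    have hMe : Continuous fun ξ => M (e ξ) := M.continuous.comp hec
    have hi2 : IntervalIntegrable (fun t => M (x' t) + (Icc 0 τ).indicator u t) volume τ t :=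
      (hMe.intervalIntegrable τ t).congr fun ξ hξ => (hcongr ξ hξ).symm
    refine ⟨hi.trans hi2, ?_⟩
    rw [← intervalIntegral.integral_add_adjacent_intervals hi hi2, ← add_assoc, ← hxτ,
      intervalIntegral.integral_congr_ae (Eventually.of_forall hcongr),
      intervalIntegral.integral_eq_sub_of_hasDerivAt (fun ξ _ => he ξ)
        (hMe.intervalIntegrable τ t), hx2 t htτ.le, hx2 τ le_rfl]
    abel

end Extension

namespace Setup

variable {n m p s nH nF : ℕ} {S : Setup n m p s nH nF} {θ : ℝ → Vec s} {τ : ℝ}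

/-! ### The filter -/

theorem filter_contOn : S.filter.ContOn S.Θ :=
  ⟨continuousOn_const, continuousOn_const, continuousOn_const, continuousOn_const⟩

section Filter

variable (hS : S.Assumptions)

include hS

/-- The stability of the filter for the true gain `ω` already forces `ωK` to be invertible; in
finite dimension `K` and `ω` are then invertible separately. -/
theorem Assumptions.ωK_inj : Function.Injective (S.ω ∘L S.K) := by
  have h := (hS.filter_stable _ hS.ω_mem).injective
  intro v w hvw
  apply h
  simpa using hvw

theorem Assumptions.K_inj : Function.Injective S.K :=
  Function.Injective.of_comp (f := S.ω) (g := S.K) hS.ωK_inj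

theorem Assumptions.K_surj : Function.Surjective S.K :=
  (LinearMap.injective_iff_surjective (f := (S.K : Vec m →ₗ[ℝ] Vec m))).1 hS.K_inj

theorem Assumptions.ω_inj : Function.Injective S.ω := by
  intro v w hvw
  obtain ⟨v', rfl⟩ := hS.K_surj v
  obtain ⟨w', rfl⟩ := hS.K_surj w
  rw [hS.ωK_inj hvw]

theorem Assumptions.ωinv_ω (v : Vec m) : S.ωinv (S.ω v) = v := by
  obtain ⟨e, he⟩ := exists_equiv_of_injective hS.ω_inj
  rw [ωinv, ← he, ContinuousLinearMap.inverse_equiv]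
  simp

theorem Assumptions.ω_ωinv (v : Vec m) : S.ω (S.ωinv v) = v := by
  obtain ⟨e, he⟩ := exists_equiv_of_injective hS.ω_inj
  rw [ωinv, ← he, ContinuousLinearMap.inverse_equiv]
  simp

theorem Assumptions.exists_K_inverse : ∃ Ki : Mat m m, ∀ v, S.K (Ki v) = v ∧ Ki (S.K v) = v := by
  obtain ⟨e, he⟩ := exists_equiv_of_injective hS.K_inj
  refine ⟨e.symm, fun v => ?_⟩
  rw [← he]
  simp

theorem Assumptions.norm_ωinv_pos (hm : 0 < m) : 0 < ‖S.ωinv‖ := by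
  rw [norm_pos_iff]
  intro h
  have h1 := hS.ω_ωinv (EuclideanSpace.single ⟨0, hm⟩ 1)
  rw [h] at h1
  have h2 := congrArg (fun v : Vec m => v ⟨0, hm⟩) h1
  simp at h2

/-- Finiteness is indispensable: `l1ωC` is a `toReal`, which would be 0 if the gain were infinite.
-/
theorem ppg_ωC_ne_top : IOMap.ppg S.mapωC S.adm ≠ ⊤ := by
  obtain ⟨c, hc⟩ := (hS.filter_stable _ hS.ω_mem).exists_bound
  refine ne_top_of_le_ne_top (ENNReal.ofReal_ne_top (r := ‖S.ωinv‖ * (‖S.ω ∘L S.K‖ * c))) ?_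
  refine iSup₂_le fun θ _ => iSup₂_le fun u _ => iSup_le fun hu => iSup₂_le fun y hy => ?_
  obtain ⟨v, ⟨x, hx, hv⟩, hy⟩ := hy
  refine linf_le_ofReal fun t ht => ?_
  have hxt : ‖x t‖ ≤ c := by
    refine hc t x u ht (fun r hr => ?_) (hx.mono Icc_subset_Ici_self) t ⟨ht, le_rfl⟩
    exact norm_le_of_linf_le zero_le_one (by simpa using hu) (mem_Ici.2 hr.1)
  rw [hy t ht, hv t ht]
  simp only [filter, zero_apply, add_zero]
  exact ContinuousLinearMap.le_opNorm_of_le _ (ContinuousLinearMap.le_opNorm_of_le _ hxt)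

/-- The gain is defined by inputs of norm at most one on `[0, ∞)`. A truncated input is scaled by
`b⁻¹`, cut off to zero after `τ`, and the filter state continues by free motion. The scaling needs
`b > 0`; the general case is a limit. -/
theorem norm_ωC_le_of_pos (hθ : θ ∈ S.adm) (hτ : 0 ≤ τ) {u : ℝ → Vec m} (hu : Measurable u)
    {y : ℝ → Vec m} (hy : S.mapC (Icc 0 τ) θ u y) {b : ℝ} (hb0 : 0 < b)
    (hb : ∀ t ∈ Icc 0 τ, ‖u t‖ ≤ b) {t : ℝ} (ht : t ∈ Icc 0 τ) :
    ‖S.ωinv (y t)‖ ≤ S.l1ωC * b := by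
  obtain ⟨x, hx, hxy⟩ := StateSpace.map_smul hy b⁻¹
  obtain ⟨x', hx', hs⟩ := exists_solvesOn_Ici hτ (M := -(S.ω ∘L S.K)) hx
  have hmap : S.mapωC (Ici 0) θ ((Icc 0 τ).indicator fun t => b⁻¹ • u t)
      (fun t => S.ωinv ((S.ω ∘L S.K) (x' t))) := by
    refine ⟨fun t => (S.ω ∘L S.K) (x' t), ⟨x', hs, fun t _ => ?_⟩, fun t _ => rfl⟩
    simp [filter]
  have hmeas : Measurable ((Icc 0 τ).indicator fun t => b⁻¹ • u t) :=
    (hu.const_smul b⁻¹).indicator measurableSet_Icc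
  have hle1 : linf (Ici 0) ((Icc 0 τ).indicator fun t => b⁻¹ • u t) ≤ 1 := by
    rw [← ENNReal.ofReal_one]
    refine linf_le_ofReal fun r _ => ?_
    by_cases hr : r ∈ Icc 0 τ
    · rw [indicator_of_mem hr, norm_smul, norm_inv, Real.norm_of_nonneg hb0.le,
        inv_mul_le_iff₀ hb0, mul_one]
      exact hb r hr
    · rw [indicator_of_notMem hr, norm_zero]
      exact zero_le_one
  have h1 : linf (Ici 0) (fun t => S.ωinv ((S.ω ∘L S.K) (x' t))) ≤
      IOMap.ppg S.mapωC S.adm := by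
    refine le_iSup₂_of_le θ hθ (le_iSup₂_of_le _ hmeas (le_iSup_of_le hle1 ?_))
    exact le_iSup₂_of_le _ hmap le_rfl
  rw [← ENNReal.ofReal_toReal (ppg_ωC_ne_top hS)] at h1
  have h2 := norm_le_of_linf_le ENNReal.toReal_nonneg h1 (mem_Ici.2 ht.1)
  have h3 : b⁻¹ • y t = (S.ω ∘L S.K) (x' t) := by
    have h4 := hxy t ht
    beta_reduce at h4
    rw [h4, hx' t ht]
    simp [filter]
  rw [← h3, map_smul, norm_smul, norm_inv, Real.norm_of_nonneg hb0.le,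
    inv_mul_le_iff₀ hb0] at h2
  rw [mul_comm]
  exact h2

/-- The truncated gain of `ω⁻¹ 𝓒` is bounded by its `L₁` norm. -/
theorem norm_ωC_le (hθ : θ ∈ S.adm) (hτ : 0 ≤ τ) {u : ℝ → Vec m} (hu : Measurable u)
    {y : ℝ → Vec m} (hy : S.mapC (Icc 0 τ) θ u y) {b : ℝ}
    (hb : ∀ t ∈ Icc 0 τ, ‖u t‖ ≤ b) {t : ℝ} (ht : t ∈ Icc 0 τ) :
    ‖S.ωinv (y t)‖ ≤ S.l1ωC * b := by
  have hb0 : 0 ≤ b := (norm_nonneg _).trans (hb t ht)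
  have h : ∀ ε > 0, ‖S.ωinv (y t)‖ ≤ S.l1ωC * (b + ε) := fun ε hε =>
    norm_ωC_le_of_pos hS hθ hτ hu hy (by linarith) (fun r hr => (hb r hr).trans (by linarith)) ht
  have hlim : Tendsto (fun ε => S.l1ωC * (b + ε)) (𝓝[>] 0) (𝓝 (S.l1ωC * b)) := by
    have hc : Continuous fun ε : ℝ => S.l1ωC * (b + ε) := by fun_prop
    have := (hc.tendsto 0).mono_left (nhdsWithin_le_nhds (s := Ioi (0 : ℝ)))
    simpa using this
  exact ge_of_tendsto hlim (by filter_upwards [self_mem_nhdsWithin] with ε hε using h ε hε)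

end Filter

theorem l1ωC_nonneg : 0 ≤ S.l1ωC := ENNReal.toReal_nonneg

/-! ### Decomposition of the state -/

theorem mapHxm_of_solvesOn {v : ℝ → Vec m} {y : ℝ → Vec n}
    (h : SolvesOn (Icc 0 τ) y 0 (fun t => S.Am (θ t) (y t) + S.B (θ t) (v t))) :
    S.mapHxm (Icc 0 τ) θ v y :=
  ⟨y, h, fun t _ => by simp⟩

theorem mapHxum_of_solvesOn {v : ℝ → Vec (n - m)} {y : ℝ → Vec n}
    (h : SolvesOn (Icc 0 τ) y 0 (fun t => S.Am (θ t) (y t) + S.Bu (θ t) (v t))) :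
    S.mapHxum (Icc 0 τ) θ v y :=
  ⟨y, h, fun t _ => by simp⟩

/-- A state driven by `η₁ - c` and `η₂`, with `c = 𝓒 (η₁ + 𝓗bar η₂ - v)`, is the sum of
`𝓖xm η₁`, `𝓖xum η₂`, `𝓗xm 𝓒 v` and a free motion. -/
theorem exists_decomposition (hS : S.Assumptions) (hθ : θ ∈ S.adm) (hτ : 0 ≤ τ)
    {e : ℝ → Vec n} {e₀ : Vec n} {η₁ v h c : ℝ → Vec m} {η₂ : ℝ → Vec (n - m)}
    (hη₁ : Continuous η₁) (hη₂ : Continuous η₂) (hh : S.mapHbar (Icc 0 τ) θ η₂ h)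
    (hc : S.mapC (Icc 0 τ) θ (fun t => η₁ t + h t - v t) c)
    (he : SolvesOn (Icc 0 τ) e e₀ (fun t =>
      S.Am (θ t) (e t) + S.B (θ t) (η₁ t - c t) + S.Bu (θ t) (η₂ t))) :
    ∃ (c₁ c₂ cv : ℝ → Vec m) (y₁ y₂ y₃ xin : ℝ → Vec n),
      S.mapC (Icc 0 τ) θ η₁ c₁ ∧ S.mapC (Icc 0 τ) θ h c₂ ∧ S.mapC (Icc 0 τ) θ v cv ∧
      (∀ t ∈ Icc 0 τ, c t = c₁ t + c₂ t - cv t) ∧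
      S.mapGxm (Icc 0 τ) θ η₁ y₁ ∧ S.mapGxum (Icc 0 τ) θ η₂ y₂ ∧ S.mapHxm (Icc 0 τ) θ cv y₃ ∧
      SolvesOn (Icc 0 τ) xin e₀ (fun t => S.Am (θ t) (xin t)) ∧
      ∀ t ∈ Icc 0 τ, e t = y₁ t + y₂ t + y₃ t + xin t := by
  have hhc : ContinuousOn h (Icc 0 τ) :=
    StateSpace.continuousOn_of_map hτ hS.Hbar_cont hθ hh (Or.inr hη₂.continuousOn)
  have hA := Trajectories.continuousOn_comp hθ hS.Am_cont τ
  have hB := Trajectories.continuousOn_comp hθ hS.B_cont τ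
  have hBu := Trajectories.continuousOn_comp hθ hS.Bu_cont τ
  obtain ⟨c₁, hc₁, hc₁c⟩ := StateSpace.exists_map hτ (filter_contOn (S := S)) hθ
    hη₁.continuousOn
  obtain ⟨c₂, hc₂, hc₂c⟩ := StateSpace.exists_map hτ (filter_contOn (S := S)) hθ hhc
  -- The response to `v` is defined as what remains of `c` once the responses to `η₁` and `h` are
  -- taken out. This avoids solving an equation with the possibly discontinuous input `v`; `y₃`
  -- below is obtained in the same way.
  have hcv : S.mapC (Icc 0 τ) θ v (fun t => c₁ t + c₂ t - c t) :=
    StateSpace.map_congr (StateSpace.map_sub (StateSpace.map_add hc₁ hc₂) hc)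
      (fun t _ => by abel) (fun t _ => rfl)
  obtain ⟨y₁, hy₁⟩ := exists_solvesOn_linear hτ hA
    (hB.clm_apply (hη₁.sub hc₁c).continuousOn) 0
  obtain ⟨a, ha⟩ := exists_solvesOn_linear hτ hA (hBu.clm_apply hη₂.continuousOn) 0
  obtain ⟨b, hb⟩ := exists_solvesOn_linear hτ hA (hB.clm_apply hc₂c.continuousOn) 0
  obtain ⟨xin, hxin⟩ := exists_solvesOn_linear hτ hA continuousOn_const e₀ (g := fun _ => 0)
  simp only [add_zero] at hxin
  have hy₃ : SolvesOn (Icc 0 τ) (fun t => e t - xin t - y₁ t - (a t - b t)) 0 (fun t =>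
      S.Am (θ t) (e t - xin t - y₁ t - (a t - b t)) + S.B (θ t) (c₁ t + c₂ t - c t)) := by
    have h1 := ((he.sub hxin).sub hy₁).sub (ha.sub hb)
    have h0 : e₀ - e₀ - 0 - (0 - 0) = (0 : Vec n) := by simp
    rw [h0] at h1
    refine h1.congr_rhs fun t _ => ?_
    simp only [map_sub, map_add, Pi.sub_apply]
    abel
  refine ⟨c₁, c₂, _, y₁, fun t => a t - b t, _, xin, hc₁, hc₂, hcv, fun t _ => by abel, ?_, ?_,
    mapHxm_of_solvesOn hy₃, hxin, fun t _ => by beta_reduce; abel⟩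
  · exact ⟨_, ⟨η₁, c₁, fun t _ => rfl, hc₁, fun t _ => rfl⟩, mapHxm_of_solvesOn hy₁⟩
  · exact ⟨a, b, mapHxum_of_solvesOn ha,
      ⟨c₂, ⟨h, hh, hc₂⟩, mapHxm_of_solvesOn hb⟩, fun t _ => rfl⟩

/-- The free motion of the ideal closed loop. -/
theorem norm_free_le (hS : S.Assumptions) (hθ : θ ∈ S.adm) (hτ : 0 ≤ τ) (hn : 0 < n)
    {x : ℝ → Vec n} {x₀ : Vec n}
    (hx : SolvesOn (Icc 0 τ) x x₀ (fun t => S.Am (θ t) (x t))) {t : ℝ} (ht : t ∈ Icc 0 τ) :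
    ‖x t‖ ≤ Real.sqrt (lamMax S.Θ S.P / lamMin S.Θ S.P) * ‖x₀‖ := by
  have hxc := hx.continuousOn hτ
  have hgc : ContinuousOn (fun t => S.Am (θ t) (x t)) (Icc 0 τ) :=
    (Trajectories.continuousOn_comp hθ hS.Am_cont τ).clm_apply hxc
  have h := hS.lyap.norm_le isCompact_Θ hn hθ le_rfl (w := fun _ => 0) (c := 0) hxc
    (fun r hr => by
      have h1 : ContinuousWithinAt (fun t => S.Am (θ t) (x t)) (Ici r) r :=
        (hgc r ⟨hr.1, hr.2.le⟩).mono_of_mem_nhdsWithin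
          (mem_of_superset (Icc_mem_nhdsGE hr.2) (Icc_subset_Icc_left hr.1))
      simpa using hx.hasDerivWithinAt_right hr h1)
    (fun _ _ => by simp) le_rfl ht
  rw [mul_zero, add_zero, hx.zero_apply ⟨le_rfl, hτ⟩] at h
  refine h.trans ?_
  have hE : Real.exp (-(S.μP / 2 * (t - 0))) ≤ 1 := Real.exp_le_one_iff.2 (by
    have := mul_nonneg (half_pos hS.lyap.mu_pos).le ht.1
    linarith)
  have hq : 0 ≤ Real.sqrt (lamMax S.Θ S.P / lamMin S.Θ S.P) := Real.sqrt_nonneg _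
  exact mul_le_mul_of_nonneg_right (mul_le_of_le_one_right hq hE) (norm_nonneg _)

/-! ### The mapping from the estimation error to the input -/

/-- With `s = exp(-y/2)` this is `(1 - s)² ≤ 1 - s²` on `[0, 1]`. It converts the rate `μ/2` of the
Lyapunov estimate into the form of `beta`. -/
theorem one_sub_exp_half_le_sqrt {y : ℝ} (hy : 0 ≤ y) :
    1 - Real.exp (-(y / 2)) ≤ Real.sqrt (1 - Real.exp (-y)) := by
  apply Real.le_sqrt_of_sq_le
  have h1 : Real.exp (-y) = Real.exp (-(y / 2)) ^ 2 := by
    rw [← Real.exp_nat_mul]; congr 1; push_cast; ring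
  have h2 : Real.exp (-(y / 2)) ≤ 1 := Real.exp_le_one_iff.2 (by linarith)
  rw [h1]
  nlinarith [Real.exp_pos (-(y / 2))]

/-- The realization has no feedthrough, so the large input on `[0, T)` can build up only a state of
size `beta T · b₁`. After `T` this state decays up to the factor `√(lamMax / lamMin)`, and the small
input adds at most `betaInf · b₂`. -/
theorem norm_F_le (hS : S.Assumptions) (hθ : θ ∈ S.adm) (hτ : 0 ≤ τ) {T : ℝ} (hT : 0 < T)
    {v : ℝ → Vec n} {y : ℝ → Vec m} (hv : Measurable v)
    (hvr : ∀ t ∈ Ico 0 τ, ContinuousWithinAt v (Ici t) t)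
    (hy : S.mapF (Icc 0 τ) θ v y) {b₁ b₂ : ℝ} (hb₁ : 0 ≤ b₁) (hb₂ : 0 ≤ b₂)
    (h₁ : ∀ t ∈ Icc 0 τ, t < T → ‖v t‖ ≤ b₁) (h₂ : ∀ t ∈ Icc 0 τ, T ≤ t → ‖v t‖ ≤ b₂)
    {t : ℝ} (ht : t ∈ Icc 0 τ) :
    ‖y t‖ ≤ maxNorm S.Θ S.CF *
      (Real.sqrt (lamMax S.Θ S.PF / lamMin S.Θ S.PF) * beta S.Θ T S.μF S.PF S.BF * b₁ +
        betaInf S.Θ S.μF S.PF S.BF * b₂) := by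
  have hbdd : linf (Icc 0 τ) v ≠ ⊤ := by
    refine ne_top_of_le_ne_top (ENNReal.ofReal_ne_top (r := max b₁ b₂))
      (linf_le_ofReal fun t ht => ?_)
    rcases lt_or_ge t T with h | h
    · exact (h₁ t ht h).trans (le_max_left _ _)
    · exact (h₂ t ht h).trans (le_max_right _ _)
  obtain ⟨x, hx, hxy⟩ := (hS.realF θ hθ τ hτ v hv hbdd y).2 hy
  obtain ⟨hAc, hBc, hCc, -⟩ := hS.sysF_cont
  simp only [sysF, zero_apply, add_zero] at hx hxy hAc hBc hCc
  have hL := hS.lyapF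
  have hμ := hL.mu_pos
  rw [hxy t ht]
  refine ContinuousLinearMap.le_of_opNorm_le_of_le _
    (norm_le_maxNorm isCompact_Θ hCc (mem_Θ hθ ht.1)) ?_
  have hne : S.Θ.Nonempty := ⟨θ 0, mem_Θ hθ le_rfl⟩
  rcases Nat.eq_zero_or_pos nF with hF | hF
  · subst hF
    have : x t = 0 := Subsingleton.elim _ _
    rw [this, norm_zero]
    -- Without states the spectrum is empty, so `lamMin` is the default value 0 and, by division by
    -- zero, `beta` and `betaInf` vanish too. The claim is then `0 ≤ 0`.
    have hm1 : lamMin S.Θ S.PF = 0 := by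
      have : {c | ∃ θ ∈ S.Θ, c ∈ spectrum ℝ (S.PF θ)} = ∅ := by
        ext c
        simp only [mem_ofPred_eq, mem_empty_iff_false, iff_false, not_exists, not_and]
        intro θ _ hc
        obtain ⟨w, hw, -⟩ := exists_eigenvector_of_mem_spectrum hc
        exact hw (Subsingleton.elim _ _)
      rw [lamMin, this, Real.sInf_empty]
    simp [beta, betaInf, hm1]
  have hxc := hx.continuousOn hτ
  set lm := lamMin S.Θ S.PF with hlm
  set lM := lamMax S.Θ S.PF with hlM
  set N := maxNorm S.Θ (fun θ => S.PF θ ∘L S.BF θ) with hN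
  have hN0 : 0 ≤ N := maxNorm_nonneg _ _
  have hlm0 : 0 < lm := hL.lamMin_pos isCompact_Θ hne hF
  have hratio : 1 ≤ lM / lm := by
    rw [one_le_div hlm0]; exact hL.lamMin_le_lamMax isCompact_Θ hne hF
  have hR : 1 ≤ Real.sqrt (lM / lm) := Real.one_le_sqrt.2 hratio
  have hRR : 1 ≤ Real.sqrt (Real.sqrt (lM / lm)) := Real.one_le_sqrt.2 hR
  have hder : ∀ r ∈ Ico 0 τ, HasDerivWithinAt x
      (S.AF (θ r) (x r) + S.BF (θ r) (v r)) (Ici r) r := by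
    intro r hr
    refine hx.hasDerivWithinAt_right hr ?_
    have hsub : Icc 0 τ ∈ 𝓝[≥] r :=
      mem_of_superset (Icc_mem_nhdsGE hr.2) (Icc_subset_Icc_left hr.1)
    have e1 := (Trajectories.continuousOn_comp hθ hAc τ) r ⟨hr.1, hr.2.le⟩
    have e2 := (Trajectories.continuousOn_comp hθ hBc τ) r ⟨hr.1, hr.2.le⟩
    have e3 := hxc r ⟨hr.1, hr.2.le⟩
    exact ((e1.clm_apply e3).mono_of_mem_nhdsWithin hsub).add
      ((e2.mono_of_mem_nhdsWithin hsub).clm_apply (hvr r hr))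
  have hPB : ∀ r, 0 ≤ r → ∀ b, ‖v r‖ ≤ b → ‖S.PF (θ r) (S.BF (θ r) (v r))‖ ≤ N * b := by
    intro r hr b hb
    have hc := hL.continuousOn.clm_comp hBc
    exact ContinuousLinearMap.le_of_opNorm_le_of_le (S.PF (θ r) ∘L S.BF (θ r))
      (norm_le_maxNorm isCompact_Θ hc (mem_Θ hθ hr)) hb
  have hk : 0 ≤ 2 / (S.μF * lm) := by positivity
  have hbeta0 : 0 ≤ beta S.Θ T S.μF S.PF S.BF :=
    mul_nonneg (mul_nonneg (Real.sqrt_nonneg _) hk) hN0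
  have hinf0 : 0 ≤ betaInf S.Θ S.μF S.PF S.BF :=
    mul_nonneg (mul_nonneg (Real.sqrt_nonneg _) hk) hN0
  -- the first sampling period
  have hfirst : ∀ r ∈ Icc 0 τ, r ≤ T → ‖x r‖ ≤ beta S.Θ T S.μF S.PF S.BF * b₁ := by
    intro r hr hrT
    have h := hL.norm_le isCompact_Θ hF hθ le_rfl (t₀ := 0) (τ := r) (c := N * b₁)
      (hxc.mono (Icc_subset_Icc_right hr.2))
      (fun q hq => hder q ⟨hq.1, hq.2.trans_le hr.2⟩)
      (fun q hq => hPB q hq.1 b₁ (h₁ q ⟨hq.1, hq.2.le.trans hr.2⟩ (hq.2.trans_le hrT)))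
      (mul_nonneg hN0 hb₁) ⟨hr.1, le_rfl⟩
    rw [hx.zero_apply ⟨le_rfl, hτ⟩, norm_zero, mul_zero, zero_add, sub_zero] at h
    refine h.trans ?_
    have e1 : 1 - Real.exp (-(S.μF / 2 * r)) ≤
        Real.sqrt (Real.sqrt (lM / lm) * (1 - Real.exp (-(S.μF * T)))) := by
      have e2 := one_sub_exp_half_le_sqrt (mul_nonneg hμ.le hT.le)
      have e3 : Real.exp (-(S.μF * T / 2)) ≤ Real.exp (-(S.μF / 2 * r)) := by
        apply Real.exp_le_exp.2
        have := mul_le_mul_of_nonneg_left hrT (half_pos hμ).le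
        linarith
      have e4 : 0 ≤ 1 - Real.exp (-(S.μF * T)) := by
        have : Real.exp (-(S.μF * T)) ≤ 1 := Real.exp_le_one_iff.2 (by
          have := mul_pos hμ hT
          linarith)
        linarith
      have e5 : Real.sqrt (1 - Real.exp (-(S.μF * T))) ≤
          Real.sqrt (Real.sqrt (lM / lm) * (1 - Real.exp (-(S.μF * T)))) :=
        Real.sqrt_le_sqrt (by nlinarith)
      linarith
    calc _ ≤ Real.sqrt (Real.sqrt (lM / lm) * (1 - Real.exp (-(S.μF * T)))) *
          (2 / (S.μF * lm)) * (N * b₁) :=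
          mul_le_mul_of_nonneg_right (mul_le_mul_of_nonneg_right e1 hk) (mul_nonneg hN0 hb₁)
      _ = beta S.Θ T S.μF S.PF S.BF * b₁ := by rw [beta]; ring
  rcases le_or_gt t T with htT | htT
  · have e1 := hfirst t ht htT
    have e2 := mul_nonneg hbeta0 hb₁
    have e3 := mul_nonneg hinf0 hb₂
    nlinarith
  -- The Lyapunov estimate is restarted at `t₀ = T` from the state that the first period has left
  -- behind.
  · have h := hL.norm_le isCompact_Θ hF hθ hT.le (t₀ := T) (τ := τ) (c := N * b₂)
      (hxc.mono (Icc_subset_Icc_left hT.le))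
      (fun q hq => hder q ⟨hT.le.trans hq.1, hq.2⟩)
      (fun q hq => hPB q (hT.le.trans hq.1) b₂ (h₂ q ⟨hT.le.trans hq.1, hq.2.le⟩ hq.1))
      (mul_nonneg hN0 hb₂) ⟨htT.le, ht.2⟩
    have hE0 := Real.exp_pos (-(S.μF / 2 * (t - T)))
    have hE1 : Real.exp (-(S.μF / 2 * (t - T))) ≤ 1 := Real.exp_le_one_iff.2 (by
      have := mul_nonneg (half_pos hμ).le (sub_nonneg.2 htT.le)
      linarith)
    refine h.trans (add_le_add ?_ ?_)
    · have e1 := hfirst T ⟨hT.le, htT.le.trans ht.2⟩ le_rfl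
      calc _ ≤ Real.sqrt (lM / lm) * 1 * (beta S.Θ T S.μF S.PF S.BF * b₁) :=
            mul_le_mul (mul_le_mul_of_nonneg_left hE1 (Real.sqrt_nonneg _)) e1 (norm_nonneg _)
              (by positivity)
        _ = _ := by ring
    · have e2 : 1 - Real.exp (-(S.μF / 2 * (t - T))) ≤ Real.sqrt (Real.sqrt (lM / lm)) := by
        linarith
      calc _ ≤ Real.sqrt (Real.sqrt (lM / lm)) * (2 / (S.μF * lm)) * (N * b₂) :=
            mul_le_mul_of_nonneg_right (mul_le_mul_of_nonneg_right e2 hk) (mul_nonneg hN0 hb₂)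
        _ = betaInf S.Θ S.μF S.PF S.BF * b₂ := by rw [betaInf]; ring

end Setup

end LPV

namespace LPV

/-! ### Sampled estimates -/

section Sampling

variable {k : ℕ} {a T τ : ℝ}

/-- The signal that vanishes on `[0, T)` and has the value `c i` on `[i T, (i + 1) T)`, `i ≥ 1`. -/
noncomputable def hold (T : ℝ) (c : ℕ → Vec k) (t : ℝ) : Vec k :=
  if t < T then 0 else c ⌊t / T⌋₊

theorem measurable_hold (T : ℝ) (c : ℕ → Vec k) : Measurable (hold T c) := by
  refine Measurable.ite measurableSet_Iio measurable_const ?_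
  exact measurable_from_nat.comp (Nat.measurable_floor.comp (measurable_id.div_const T))

theorem exists_period (hT : 0 < T) {t : ℝ} (ht : 0 ≤ t) :
    (⌊t / T⌋₊ : ℝ) * T ≤ t ∧ t < (⌊t / T⌋₊ + 1) * T := by
  constructor
  · rw [← le_div_iff₀ hT]; exact Nat.floor_le (by positivity)
  · rw [← div_lt_iff₀ hT]; exact Nat.lt_floor_add_one _

/-- At a sampling instant the new value is already taken, so the signal is continuous from the right
everywhere. This is the regularity that `norm_F_le` requires of its input. -/
theorem hold_continuousWithinAt (hT : 0 < T) (c : ℕ → Vec k) {t : ℝ} (ht : 0 ≤ t) :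
    ContinuousWithinAt (hold T c) (Ici t) t := by
  have hconst : ∀ᶠ r in 𝓝[≥] t, hold T c r = hold T c t := by
    rcases lt_or_ge t T with h | h
    · filter_upwards [Ico_mem_nhdsGE h] with r hr
      simp [hold, h, hr.2]
    · obtain ⟨h1, h2⟩ := exists_period hT ht
      filter_upwards [Ico_mem_nhdsGE h2] with r hr
      have h3 : ⌊r / T⌋₊ = ⌊t / T⌋₊ := by
        rw [Nat.floor_eq_iff (div_nonneg (ht.trans hr.1) hT.le), le_div_iff₀ hT, div_lt_iff₀ hT]
        exact ⟨h1.trans hr.1, hr.2⟩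
      simp [hold, not_lt.2 h, not_lt.2 (h.trans hr.1), h3]
  exact (tendsto_const_nhds (x := hold T c t)).congr' (hconst.mono fun r hr => hr.symm)

/-- The piecewise constant estimate is a discounted average of the uncertainty over the previous
sampling period. -/
theorem norm_estimate_sub_le (ha : 0 < a) (hT : 0 < T) {xt σ σh : ℝ → Vec k} {x₀ : Vec k}
    (hτ : 0 ≤ τ) (hσ : ContinuousOn σ (Icc 0 τ))
    (hsol : SolvesOn (Icc 0 τ) xt x₀ (fun t => σh t - σ t - a • xt t))
    (hlaw : ∀ i : ℕ, ∀ t ∈ Icc 0 τ, i * T ≤ t → t < (i + 1) * T →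
      σh t = -((a / (Real.exp (a * T) - 1)) • xt (i * T)))
    (i : ℕ) {t : ℝ} (ht : t ∈ Icc 0 τ) (h1 : (i + 1) * T ≤ t) (h2 : t < (i + 2) * T)
    {v : Vec k} {D : ℝ} (hD : ∀ r ∈ Icc (i * T) ((i + 1) * T), ‖σ r - v‖ ≤ D) :
    ‖σh t - Real.exp (-(a * T)) • v‖ ≤ Real.exp (-(a * T)) * D := by
  have hxc := hsol.continuousOn hτ
  set t₀ : ℝ := i * T with ht₀
  set t₁ : ℝ := (i + 1) * T with ht₁
  have ht₀0 : 0 ≤ t₀ := by positivity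
  have ht₁₀ : t₁ = t₀ + T := by rw [ht₁, ht₀]; ring
  have ht01 : t₀ ≤ t₁ := by linarith
  have ht₁τ : t₁ ≤ τ := h1.trans ht.2
  have hsub : Icc t₀ t₁ ⊆ Icc 0 τ := Icc_subset_Icc ht₀0 ht₁τ
  set q := Real.exp (a * T) with hq
  have hq1 : 0 < q - 1 := by
    have := Real.one_lt_exp_iff.2 (mul_pos ha hT)
    linarith
  set c : Vec k := -((a / (q - 1)) • xt t₀) with hc
  have hσc : ∀ r ∈ Ico t₀ t₁, σh r = c := fun r hr =>
    hlaw i r (hsub ⟨hr.1, hr.2.le⟩) hr.1 hr.2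
  set E₀ := Real.exp (a * t₀) with hE₀
  have hE₀0 : 0 < E₀ := Real.exp_pos _
  have hE₁ : Real.exp (a * t₁) = E₀ * q := by
    rw [hE₀, hq, ← Real.exp_add, ht₁₀]; congr 1; ring
  have hσ' : ContinuousOn σ (Icc t₀ t₁) := hσ.mono hsub
  have hexp : Continuous fun r : ℝ => Real.exp (a * r) := by fun_prop
  have hcint : ContinuousOn (fun r => Real.exp (a * r) • (c - σ r)) (Icc t₀ t₁) :=
    hexp.continuousOn.smul (continuousOn_const.sub hσ')
  -- On one period `σh = c`, so `exp(a r) xt` has the right derivative `exp(a r) (c - σ)`, and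
  -- integration removes the damping term.
  have hftc : ∫ r in t₀..t₁, Real.exp (a * r) • (c - σ r) =
      Real.exp (a * t₁) • xt t₁ - Real.exp (a * t₀) • xt t₀ := by
    refine intervalIntegral.integral_eq_sub_of_hasDeriv_right_of_le ht01
      (f := fun r => Real.exp (a * r) • xt r) ?_ ?_ ?_
    · exact hexp.continuousOn.smul (hxc.mono hsub)
    · intro r hr
      have hrτ : r ∈ Ico 0 τ := ⟨ht₀0.trans hr.1.le, hr.2.trans_le ht₁τ⟩
      have hnear : Icc 0 τ ∈ 𝓝[≥] r :=
        mem_of_superset (Icc_mem_nhdsGE hrτ.2) (Icc_subset_Icc_left hrτ.1)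
      have hσhc : ContinuousWithinAt σh (Ici r) r := by
        have : ∀ᶠ s in 𝓝[≥] r, σh s = σh r := by
          filter_upwards [Ico_mem_nhdsGE hr.2] with s hs
          rw [hσc s ⟨hr.1.le.trans hs.1, hs.2⟩, hσc r ⟨hr.1.le, hr.2⟩]
        exact (tendsto_const_nhds (x := σh r)).congr' (this.mono fun s hs => hs.symm)
      have hg : ContinuousWithinAt (fun t => σh t - σ t - a • xt t) (Ici r) r :=
        (hσhc.sub ((hσ r ⟨hrτ.1, hrτ.2.le⟩).mono_of_mem_nhdsWithin hnear)).sub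
          (((hxc r ⟨hrτ.1, hrτ.2.le⟩).mono_of_mem_nhdsWithin hnear).const_smul a)
      have hd := (hsol.hasDerivWithinAt_right hrτ hg).mono Ioi_subset_Ici_self
      have hde : HasDerivWithinAt (fun r : ℝ => Real.exp (a * r)) (Real.exp (a * r) * a)
          (Ioi r) r := by
        have := ((hasDerivAt_id r).const_mul a).exp
        simpa using this.hasDerivWithinAt
      refine (hde.smul hd).congr_deriv ?_
      rw [hσc r ⟨hr.1.le, hr.2⟩]
      module
    · refine ContinuousOn.intervalIntegrable ?_
      rwa [uIcc_of_le ht01]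
  have hR1 : IntervalIntegrable (fun r => Real.exp (a * r) • (σ r - v)) volume t₀ t₁ := by
    refine ContinuousOn.intervalIntegrable ?_
    rw [uIcc_of_le ht01]
    exact hexp.continuousOn.smul (hσ'.sub continuousOn_const)
  have hR2 : IntervalIntegrable (fun r => Real.exp (a * r) • (c - v)) volume t₀ t₁ :=
    Continuous.intervalIntegrable (by fun_prop) _ _
  have hexpint : ∫ r in t₀..t₁, Real.exp (a * r) = E₀ * (q - 1) / a := by
    rw [intervalIntegral.integral_comp_mul_left (fun x => Real.exp x) ha.ne', integral_exp, hE₁]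
    simp only [smul_eq_mul]
    rw [← hE₀]
    field_simp
  set R := ∫ r in t₀..t₁, Real.exp (a * r) • (σ r - v) with hR
  have hsplit : ∫ r in t₀..t₁, Real.exp (a * r) • (c - σ r) =
      (E₀ * (q - 1) / a) • (c - v) - R := by
    rw [hR, ← hexpint, ← intervalIntegral.integral_smul_const, ← intervalIntegral.integral_sub
      hR2 hR1]
    refine intervalIntegral.integral_congr fun r _ => ?_
    rw [← smul_sub]
    congr 1
    abel
  have hRn : ‖R‖ ≤ D * (E₀ * (q - 1) / a) := by
    rw [← hexpint, ← intervalIntegral.integral_const_mul]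
    refine intervalIntegral.norm_integral_le_of_norm_le ht01 ?_
      ((hexp.intervalIntegrable _ _).const_mul _)
    refine Eventually.of_forall fun r hr => ?_
    rw [norm_smul, Real.norm_of_nonneg (Real.exp_pos _).le, mul_comm]
    exact mul_le_mul_of_nonneg_right (hD r ⟨hr.1.le, hr.2⟩) (Real.exp_pos _).le
  -- The cancellation built into the adaptive law: `c` integrates to `-(E₀ • xt t₀)`, exactly the
  -- negative of the initial term, so `xt t₀` disappears and `xt t₁` depends on `σ` alone.
  have hx1 : xt t₁ = (E₀ * q)⁻¹ • (-((E₀ * (q - 1) / a) • v) - R) := by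
    have h3 := hftc.symm.trans hsplit
    rw [hE₁, hc] at h3
    have h4 : (E₀ * q) • xt t₁ = -((E₀ * (q - 1) / a) • v) - R := by
      have h5 : (E₀ * (q - 1) / a) • (-((a / (q - 1)) • xt t₀) - v) =
          -(E₀ • xt t₀) - (E₀ * (q - 1) / a) • v := by
        rw [smul_sub, smul_neg, smul_smul]
        congr 3
        field_simp
      rw [h5] at h3
      rw [eq_sub_iff_add_eq] at h3 ⊢
      rw [← sub_eq_zero] at h3 ⊢
      rw [← h3]
      abel
    rw [← h4, smul_smul, inv_mul_cancel₀ (by positivity), one_smul]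
  have hσt : σh t = -((a / (q - 1)) • xt t₁) := by
    have := hlaw (i + 1) t ht (by push_cast; exact h1) (by push_cast; linarith)
    rw [this]
    push_cast
    rfl
  have hfin : σh t - Real.exp (-(a * T)) • v = (a / ((q - 1) * (E₀ * q))) • R := by
    have hq0 : q ≠ 0 := (Real.exp_pos _).ne'
    rw [hσt, hx1, Real.exp_neg, ← hq, smul_sub, smul_neg, smul_sub, smul_neg, smul_smul,
      smul_smul, smul_smul]
    have e1 : a / (q - 1) * (E₀ * q)⁻¹ * (E₀ * (q - 1) / a) = q⁻¹ := by
      field_simp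
    have e2 : a / (q - 1) * (E₀ * q)⁻¹ = a / ((q - 1) * (E₀ * q)) := by field_simp
    rw [e1, e2]
    abel
  have hq0 : 0 < q := Real.exp_pos _
  rw [hfin, norm_smul, Real.norm_of_nonneg (by positivity), Real.exp_neg, ← hq]
  calc a / ((q - 1) * (E₀ * q)) * ‖R‖ ≤ a / ((q - 1) * (E₀ * q)) * (D * (E₀ * (q - 1) / a)) :=
        mul_le_mul_of_nonneg_left hRn (by positivity)
    _ = q⁻¹ * D := by field_simp

end Sampling

end LPV

namespace LPV

namespace Setup

variable {n m p s nH nF : ℕ} {S : Setup n m p s nH nF} {f : ℝ → Vec n → Vec n}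
  {θ : ℝ → Vec s} {τ : ℝ}

/-! ### The adaptive closed loop -/

/-- The total uncertainty `B(θ)(ω - I)u + f(t, x) + B(θ)(ω - I)Kx(θ)x` along a solution. -/
noncomputable def sigma (S : Setup n m p s nH nF) (f : ℝ → Vec n → Vec n) (θ : ℝ → Vec s)
    (x : ℝ → Vec n) (u : ℝ → Vec m) (t : ℝ) : Vec n :=
  S.B (θ t) (S.ω (u t) - u t) + S.fbar f θ t (x t)

theorem lfbar_nonneg (hS : S.Assumptions) (hθ : θ ∈ S.adm) {δ : ℝ} (hδ : 0 ≤ δ) :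
    0 ≤ S.lfbar δ := by
  have h1 := hS.rate_nonneg hθ
  have h2 := maxωI_nonneg (S := S)
  have h3 := bB_nonneg (S := S)
  have h4 := bKx_nonneg (S := S)
  have h5 := hS.LB_pos.le
  have h6 := hS.LKx_pos.le
  have h7 := hS.lf_pos.le
  rw [lfbar]
  positivity

section Sigma

variable (hS : S.Assumptions) (hf : S.Uncertainty f) (hθ : θ ∈ S.adm) {x : ℝ → Vec n}
  {u : ℝ → Vec m} {δ R : ℝ}

include hS hf hθ

theorem continuousOn_sigma (hx : ContinuousOn x (Icc 0 τ)) (hu : ContinuousOn u (Icc 0 τ)) :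
    ContinuousOn (S.sigma f θ x u) (Icc 0 τ) :=
  ((Trajectories.continuousOn_comp hθ hS.B_cont τ).clm_apply
    ((S.ω.continuous.comp_continuousOn hu).sub hu)).add (continuousOn_fbar hS hf hθ hx)

theorem norm_sigma_le (hδ : 0 < δ) {t : ℝ} (ht : 0 ≤ t) (hx : ‖x t‖ ≤ δ) (hu : ‖u t‖ ≤ R) :
    ‖S.sigma f θ x u t‖ ≤ S.bσ δ R := by
  have h1 := norm_B_ωI_le hS hθ ht (u t)
  have h2 := norm_fbar_le hS hf hθ hδ ht hx
  have h3 := mul_le_mul_of_nonneg_left hu (mul_nonneg (bB_nonneg (S := S)) (maxωI_nonneg (S := S)))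
  have h4 := norm_add_le (S.B (θ t) (S.ω (u t) - u t)) (S.fbar f θ t (x t))
  rw [sigma, bσ]
  nlinarith

/-- The increment is telescoped into four: the change of `u`, of `B(θ)` acting on `u`, of `x` inside
the uncertainty, and of its explicit time and parameter. With `bx` and `bu` as rates, these are the
terms of the bracket in `bσtil`. -/
theorem norm_sigma_sub_le (hδ : 0 < δ) (hx : ∀ t ∈ Icc 0 τ, ‖x t‖ ≤ δ)
    (hu : ∀ t ∈ Icc 0 τ, ‖u t‖ ≤ R) {bx bu : ℝ} {t₁ t₂ : ℝ} (h₁ : t₁ ∈ Icc 0 τ)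
    (h₂ : t₂ ∈ Icc 0 τ) (hbx : ‖x t₁ - x t₂‖ ≤ bx * |t₁ - t₂|)
    (hbu : ‖u t₁ - u t₂‖ ≤ bu * |t₁ - t₂|) :
    ‖S.sigma f θ x u t₁ - S.sigma f θ x u t₂‖ ≤
      (‖S.ω - ContinuousLinearMap.id ℝ (Vec m)‖ * (S.bB * bu + S.LB * S.bθ' * R)
        + S.lfbar δ + S.Lfbar δ * bx) * |t₁ - t₂| := by
  set W := S.ω - ContinuousLinearMap.id ℝ (Vec m) with hW
  have e1 := mem_Θ hθ h₁.1
  have e2 := mem_Θ hθ h₂.1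
  have hθd := Trajectories.norm_sub_le hθ hS.rate_bound h₁.1 h₂.1
  have hdec : S.sigma f θ x u t₁ - S.sigma f θ x u t₂ =
      (S.B (θ t₁) (W (u t₁ - u t₂)) + (S.B (θ t₁) - S.B (θ t₂)) (W (u t₂))) +
      ((S.fbar f θ t₁ (x t₁) - S.fbar f θ t₁ (x t₂)) +
        (S.fbar f θ t₁ (x t₂) - S.fbar f θ t₂ (x t₂))) := by
    simp only [sigma, hW, sub_apply, ContinuousLinearMap.id_apply, map_sub]
    abel
  have a1 : ‖S.B (θ t₁) (W (u t₁ - u t₂))‖ ≤ S.bB * (‖W‖ * (bu * |t₁ - t₂|)) :=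
    ContinuousLinearMap.le_of_opNorm_le_of_le _ (hS.norm_B_le e1) (W.le_opNorm_of_le hbu)
  have a2 : ‖(S.B (θ t₁) - S.B (θ t₂)) (W (u t₂))‖ ≤
      (S.LB * (S.bθ' * |t₁ - t₂|)) * (‖W‖ * R) :=
    ContinuousLinearMap.le_of_opNorm_le_of_le _
      ((hS.B_lip _ e1 _ e2).trans (mul_le_mul_of_nonneg_left hθd hS.LB_pos.le))
      (W.le_opNorm_of_le (hu t₂ h₂))
  have a3 : ‖S.fbar f θ t₁ (x t₁) - S.fbar f θ t₁ (x t₂)‖ ≤ S.Lfbar δ * (bx * |t₁ - t₂|) :=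
    (norm_fbar_sub_le hS hf hθ hδ h₁.1 (hx t₁ h₁) (hx t₂ h₂)).trans
      (mul_le_mul_of_nonneg_left hbx (hS.Lfbar_nonneg hδ))
  have a4 := norm_fbar_time_sub_le hS hf hθ h₁.1 h₂.1 (hx t₂ h₂)
  rw [hdec]
  refine (norm_add_le _ _).trans ((add_le_add ((norm_add_le _ _).trans (add_le_add a1 a2))
    ((norm_add_le _ _).trans (add_le_add a3 a4))).trans_eq ?_)
  ring

/-- The plant equation in terms of the total uncertainty. -/
theorem norm_plant_rhs_le (hδ : 0 < δ) {t : ℝ} (ht : 0 ≤ t) (hx : ‖x t‖ ≤ δ) (hu : ‖u t‖ ≤ R) :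
    ‖S.A (θ t) (x t) + S.B (θ t) (S.ω (S.Kx (θ t) (x t) + u t)) + f t (x t)‖ ≤ S.bx' δ R := by
  have hR : 0 ≤ R := (norm_nonneg _).trans hu
  have e1 := mem_Θ hθ ht
  have hdec : S.A (θ t) (x t) + S.B (θ t) (S.ω (S.Kx (θ t) (x t) + u t)) + f t (x t) =
      S.Am (θ t) (x t) + S.B (θ t) (S.ω (u t)) + S.fbar f θ t (x t) := by
    simp only [fbar, Am, add_apply, ContinuousLinearMap.comp_apply, map_add, map_sub]
    abel
  have a1 : ‖S.Am (θ t) (x t)‖ ≤ S.bAm * δ :=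
    ContinuousLinearMap.le_of_opNorm_le_of_le _ (hS.norm_Am_le e1) hx
  have a2 : ‖S.B (θ t) (S.ω (u t))‖ ≤ S.bB * (S.maxω * R) :=
    ContinuousLinearMap.le_of_opNorm_le_of_le _ (hS.norm_B_le e1)
      (ContinuousLinearMap.le_of_opNorm_le_of_le _ hS.norm_ω_le hu)
  have a3 := norm_fbar_le hS hf hθ hδ ht hx
  rw [hdec]
  refine (norm_add_le _ _).trans ((add_le_add ((norm_add_le _ _).trans (add_le_add a1 a2))
    a3).trans_eq ?_)
  rw [bx']
  ring

end Sigma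

/-- Along a bounded solution of the adaptive closed loop, `-ω u` is the response of the filter to
the input of the reference law, up to a perturbation `φ` whose response is bounded by `γ₀`. -/
theorem AdaptiveSolution.exists_response (hS : S.Assumptions) (hf : S.Uncertainty f)
    (hθ : θ ∈ S.adm) (hn : 0 < n) {T : ℝ} (hT : 0 < T) (hτ : 0 ≤ τ) {δ R : ℝ} (hδ : 0 < δ)
    {x₀ xh₀ : Vec n} {x : ℝ → Vec n} {u : ℝ → Vec m} {y : ℝ → Vec p}
    (hsol : S.AdaptiveSolution T f θ x₀ xh₀ (Icc 0 τ) x u y)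
    (hx : ∀ t ∈ Icc 0 τ, ‖x t‖ ≤ δ) (hu : ∀ t ∈ Icc 0 τ, ‖u t‖ ≤ R) :
    ∃ hb φ : ℝ → Vec m,
      S.mapHbar (Icc 0 τ) θ (fun t => S.Bud (θ t) (S.fbar f θ t (x t))) hb ∧
      S.mapC (Icc 0 τ) θ
        (fun t => S.Bd (θ t) (S.fbar f θ t (x t)) + hb t - S.Kr (θ t) (S.r t) - φ t)
        (fun t => -(S.ω (u t))) ∧
      ∀ z, S.mapC (Icc 0 τ) θ φ z → ∀ t ∈ Icc 0 τ, ‖z t‖ ≤ S.γ0 T δ R := by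
  obtain ⟨xh, σh, σc, σm, σum, ηh₂, hplant, -, hpred, hlaw, hσc0, hσc1, hmu, hH, hctl⟩ := hsol
  have h0mem : (0 : ℝ) ∈ Icc 0 τ := ⟨le_rfl, hτ⟩
  have hxc := hplant.continuousOn hτ
  have huc := hctl.continuousOn hτ
  have hσc := continuousOn_sigma hS hf hθ hxc huc
  set σ := S.sigma f θ x u with hσdef
  have hσb : ∀ t ∈ Icc 0 τ, ‖σ t‖ ≤ S.bσ δ R := fun t ht =>
    norm_sigma_le hS hf hθ hδ ht.1 (hx t ht) (hu t ht)
  have hR0 : 0 ≤ R := (norm_nonneg _).trans (hu 0 h0mem)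
  have hbσ0 : 0 ≤ S.bσ δ R := (norm_nonneg _).trans (hσb 0 h0mem)
  -- The constants of the theorem carry a factor `√n` that the averaging argument does not need; it
  -- is absorbed by `1 ≤ √n`.
  have hsn : 1 ≤ Real.sqrt n := Real.one_le_sqrt.2 (by exact_mod_cast hn)
  have haT : 0 < S.a * T := mul_pos hS.a_pos hT
  have hE0 : 0 < Real.exp (-(S.a * T)) := Real.exp_pos _
  have hE1 : Real.exp (-(S.a * T)) ≤ 1 := Real.exp_le_one_iff.2 (by linarith)
  have hbhat0 : 0 ≤ S.bσhatc T δ R :=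
    mul_nonneg (mul_nonneg hE0.le (Real.sqrt_nonneg _)) hbσ0
  -- the prediction error
  have hpe : SolvesOn (Icc 0 τ) (fun t => xh t - x t) (xh₀ - x₀)
      (fun t => σh t - σ t - S.a • (xh t - x t)) :=
    (hpred.sub hplant).congr_rhs fun t _ => by
      simp only [hσdef, sigma, fbar, Am, add_apply, ContinuousLinearMap.comp_apply, map_add,
        map_sub]
      abel
  -- The index is shifted: for `t` in the period numbered `i + 1`, the estimate is formed from `σ`
  -- on the period numbered `i`. Hence the distance `2 T` in `hprev`, and hence the first period is
  -- exceptional.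
  have hperiod : ∀ t ∈ Icc 0 τ, T ≤ t → ∃ i : ℕ, (i + 1) * T ≤ t ∧ t < (i + 2) * T := by
    intro t ht hTt
    obtain ⟨h1, h2⟩ := exists_period hT ht.1
    have h3 : 1 ≤ ⌊t / T⌋₊ := Nat.le_floor (by rwa [Nat.cast_one, one_le_div hT])
    obtain ⟨i, hi⟩ := Nat.exists_eq_add_of_le' h3
    refine ⟨i, ?_, ?_⟩
    · rw [hi] at h1; push_cast at h1; exact h1
    · rw [hi] at h2; push_cast at h2; linarith
  have hprev : ∀ t ∈ Icc 0 τ, ∀ i : ℕ, (i + 1) * T ≤ t → t < (i + 2) * T →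
      ∀ q ∈ Icc (i * T) ((i + 1) * T), q ∈ Icc 0 τ ∧ |q - t| ≤ 2 * T := by
    intro t ht i h1 h2 q hq
    have h3 : 0 ≤ (i : ℝ) * T := by positivity
    refine ⟨⟨h3.trans hq.1, hq.2.trans (h1.trans ht.2)⟩, ?_⟩
    rw [abs_le]
    constructor <;> nlinarith [hq.1, hq.2]
  have hest : ∀ t ∈ Icc 0 τ, ∀ i : ℕ, (i + 1) * T ≤ t → t < (i + 2) * T → ∀ (v : Vec n) (D : ℝ),
      (∀ q ∈ Icc (i * T) ((i + 1) * T), ‖σ q - v‖ ≤ D) →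
      ‖σh t - Real.exp (-(S.a * T)) • v‖ ≤ Real.exp (-(S.a * T)) * D :=
    fun t ht i h1 h2 v D hD =>
      norm_estimate_sub_le hS.a_pos hT hτ hσc hpe hlaw i ht h1 h2 hD
  -- bounds on the estimate
  have hσcb : ∀ t ∈ Icc 0 τ, ‖σc t‖ ≤ S.bσhatc T δ R := by
    intro t ht
    rcases lt_or_ge t T with h | h
    · rw [hσc0 t ht h, norm_zero]; exact hbhat0
    · obtain ⟨i, h1, h2⟩ := hperiod t ht h
      have h3 := hest t ht i h1 h2 0 (S.bσ δ R) fun q hq => by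
        rw [sub_zero]; exact hσb q (hprev t ht i h1 h2 q hq).1
      rw [smul_zero, sub_zero] at h3
      rw [hσc1 t ht h]
      refine h3.trans ?_
      rw [bσhatc]
      calc _ = Real.exp (-(S.a * T)) * 1 * S.bσ δ R := by ring
        _ ≤ _ := mul_le_mul_of_nonneg_right (mul_le_mul_of_nonneg_left hsn hE0.le) hbσ0
  -- The estimate is prescribed only on `[0, τ]`. The signal `hold T cst` agrees with it there and
  -- is measurable on the whole line.
  set cst : ℕ → Vec n := fun i =>
    -((S.a / (Real.exp (S.a * T) - 1)) • (xh (i * T) - x (i * T))) with hcst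
  have hhold : ∀ t ∈ Icc 0 τ, hold T cst t = σc t := by
    intro t ht
    rcases lt_or_ge t T with h | h
    · rw [hσc0 t ht h, hold, if_pos h]
    · obtain ⟨h1, h2⟩ := exists_period hT ht.1
      rw [hσc1 t ht h, hold, if_neg (not_lt.2 h), hlaw _ t ht h1 h2]
  have hσm : ∀ t ∈ Icc 0 τ, σm t = S.Bd (θ t) (σc t) := fun t ht => by
    rw [← hmu t ht, hS.Bd_decomp (mem_Θ hθ ht.1)]
  have hσum : ∀ t ∈ Icc 0 τ, σum t = S.Bud (θ t) (σc t) := fun t ht => by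
    rw [← hmu t ht, hS.Bud_decomp (mem_Θ hθ ht.1)]
  obtain ⟨Wu, hWuc, hWu⟩ := exists_continuous_extension hτ
    (Trajectories.continuousOn_comp hθ hS.Bud_cont τ)
  have hη2 : ∀ t ∈ Icc 0 τ, ‖ηh₂ t‖ ≤ S.gHbar * (S.bBud * S.bσhatc T δ R) := by
    intro t ht
    have heq : ∀ t ∈ Icc 0 τ, σum t = Wu t (hold T cst t) := fun t ht => by
      rw [hσum t ht, hWu t ht, hhold t ht]
    refine hS.ppg_Hbar.norm_le hθ hτ (measurable_clm_apply hWuc (measurable_hold T cst))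
      (StateSpace.map_congr hH heq fun _ _ => rfl) (fun r hr => ?_) ht
    rw [← heq r hr, hσum r hr]
    exact ContinuousLinearMap.le_of_opNorm_le_of_le _ (hS.norm_Bud_le (mem_Θ hθ hr.1)) (hσcb r hr)
  -- Lipschitz bounds
  have hu' : ∀ t ∈ Icc 0 τ, ‖-(S.K (u t + σm t + ηh₂ t - S.Kr (θ t) (S.r t)))‖ ≤
      S.bu' T δ R := by
    intro t ht
    rw [norm_neg, bu']
    refine S.K.le_opNorm_of_le ?_
    have b1 : ‖σm t‖ ≤ S.bBd * S.bσhatc T δ R := by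
      rw [hσm t ht]
      exact ContinuousLinearMap.le_of_opNorm_le_of_le _ (hS.norm_Bd_le (mem_Θ hθ ht.1))
        (hσcb t ht)
    have b2 : ‖S.Kr (θ t) (S.r t)‖ ≤ S.bKr * S.rNorm :=
      ContinuousLinearMap.le_of_opNorm_le_of_le _ (hS.norm_Kr_le (mem_Θ hθ ht.1))
        (hS.norm_r_le ht.1)
    refine (norm_sub_le _ _).trans ((add_le_add (norm_add₃_le.trans
      (add_le_add (add_le_add (hu t ht) b1) (hη2 t ht))) b2).trans_eq ?_)
    ring
  have hx' : ∀ t ∈ Icc 0 τ,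
      ‖S.A (θ t) (x t) + S.B (θ t) (S.ω (S.Kx (θ t) (x t) + u t)) + f t (x t)‖ ≤ S.bx' δ R :=
    fun t ht => norm_plant_rhs_le hS hf hθ hδ ht.1 (hx t ht) (hu t ht)
  set Lσ : ℝ := ‖S.ω - ContinuousLinearMap.id ℝ (Vec m)‖ *
    (S.bB * S.bu' T δ R + S.LB * S.bθ' * R) + S.lfbar δ + S.Lfbar δ * S.bx' δ R with hLσ
  have hLσ0 : 0 ≤ Lσ := by
    have b1 : 0 ≤ S.bu' T δ R := (norm_nonneg _).trans (hu' 0 h0mem)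
    have b2 : 0 ≤ S.bx' δ R := (norm_nonneg _).trans (hx' 0 h0mem)
    have b3 := hS.rate_nonneg hθ
    have b4 := bB_nonneg (S := S)
    have b5 := hS.LB_pos.le
    have b6 := lfbar_nonneg hS hθ hδ.le
    have b7 := hS.Lfbar_nonneg hδ
    positivity
  have hσlip : ∀ t₁ ∈ Icc 0 τ, ∀ t₂ ∈ Icc 0 τ, ‖σ t₁ - σ t₂‖ ≤ Lσ * |t₁ - t₂| :=
    fun t₁ h₁ t₂ h₂ => norm_sigma_sub_le hS hf hθ hδ hx hu h₁ h₂
      (hplant.norm_sub_le hx' h₂ h₁) (hctl.norm_sub_le hu' h₂ h₁)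
  have hbtil : S.bσtil T δ R = 2 * Real.sqrt n * T * Lσ +
      (1 - Real.exp (-(S.a * T))) * Real.sqrt n * S.bσ δ R := rfl
  have hbtil1 : 2 * T * Lσ + (1 - Real.exp (-(S.a * T))) * S.bσ δ R ≤ S.bσtil T δ R := by
    rw [hbtil]
    have c1 : 0 ≤ 2 * T * Lσ := by positivity
    have c2 : 0 ≤ (1 - Real.exp (-(S.a * T))) * S.bσ δ R := mul_nonneg (by linarith) hbσ0
    nlinarith
  have hbtil0 : 0 ≤ S.bσtil T δ R := by
    refine le_trans ?_ hbtil1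
    have c2 : 0 ≤ (1 - Real.exp (-(S.a * T))) * S.bσ δ R := mul_nonneg (by linarith) hbσ0
    positivity
  have htil : ∀ t ∈ Icc 0 τ, T ≤ t → ‖σ t - σc t‖ ≤ S.bσtil T δ R := by
    intro t ht h
    obtain ⟨i, h1, h2⟩ := hperiod t ht h
    -- The average is compared with the current value `σ t`: the Lipschitz bound accounts for the
    -- delay of up to `2 T`, and the missing weight `1 - exp(-aT)` for the second term of `bσtil`.
    have h3 := hest t ht i h1 h2 (σ t) (Lσ * (2 * T)) fun q hq => by
      obtain ⟨hq1, hq2⟩ := hprev t ht i h1 h2 q hq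
      exact (hσlip q hq1 t ht).trans (mul_le_mul_of_nonneg_left hq2 hLσ0)
    rw [hσc1 t ht h]
    have hdec : σ t - σh t = (1 - Real.exp (-(S.a * T))) • σ t -
        (σh t - Real.exp (-(S.a * T)) • σ t) := by
      rw [sub_smul, one_smul]; abel
    have h4 : ‖(1 - Real.exp (-(S.a * T))) • σ t‖ ≤
        (1 - Real.exp (-(S.a * T))) * S.bσ δ R := by
      rw [norm_smul, Real.norm_of_nonneg (by linarith)]
      exact mul_le_mul_of_nonneg_left (hσb t ht) (by linarith)
    have h5 : Real.exp (-(S.a * T)) * (Lσ * (2 * T)) ≤ 1 * (Lσ * (2 * T)) :=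
      mul_le_mul_of_nonneg_right hE1 (by positivity)
    rw [hdec]
    refine (norm_sub_le _ _).trans (le_trans ?_ hbtil1)
    linarith
  -- the feedforward response to the uncertainty
  have hfbc := continuousOn_fbar hS hf hθ hxc
  have hBudc := Trajectories.continuousOn_comp hθ hS.Bud_cont τ
  obtain ⟨hb, hhb, -⟩ := StateSpace.exists_map hτ hS.Hbar_cont hθ (hBudc.clm_apply hfbc)
  -- The estimation error `σ - σc` as it enters the control law, through the matched channel and
  -- through `𝓗bar`; thus `𝓒 φ` is `𝓕` applied to `σ - σc`.
  set φ : ℝ → Vec m := fun t => S.Bd (θ t) (σ t - σc t) + (hb t - ηh₂ t) with hφ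
  have hBdσ : ∀ t ∈ Icc 0 τ, S.Bd (θ t) (σ t) =
      S.ω (u t) - u t + S.Bd (θ t) (S.fbar f θ t (x t)) := fun t ht => by
    rw [hσdef, sigma, map_add, hS.Bd_B (mem_Θ hθ ht.1)]
  have hBudσ : ∀ t ∈ Icc 0 τ, S.Bud (θ t) (σ t) = S.Bud (θ t) (S.fbar f θ t (x t)) :=
    fun t ht => by rw [hσdef, sigma, map_add, hS.Bud_B (mem_Θ hθ ht.1), zero_add]
  have hCu : S.mapC (Icc 0 τ) θ
      (fun t => S.Bd (θ t) (S.fbar f θ t (x t)) + hb t - S.Kr (θ t) (S.r t) - φ t)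
      (fun t => -(S.ω (u t))) := by
    obtain ⟨Ki, hKi⟩ := hS.exists_K_inverse
    have h1 := (hctl.clm Ki).neg
    rw [map_zero, neg_zero] at h1
    -- The filter state is `-K⁻¹ u`: its output `ωK(-K⁻¹ u)` is `-ωu`, and the term `(ω - I) u`
    -- contained in `B† σ` turns the integrator of the control law into the filter with pole matrix
    -- `-ωK`.
    refine ⟨fun t => -(Ki (u t)), h1.congr_rhs fun t ht => ?_, fun t _ => ?_⟩
    · simp only [filter, map_neg, (hKi _).1, (hKi _).2, ContinuousLinearMap.comp_apply,
        neg_apply, ContinuousLinearMap.id_apply, hφ, map_sub (S.Bd (θ t)), hBdσ t ht, hσm t ht]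
      abel
    · simp [filter, (hKi _).1]
  have hHdiff : S.mapHbar (Icc 0 τ) θ (fun t => S.Bud (θ t) (σ t - σc t))
      (fun t => hb t - ηh₂ t) :=
    StateSpace.map_congr (StateSpace.map_sub hhb hH)
      (fun t ht => by rw [map_sub, hBudσ t ht, hσum t ht]) (fun _ _ => rfl)
  refine ⟨hb, φ, hhb, hCu, fun z hCφ => ?_⟩
  obtain ⟨σe, hσec, hσe⟩ := exists_continuous_extension hτ hσc
  set v : ℝ → Vec n := fun t => σe t - hold T cst t with hv
  have hveq : ∀ t ∈ Icc 0 τ, v t = σ t - σc t := fun t ht => by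
    rw [hv]; beta_reduce; rw [hσe t ht, hhold t ht]
  have hF : S.mapF (Icc 0 τ) θ v z := by
    refine ⟨φ, ⟨fun t => S.Bd (θ t) (σ t - σc t), fun t => hb t - ηh₂ t, fun t ht => ?_,
      ⟨fun t => S.Bud (θ t) (σ t - σc t), fun t ht => ?_, hHdiff⟩, fun _ _ => rfl⟩, hCφ⟩
    · rw [hveq t ht]
    · rw [hveq t ht]
  intro t ht
  refine norm_F_le hS hθ hτ hT (hσec.measurable.sub (measurable_hold T cst)) ?_ hF hbσ0 hbtil0
    ?_ ?_ ht
  · intro r hr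
    exact hσec.continuousAt.continuousWithinAt.sub (hold_continuousWithinAt hT cst hr.1)
  · intro r hr hrT
    change ‖v r‖ ≤ _
    rw [hveq r hr, hσc0 r hr hrT, sub_zero]
    exact hσb r hr
  · intro r hr hrT
    change ‖v r‖ ≤ _
    rw [hveq r hr]
    exact htil r hr hrT

end Setup

end LPV

/-! ### Continuation in time, the reference system, and the deviation from it -/

namespace LPV

/-- A continuation argument: a bound that improves itself is never violated. -/
theorem forall_lt_of_self_improving {φ : ℝ → ℝ} {b τ : ℝ} (hφ : ContinuousOn φ (Icc 0 τ))
    (h0 : φ 0 < b) (hstep : ∀ t ∈ Icc 0 τ, (∀ r ∈ Icc 0 t, φ r ≤ b) → φ t < b) :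
    ∀ t ∈ Icc 0 τ, φ t < b := by
  by_contra hcon
  push Not at hcon
  obtain ⟨t₁, ht₁, hb₁⟩ := hcon
  have hcomp : IsCompact (Icc 0 τ ∩ φ ⁻¹' Ici b) :=
    isCompact_Icc.of_isClosed_subset (hφ.preimage_isClosed_of_isClosed isClosed_Icc isClosed_Ici)
      inter_subset_left
  obtain ⟨t, ⟨ht, htb⟩, hmin⟩ := hcomp.exists_isLeast ⟨t₁, ht₁, hb₁⟩
  have hlt : ∀ r ∈ Icc 0 t, r ≠ t → φ r < b := by
    intro r hr hne
    by_contra hge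
    exact hne (le_antisymm hr.2 (hmin ⟨⟨hr.1, hr.2.trans ht.2⟩, not_lt.1 hge⟩))
  -- At the first time `t` with `φ t ≥ b`, continuity forces the value to be exactly `b`. So `φ ≤ b`
  -- on all of `[0, t]`, and the self-improvement contradicts equality.
  obtain ⟨r, hr, hrb⟩ := intermediate_value_Icc ht.1 (hφ.mono (Icc_subset_Icc_right ht.2))
    ⟨h0.le, htb⟩
  have hrt : r = t := by
    by_contra hne
    exact (hlt r hr hne).ne hrb
  subst hrt
  refine (hstep r ht fun q hq => ?_).ne hrb
  by_cases hqr : q = r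
  · rw [hqr, hrb]
  · exact (hlt q hq hqr).le

namespace Setup

variable {n m p s nH nF : ℕ} {S : Setup n m p s nH nF} {f : ℝ → Vec n → Vec n}
  {θ : ℝ → Vec s} {τ : ℝ}

theorem AdaptiveSolution.mono {T : ℝ} {x₀ xh₀ : Vec n} {J J' : Set ℝ} {x : ℝ → Vec n}
    {u : ℝ → Vec m} {y : ℝ → Vec p} (h : S.AdaptiveSolution T f θ x₀ xh₀ J x u y)
    (hJ : J' ⊆ J) : S.AdaptiveSolution T f θ x₀ xh₀ J' x u y := by
  obtain ⟨xh, σh, σc, σm, σum, ηh₂, h1, h2, h3, h4, h5, h6, h7, h8, h9⟩ := h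
  exact ⟨xh, σh, σc, σm, σum, ηh₂, h1.mono hJ, fun t ht => h2 t (hJ ht), h3.mono hJ,
    fun i t ht => h4 i t (hJ ht), fun t ht => h5 t (hJ ht), fun t ht => h6 t (hJ ht),
    fun t ht => h7 t (hJ ht), StateSpace.map_mono h8 hJ, h9.mono hJ⟩

theorem ReferenceSolution.mono {x₀ : Vec n} {J J' : Set ℝ} {xr : ℝ → Vec n}
    {ur : ℝ → Vec m} {yr : ℝ → Vec p} (h : S.ReferenceSolution f θ x₀ J xr ur yr)
    (hJ : J' ⊆ J) : S.ReferenceSolution f θ x₀ J' xr ur yr := by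
  obtain ⟨η₁, η₂, h, c, h1, h2, h3, h4, h5, h6⟩ := h
  exact ⟨η₁, η₂, h, c, fun t ht => h1 t (hJ ht), h2.mono hJ, StateSpace.map_mono h3 hJ,
    StateSpace.map_mono h4 hJ, fun t ht => h5 t (hJ ht), fun t ht => h6 t (hJ ht)⟩

/-! ### The reference system -/

section Reference

variable (hS : S.Assumptions) (hf : S.Uncertainty f) (hθ : θ ∈ S.adm)
  {x₀ : Vec n} {xr : ℝ → Vec n} {ur : ℝ → Vec m} {yr : ℝ → Vec p}

include hS hθ

/-- The pseudo-inverses recover `η₁` and `η₂` from their defining relation, and `ω ur = -c`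
eliminates the input. What is left has the form treated by `exists_decomposition`. -/
theorem ReferenceSolution.exists_response
    (hsol : S.ReferenceSolution f θ x₀ (Icc 0 τ) xr ur yr) :
    ∃ h c : ℝ → Vec m,
      S.mapHbar (Icc 0 τ) θ (fun t => S.Bud (θ t) (S.fbar f θ t (xr t))) h ∧
      S.mapC (Icc 0 τ) θ
        (fun t => S.Bd (θ t) (S.fbar f θ t (xr t)) + h t - S.Kr (θ t) (S.r t)) c ∧
      SolvesOn (Icc 0 τ) xr x₀ (fun t => S.Am (θ t) (xr t) +
        S.B (θ t) (S.Bd (θ t) (S.fbar f θ t (xr t)) - c t) +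
        S.Bu (θ t) (S.Bud (θ t) (S.fbar f θ t (xr t)))) ∧
      ∀ t ∈ Icc 0 τ, ur t = -(S.ωinv (c t)) := by
  obtain ⟨η₁, η₂, h, c, hη, hxr, hh, hc, hur, -⟩ := hsol
  have h1 : ∀ t ∈ Icc 0 τ, η₁ t = S.Bd (θ t) (S.fbar f θ t (xr t)) := fun t ht => by
    rw [fbar, ← hη t ht, hS.Bd_decomp (mem_Θ hθ ht.1)]
  have h2 : ∀ t ∈ Icc 0 τ, η₂ t = S.Bud (θ t) (S.fbar f θ t (xr t)) := fun t ht => by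
    rw [fbar, ← hη t ht, hS.Bud_decomp (mem_Θ hθ ht.1)]
  refine ⟨h, c, StateSpace.map_congr hh h2 fun _ _ => rfl,
    StateSpace.map_congr hc (fun t ht => by rw [h1 t ht]) fun _ _ => rfl,
    hxr.congr_rhs fun t ht => ?_, hur⟩
  rw [hur t ht, map_neg, hS.ω_ωinv, h1 t ht, h2 t ht]
  congr 3
  abel

include hf

/-- Under the stability condition a bound `ρ_r` on the reference state is self-improving. -/
theorem ReferenceSolution.norm_lt (hn : 0 < n) (hτ : 0 ≤ τ) (hρr : 0 < S.ρr) (hγ1 : 0 < S.γ1)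
    (hstab : S.StabilityCondition) (hx₀ : ‖x₀‖ ≤ S.ρ0)
    (hsol : S.ReferenceSolution f θ x₀ (Icc 0 τ) xr ur yr)
    (hxr : ∀ t ∈ Icc 0 τ, ‖xr t‖ ≤ S.ρr) {t : ℝ} (ht : t ∈ Icc 0 τ) : ‖xr t‖ < S.ρr := by
  obtain ⟨h, c, hh, hc, hx, -⟩ := hsol.exists_response hS hθ
  have hρ : S.ρr ≤ S.ρ := by rw [ρ]; linarith
  have hρ0 : 0 < S.ρ := hρr.trans_le hρ
  have hxc := hx.continuousOn hτ
  have hfbc := continuousOn_fbar hS hf hθ hxc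
  obtain ⟨η₁, hη₁c, hη₁⟩ := exists_continuous_extension hτ
    ((Trajectories.continuousOn_comp hθ hS.Bd_cont τ).clm_apply hfbc)
  obtain ⟨η₂, hη₂c, hη₂⟩ := exists_continuous_extension hτ
    ((Trajectories.continuousOn_comp hθ hS.Bud_cont τ).clm_apply hfbc)
  obtain ⟨c₁, c₂, cv, y₁, y₂, y₃, xin, -, -, hcv, -, hy₁, hy₂, hy₃, hxin, hdec⟩ :=
    exists_decomposition hS hθ hτ (v := fun t => S.Kr (θ t) (S.r t)) hη₁c hη₂c
      (StateSpace.map_congr hh (fun t ht => (hη₂ t ht).symm) fun _ _ => rfl)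
      (StateSpace.map_congr hc (fun t ht => by rw [hη₁ t ht]) fun _ _ => rfl)
      (hx.congr_rhs fun t ht => by rw [hη₁ t ht, hη₂ t ht])
  have b1 : ∀ t ∈ Icc 0 τ, ‖η₁ t‖ ≤ S.Lf1 S.ρ * S.ρr + S.bf10 := by
    intro t ht
    rw [hη₁ t ht]
    have := norm_Bd_fbar_le hS hf hθ hρ0 ht.1 ((hxr t ht).trans hρ)
    linarith [mul_le_mul_of_nonneg_left (hxr t ht) (hS.Lf1_nonneg hρ0)]
  have b2 : ∀ t ∈ Icc 0 τ, ‖η₂ t‖ ≤ S.Lf2 S.ρ * S.ρr + S.bf20 := by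
    intro t ht
    rw [hη₂ t ht]
    have := norm_Bud_fbar_le hS hf hθ hρ0 ht.1 ((hxr t ht).trans hρ)
    linarith [mul_le_mul_of_nonneg_left (hxr t ht) (hS.Lf2_nonneg hρ0)]
  have d1 := hS.ppg_Gxm.norm_le hθ hτ hη₁c.measurable hy₁ b1 ht
  have d2 := hS.ppg_Gxum.norm_le hθ hτ hη₂c.measurable hy₂ b2 ht
  have d3 := hS.ppg_HxmCKr.norm_le hθ hτ hS.r_meas
    (y := y₃) ⟨cv, ⟨_, fun _ _ => rfl, hcv⟩, hy₃⟩ (fun r hr => hS.norm_r_le hr.1) ht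
  have d4 : ‖xin t‖ ≤ S.ρin := by
    refine (norm_free_le hS hθ hτ hn hxin ht).trans ?_
    rw [ρin, mul_comm]
    exact mul_le_mul_of_nonneg_right hx₀ (Real.sqrt_nonneg _)
  rw [hdec t ht]
  have d5 : ‖y₁ t + y₂ t + y₃ t + xin t‖ ≤ ‖y₁ t‖ + ‖y₂ t‖ + ‖y₃ t‖ + ‖xin t‖ :=
    (norm_add_le _ _).trans (add_le_add_left norm_add₃_le _)
  have := hstab
  rw [StabilityCondition] at this
  linarith

/-- The Lipschitz constants may be taken at radius `ρr` rather than `ρ`, because the reference state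
stays in the smaller ball; this is how `ρur` is defined. -/
theorem ReferenceSolution.norm_input_le (hτ : 0 ≤ τ) (hρr : 0 < S.ρr)
    (hsol : S.ReferenceSolution f θ x₀ (Icc 0 τ) xr ur yr)
    (hxr : ∀ t ∈ Icc 0 τ, ‖xr t‖ ≤ S.ρr) {t : ℝ} (ht : t ∈ Icc 0 τ) : ‖ur t‖ ≤ S.ρur := by
  obtain ⟨h, c, hh, hc, hx, hur⟩ := hsol.exists_response hS hθ
  have hxc := hx.continuousOn hτ
  have hfbc := continuousOn_fbar hS hf hθ hxc
  obtain ⟨η₁, hη₁c, hη₁⟩ := exists_continuous_extension hτ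
    ((Trajectories.continuousOn_comp hθ hS.Bd_cont τ).clm_apply hfbc)
  obtain ⟨η₂, hη₂c, hη₂⟩ := exists_continuous_extension hτ
    ((Trajectories.continuousOn_comp hθ hS.Bud_cont τ).clm_apply hfbc)
  have hh' : S.mapHbar (Icc 0 τ) θ η₂ h :=
    StateSpace.map_congr hh (fun t ht => (hη₂ t ht).symm) fun _ _ => rfl
  obtain ⟨h', hh'c, hh'e⟩ := exists_continuous_extension hτ
    (StateSpace.continuousOn_of_map hτ hS.Hbar_cont hθ hh' (Or.inr hη₂c.continuousOn))
  obtain ⟨W, hWc, hW⟩ := exists_continuous_extension hτ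
    (Trajectories.continuousOn_comp hθ hS.Kr_cont τ)
  have b1 : ∀ t ∈ Icc 0 τ, ‖η₁ t‖ ≤ S.Lf1 S.ρr * S.ρr + S.bf10 := by
    intro t ht
    rw [hη₁ t ht]
    have := norm_Bd_fbar_le hS hf hθ hρr ht.1 (hxr t ht)
    linarith [mul_le_mul_of_nonneg_left (hxr t ht) (hS.Lf1_nonneg hρr)]
  have b2 : ∀ t ∈ Icc 0 τ, ‖η₂ t‖ ≤ S.Lf2 S.ρr * S.ρr + S.bf20 := by
    intro t ht
    rw [hη₂ t ht]
    have := norm_Bud_fbar_le hS hf hθ hρr ht.1 (hxr t ht)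
    linarith [mul_le_mul_of_nonneg_left (hxr t ht) (hS.Lf2_nonneg hρr)]
  have hin : S.mapC (Icc 0 τ) θ (fun t => η₁ t + h' t - W t (S.r t)) c :=
    StateSpace.map_congr hc (fun t ht => by rw [hη₁ t ht, hh'e t ht, hW t ht]) fun _ _ => rfl
  have hmeas : Measurable fun t => η₁ t + h' t - W t (S.r t) :=
    (hη₁c.add hh'c).measurable.sub (measurable_clm_apply hWc hS.r_meas)
  rw [hur t ht, norm_neg]
  refine norm_ωC_le hS hθ hτ hmeas hin (fun r hr => ?_) ht
  have b3 : ‖h' r‖ ≤ S.gHbar * (S.Lf2 S.ρr * S.ρr + S.bf20) := by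
    rw [hh'e r hr]
    exact hS.ppg_Hbar.norm_le hθ hτ hη₂c.measurable hh' b2 hr
  have b4 : ‖W r (S.r r)‖ ≤ S.bKr * S.rNorm := by
    rw [hW r hr]
    exact ContinuousLinearMap.le_of_opNorm_le_of_le _ (hS.norm_Kr_le (mem_Θ hθ hr.1))
      (hS.norm_r_le hr.1)
  refine (norm_sub_le _ _).trans ((add_le_add ((norm_add_le _ _).trans
    (add_le_add (b1 r hr) b3)) b4).trans_eq ?_)
  ring

end Reference

/-! ### The difference between the adaptive and the reference system -/

/-- The loop gain `‖𝓖xm‖ L_{f₁} + ‖𝓖xum‖ L_{f₂}`. -/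
noncomputable def loopGain (S : Setup n m p s nH nF) : ℝ :=
  S.gGxm * S.Lf1 S.ρ + S.gGxum * S.Lf2 S.ρ

theorem StabilityCondition.ρin_lt (hS : S.Assumptions) (hf : S.Uncertainty f)
    (hρr : 0 < S.ρr) (hγ1 : 0 < S.γ1) (h : S.StabilityCondition) : S.ρin < S.ρr := by
  have hρ0 : 0 < S.ρ := by rw [ρ]; linarith
  have h1 := hS.Lf1_nonneg hρ0
  have h2 := hS.Lf2_nonneg hρ0
  have h3 := hf.bf10_nonneg
  have h4 := hf.bf20_nonneg
  have h5 := hS.ppg_Gxm.1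
  have h6 := hS.ppg_Gxum.1
  have h7 := hS.ppg_HxmCKr.1
  have h8 : 0 ≤ S.rNorm := ENNReal.toReal_nonneg
  have e1 : 0 ≤ S.gGxm * (S.Lf1 S.ρ * S.ρr + S.bf10) := by positivity
  have e2 : 0 ≤ S.gGxum * (S.Lf2 S.ρ * S.ρr + S.bf20) := by positivity
  have e3 : 0 ≤ S.gHxmCKr * S.rNorm := by positivity
  rw [StabilityCondition] at h
  linarith

/-- Dropping the nonnegative offsets from the stability condition leaves `loopGain * ρr < ρr`. An
uncertainty `f` is needed only to know that `bf0` is nonnegative. -/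
theorem StabilityCondition.loopGain_lt_one (hS : S.Assumptions) (hf : S.Uncertainty f)
    (hρr : 0 < S.ρr) (h : S.StabilityCondition) : S.loopGain < 1 := by
  have h3 := hf.bf10_nonneg
  have h4 := hf.bf20_nonneg
  have h5 := hS.ppg_Gxm.1
  have h6 := hS.ppg_Gxum.1
  have h7 := hS.ppg_HxmCKr.1
  have h8 : 0 ≤ S.rNorm := ENNReal.toReal_nonneg
  have h9 : 0 ≤ S.ρin := mul_nonneg hS.ρ0_pos.le (Real.sqrt_nonneg _)
  have e1 : 0 ≤ S.gGxm * S.bf10 := by positivity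
  have e2 : 0 ≤ S.gGxum * S.bf20 := by positivity
  have e3 : 0 ≤ S.gHxmCKr * S.rNorm := by positivity
  rw [StabilityCondition] at h
  have e4 : S.loopGain * S.ρr < 1 * S.ρr := by
    rw [loopGain]
    linarith
  exact lt_of_mul_lt_mul_right e4 hρr.le

/-- Small gain: the difference of the two systems is driven by increments of the uncertainty, which
return the error with a factor below 1, and by the response to the estimation error. The input bound
is stated for an arbitrary state bound `E` so that it serves both with `γ1`, in the continuation
argument, and with the sharper bound just obtained, for small `T`. -/
theorem norm_error_le (hS : S.Assumptions) (hf : S.Uncertainty f) (hθ : θ ∈ S.adm)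
    (hn : 0 < n) {T : ℝ} (hT : 0 < T) (hτ : 0 ≤ τ) {R : ℝ} (hρ0 : 0 < S.ρ)
    (hgain : S.loopGain < 1) {x₀ xh₀ : Vec n}
    {x xr : ℝ → Vec n} {u ur : ℝ → Vec m} {y yr : ℝ → Vec p}
    (hsol : S.AdaptiveSolution T f θ x₀ xh₀ (Icc 0 τ) x u y)
    (href : S.ReferenceSolution f θ x₀ (Icc 0 τ) xr ur yr)
    (hx : ∀ t ∈ Icc 0 τ, ‖x t‖ ≤ S.ρ) (hu : ∀ t ∈ Icc 0 τ, ‖u t‖ ≤ R)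
    (hxr : ∀ t ∈ Icc 0 τ, ‖xr t‖ ≤ S.ρ) :
    (∀ t ∈ Icc 0 τ, ‖xr t - x t‖ ≤ S.gHxm / (1 - S.loopGain) * S.γ0 T S.ρ R) ∧
    ∀ E, (∀ t ∈ Icc 0 τ, ‖xr t - x t‖ ≤ E) → ∀ t ∈ Icc 0 τ,
      ‖ur t - u t‖ ≤ (S.l1ωC * S.Lf1 S.ρ + S.gCHbar * S.Lf2 S.ρ) * E +
        ‖S.ωinv‖ * S.γ0 T S.ρ R := by
  obtain ⟨hb, φ, hhb, hCu, hφ⟩ := hsol.exists_response hS hf hθ hn hT hτ hρ0 hx hu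
  obtain ⟨h, c, hh, hc, hxrs, hur⟩ := href.exists_response hS hθ
  obtain ⟨_, _, _, _, _, _, hplant, -⟩ := hsol
  have hxc := hplant.continuousOn hτ
  have hxrc := hxrs.continuousOn hτ
  have hfx := continuousOn_fbar hS hf hθ hxc
  have hfxr := continuousOn_fbar hS hf hθ hxrc
  obtain ⟨η₁, hη₁c, hη₁⟩ := exists_continuous_extension hτ
    ((Trajectories.continuousOn_comp hθ hS.Bd_cont τ).clm_apply (hfxr.sub hfx))
  obtain ⟨η₂, hη₂c, hη₂⟩ := exists_continuous_extension hτ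
    ((Trajectories.continuousOn_comp hθ hS.Bud_cont τ).clm_apply (hfxr.sub hfx))
  simp only [Pi.sub_apply] at hη₁ hη₂
  have hHd : S.mapHbar (Icc 0 τ) θ η₂ (fun t => h t - hb t) :=
    StateSpace.map_congr (StateSpace.map_sub hh hhb)
      (fun t ht => by rw [hη₂ t ht, map_sub]) fun _ _ => rfl
  have hCd : S.mapC (Icc 0 τ) θ (fun t => η₁ t + (h t - hb t) - -φ t)
      (fun t => c t - -(S.ω (u t))) :=
    StateSpace.map_congr (StateSpace.map_sub hc hCu)
      (fun t ht => by rw [hη₁ t ht, map_sub]; abel) fun _ _ => rfl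
  have hes : SolvesOn (Icc 0 τ) (fun t => xr t - x t) (x₀ - x₀) (fun t =>
      S.Am (θ t) (xr t - x t) + S.B (θ t) (η₁ t - (c t - -(S.ω (u t)))) +
        S.Bu (θ t) (η₂ t)) :=
    (hxrs.sub hplant).congr_rhs fun t ht => by
      have e1 := hS.B_Bd_add_Bu_Bud (mem_Θ hθ ht.1) (S.fbar f θ t (x t))
      have e2 : S.A (θ t) (x t) + S.B (θ t) (S.ω (S.Kx (θ t) (x t) + u t)) + f t (x t) =
          S.Am (θ t) (x t) + S.B (θ t) (S.ω (u t)) + S.fbar f θ t (x t) := by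
        simp only [fbar, Am, add_apply, ContinuousLinearMap.comp_apply, map_add, map_sub]
        abel
      rw [e2, ← e1, hη₁ t ht, hη₂ t ht]
      simp only [map_sub, map_neg]
      abel
  obtain ⟨c₁, c₂, cv, y₁, y₂, y₃, xin, hc₁, hc₂, hcv, hcsum, hy₁, hy₂, hy₃, hxin, hdec⟩ :=
    exists_decomposition hS hθ hτ hη₁c hη₂c hHd hCd hes
  -- The perturbation enters the difference as `v = -φ`, so `-cv` is the response of the filter to
  -- `φ`.
  have hcvb : ∀ t ∈ Icc 0 τ, ‖cv t‖ ≤ S.γ0 T S.ρ R := by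
    intro t ht
    have := hφ (fun t => -cv t) (StateSpace.map_congr (StateSpace.map_neg hcv)
      (fun t _ => neg_neg _) fun _ _ => rfl) t ht
    rwa [norm_neg] at this
  have hxin0 : ∀ t ∈ Icc 0 τ, xin t = 0 := by
    intro t ht
    have := norm_free_le hS hθ hτ hn hxin ht
    rw [sub_self, norm_zero, mul_zero] at this
    exact norm_le_zero_iff.1 this
  have hη₁b : ∀ E, (∀ t ∈ Icc 0 τ, ‖xr t - x t‖ ≤ E) → ∀ t ∈ Icc 0 τ, ‖η₁ t‖ ≤ S.Lf1 S.ρ * E := by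
    intro E hE t ht
    rw [hη₁ t ht]
    exact (norm_Bd_fbar_sub_le hS hf hθ hρ0 ht.1 (hxr t ht) (hx t ht)).trans
      (mul_le_mul_of_nonneg_left (hE t ht) (hS.Lf1_nonneg hρ0))
  have hη₂b : ∀ E, (∀ t ∈ Icc 0 τ, ‖xr t - x t‖ ≤ E) → ∀ t ∈ Icc 0 τ, ‖η₂ t‖ ≤ S.Lf2 S.ρ * E := by
    intro E hE t ht
    rw [hη₂ t ht]
    exact (norm_Bud_fbar_sub_le hS hf hθ hρ0 ht.1 (hxr t ht) (hx t ht)).trans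
      (mul_le_mul_of_nonneg_left (hE t ht) (hS.Lf2_nonneg hρ0))
  obtain ⟨cv', hcv'c, hcv'⟩ := exists_continuous_extension hτ
    (StateSpace.continuousOn_of_map hτ (filter_contOn (S := S)) hθ hcv (Or.inl fun _ => rfl))
  have hy₃' : S.mapHxm (Icc 0 τ) θ cv' y₃ :=
    StateSpace.map_congr hy₃ (fun t ht => (hcv' t ht).symm) fun _ _ => rfl
  constructor
  -- The loop inequality is evaluated where the error is largest on the compact interval; the finite
  -- maximum `E` then satisfies `E ≤ loopGain * E + gHxm * γ0`.
  · obtain ⟨t₁, ht₁, hmax⟩ := isCompact_Icc.exists_isMaxOn (nonempty_Icc.2 hτ)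
      (hxrc.sub hxc).norm
    set E := ‖xr t₁ - x t₁‖ with hE
    have hEb : ∀ t ∈ Icc 0 τ, ‖xr t - x t‖ ≤ E := fun t ht => hmax ht
    have d1 := hS.ppg_Gxm.norm_le hθ hτ hη₁c.measurable hy₁ (hη₁b E hEb) ht₁
    have d2 := hS.ppg_Gxum.norm_le hθ hτ hη₂c.measurable hy₂ (hη₂b E hEb) ht₁
    have d3 := hS.ppg_Hxm.norm_le hθ hτ hcv'c.measurable hy₃'
      (fun r hr => by rw [hcv' r hr]; exact hcvb r hr) ht₁
    have d4 : E ≤ S.loopGain * E + S.gHxm * S.γ0 T S.ρ R := by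
      have e1 : xr t₁ - x t₁ = y₁ t₁ + y₂ t₁ + y₃ t₁ := by
        rw [hdec t₁ ht₁, hxin0 t₁ ht₁, add_zero]
      rw [hE, e1, ← e1, ← hE]
      have e2 : E ≤ ‖y₁ t₁‖ + ‖y₂ t₁‖ + ‖y₃ t₁‖ := by
        rw [hE, e1]; exact norm_add₃_le
      rw [loopGain]
      linarith
    intro t ht
    refine (hEb t ht).trans ?_
    rw [div_mul_eq_mul_div, le_div_iff₀ (by linarith)]
    linarith
  · intro E hEb t ht
    have d1 := norm_ωC_le hS hθ hτ hη₁c.measurable hc₁ (hη₁b E hEb) ht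
    have d2 : ‖S.ωinv (c₂ t)‖ ≤ S.gCHbar * (S.Lf2 S.ρ * E) :=
      hS.ppg_CHbar.norm_le hθ hτ hη₂c.measurable (y := fun t => S.ωinv (c₂ t))
        ⟨_, hHd, c₂, hc₂, fun _ _ => rfl⟩ (hη₂b E hEb) ht
    have d3 : ‖S.ωinv (cv t)‖ ≤ ‖S.ωinv‖ * S.γ0 T S.ρ R := S.ωinv.le_opNorm_of_le (hcvb t ht)
    have e1 : ur t - u t = -(S.ωinv (c₁ t) + S.ωinv (c₂ t)) + S.ωinv (cv t) := by
      have e2 : S.ωinv (c t - -(S.ω (u t))) = S.ωinv (c₁ t + c₂ t - cv t) := by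
        rw [hcsum t ht]
      simp only [map_sub, map_neg, map_add, hS.ωinv_ω] at e2
      rw [hur t ht]
      have e3 : -(S.ωinv (c t)) - u t = -(S.ωinv (c t) - -u t) := by abel
      rw [e3, e2]
      abel
    rw [e1]
    have e4 := norm_add_le (-(S.ωinv (c₁ t) + S.ωinv (c₂ t))) (S.ωinv (cv t))
    rw [norm_neg] at e4
    have e5 := norm_add_le (S.ωinv (c₁ t)) (S.ωinv (c₂ t))
    linarith

end Setup

end LPV

namespace LPV

namespace Setup

variable {n m p s nH nF : ℕ} {S : Setup n m p s nH nF} {f : ℝ → Vec n → Vec n}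
  {θ : ℝ → Vec s} {τ : ℝ}

/-! ### Bounds along arbitrary runs -/

theorem Assumptions.ρ0_le_ρin (hS : S.Assumptions) (hn : 0 < n) (hne : S.Θ.Nonempty) :
    S.ρ0 ≤ S.ρin := by
  have h1 := hS.lyap.lamMin_pos isCompact_Θ hne hn
  have h2 := hS.lyap.lamMin_le_lamMax isCompact_Θ hne hn
  exact le_mul_of_one_le_right hS.ρ0_pos.le (Real.one_le_sqrt.2 ((one_le_div h1).2 h2))

theorem ReferenceSolution.norm_state_lt (hS : S.Assumptions) (hf : S.Uncertainty f)
    (hθ : θ ∈ S.adm) (hn : 0 < n) (hτ : 0 ≤ τ) (hρr : 0 < S.ρr) (hγ1 : 0 < S.γ1)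
    (hstab : S.StabilityCondition) {x₀ : Vec n} {xr : ℝ → Vec n} {ur : ℝ → Vec m}
    {yr : ℝ → Vec p} (hx₀ : ‖x₀‖ ≤ S.ρ0)
    (hsol : S.ReferenceSolution f θ x₀ (Icc 0 τ) xr ur yr) :
    ∀ t ∈ Icc 0 τ, ‖xr t‖ < S.ρr := by
  obtain ⟨_, _, -, -, hx, -⟩ := hsol.exists_response hS hθ
  refine forall_lt_of_self_improving (φ := fun t => ‖xr t‖) (hx.continuousOn hτ).norm ?_
    fun t ht hb => ?_
  · rw [hx.zero_apply (left_mem_Icc.2 hτ)]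
    exact (hx₀.trans (hS.ρ0_le_ρin hn ⟨_, mem_Θ hθ le_rfl⟩)).trans_lt
      (hstab.ρin_lt hS hf hρr hγ1)
  · exact (hsol.mono (Icc_subset_Icc_right ht.2)).norm_lt hS hf hθ hn ht.1 hρr hγ1 hstab hx₀ hb
      (right_mem_Icc.2 ht.1)

/-- The filter is strictly proper with zero initial state, so the input is continuous and starts at
zero even though `r` may jump. The continuation argument needs both facts. -/
theorem ReferenceSolution.continuousOn_input (hS : S.Assumptions) (hθ : θ ∈ S.adm)
    (hτ : 0 ≤ τ) {x₀ : Vec n} {xr : ℝ → Vec n} {ur : ℝ → Vec m} {yr : ℝ → Vec p}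
    (hsol : S.ReferenceSolution f θ x₀ (Icc 0 τ) xr ur yr) :
    ContinuousOn ur (Icc 0 τ) ∧ ur 0 = 0 := by
  obtain ⟨h, c, -, hc, -, hur⟩ := hsol.exists_response hS hθ
  have hcc := StateSpace.continuousOn_of_map hτ (filter_contOn (S := S)) hθ hc
    (Or.inl fun _ => rfl)
  refine ⟨((S.ωinv.continuous.comp_continuousOn hcc).neg).congr hur, ?_⟩
  obtain ⟨z, hz, hcz⟩ := hc
  have h0 : (0 : ℝ) ∈ Icc 0 τ := left_mem_Icc.2 hτ
  rw [hur 0 h0, hcz 0 h0, hz.zero_apply h0]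
  simp [filter]

/-- The gain from the estimation error to the state deviation. -/
noncomputable def errorGain (S : Setup n m p s nH nF) : ℝ := S.gHxm / (1 - S.loopGain)

theorem gammaConstraint_iff {γ0bar : ℝ} :
    S.GammaConstraint γ0bar ↔ S.errorGain * γ0bar < S.γ1 := by
  rw [GammaConstraint, errorGain, loopGain, ← sub_sub]

theorem errorGain_pos (hS : S.Assumptions) (h : S.loopGain < 1) : 0 < S.errorGain :=
  div_pos hS.ppg_Hxm.1 (by linarith)

/-- The gain from the state deviation to the input deviation. -/
noncomputable def inputGain (S : Setup n m p s nH nF) : ℝ :=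
  S.l1ωC * S.Lf1 S.ρ + S.gCHbar * S.Lf2 S.ρ

/-- The bounds for the adaptive closed loop, with the deviation from the reference system expressed
by the estimation error `γ₀`. -/
theorem forall_norm_le (hm : 0 < m) (hS : S.Assumptions) (hf : S.Uncertainty f) (hθ : θ ∈ S.adm)
    (hρr : 0 < S.ρr) (hγ1 : 0 < S.γ1) (hstab : S.StabilityCondition) {γ0bar : ℝ}
    (hγ0bar : 0 < γ0bar) (hγ : S.GammaConstraint γ0bar) {T : ℝ} (hT : 0 < T)
    (hγ0 : S.γ0 T S.ρ (S.ρu γ0bar) < γ0bar) {x₀ xh₀ : Vec n} (hx₀ : ‖x₀‖ ≤ S.ρ0) (hτ : 0 ≤ τ)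
    {x xr : ℝ → Vec n} {u ur : ℝ → Vec m} {y yr : ℝ → Vec p}
    (hsol : S.AdaptiveSolution T f θ x₀ xh₀ (Icc 0 τ) x u y)
    (href : S.ReferenceSolution f θ x₀ (Icc 0 τ) xr ur yr) :
    ∀ t ∈ Icc 0 τ, ‖x t‖ ≤ S.ρ ∧ ‖u t‖ ≤ S.ρu γ0bar ∧
      ‖xr t - x t‖ ≤ S.γ1 ∧ ‖ur t - u t‖ ≤ S.γ2 γ0bar ∧
      ‖xr t - x t‖ ≤ S.errorGain * S.γ0 T S.ρ (S.ρu γ0bar) ∧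
      ‖ur t - u t‖ ≤ S.inputGain * (S.errorGain * S.γ0 T S.ρ (S.ρu γ0bar)) +
        ‖S.ωinv‖ * S.γ0 T S.ρ (S.ρu γ0bar) := by
  have hn : 0 < n := hm.trans_le (hS.m_le_n (mem_Θ hθ le_rfl))
  have hρ0 : 0 < S.ρ := add_pos hρr hγ1
  have hgain := hstab.loopGain_lt_one hS hf hρr
  have hκ := errorGain_pos hS hgain
  have hω := hS.norm_ωinv_pos hm
  have hxr := href.norm_state_lt hS hf hθ hn hτ hρr hγ1 hstab hx₀
  have hxrρ : ∀ t ∈ Icc 0 τ, ‖xr t‖ ≤ S.ρ := fun t ht => by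
    rw [ρ]; linarith [hxr t ht]
  have hbound : ∀ t ∈ Icc 0 τ, ‖xr t - x t‖ ≤ S.γ1 → ‖ur t - u t‖ ≤ S.γ2 γ0bar →
      ‖x t‖ ≤ S.ρ ∧ ‖u t‖ ≤ S.ρu γ0bar := by
    intro t ht h1 h2
    have h3 := href.norm_input_le hS hf hθ hτ hρr (fun r hr => (hxr r hr).le) ht
    have h4 := norm_le_norm_add_norm_sub (xr t) (x t)
    have h5 := norm_le_norm_add_norm_sub (ur t) (u t)
    constructor
    · rw [ρ]; linarith [hxr t ht]
    · rw [ρu]; linarith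
  have hκγ : S.errorGain * S.γ0 T S.ρ (S.ρu γ0bar) < S.γ1 :=
    (mul_le_mul_of_nonneg_left hγ0.le hκ.le).trans_lt (gammaConstraint_iff.1 hγ)
  -- State and input deviations must be continued together, since each bound is needed to control
  -- the other; their excesses are merged into one scalar function that must stay negative.
  have hlt : ∀ t ∈ Icc 0 τ, max (‖xr t - x t‖ - S.γ1) (‖ur t - u t‖ - S.γ2 γ0bar) < 0 := by
    obtain ⟨_, _, -, -, hxrs, -⟩ := href.exists_response hS hθ
    obtain ⟨_, _, _, _, _, _, hplant, -, -, -, -, -, -, -, hus⟩ := id hsol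
    obtain ⟨hurc, hur0⟩ := href.continuousOn_input hS hθ hτ
    have h0 : (0 : ℝ) ∈ Icc 0 τ := left_mem_Icc.2 hτ
    refine forall_lt_of_self_improving
      ((((hxrs.continuousOn hτ).sub (hplant.continuousOn hτ)).norm.sub continuousOn_const).sup
        ((hurc.sub (hus.continuousOn hτ)).norm.sub continuousOn_const)) ?_ fun t ht hb => ?_
    · rw [hxrs.zero_apply h0, hplant.zero_apply h0, hur0, hus.zero_apply h0]
      simp only [sub_self, norm_zero, zero_sub, max_lt_iff, neg_lt_zero]
      refine ⟨hγ1, ?_⟩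
      have := hS.Lf1_nonneg hρ0
      have := hS.Lf2_nonneg hρ0
      have := l1ωC_nonneg (S := S)
      have := hS.ppg_CHbar.1
      rw [γ2]
      positivity
    · have hsub : Icc 0 t ⊆ Icc 0 τ := Icc_subset_Icc_right ht.2
      have hb1 : ∀ r ∈ Icc 0 t, ‖xr r - x r‖ ≤ S.γ1 := fun r hr =>
        sub_nonpos.1 ((le_max_left _ _).trans (hb r hr))
      have hb2 : ∀ r ∈ Icc 0 t, ‖ur r - u r‖ ≤ S.γ2 γ0bar := fun r hr =>
        sub_nonpos.1 ((le_max_right _ _).trans (hb r hr))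
      obtain ⟨e1, e2⟩ := norm_error_le hS hf hθ hn hT ht.1 hρ0 hgain (hsol.mono hsub)
        (href.mono hsub) (fun r hr => (hbound r (hsub hr) (hb1 r hr) (hb2 r hr)).1)
        (fun r hr => (hbound r (hsub hr) (hb1 r hr) (hb2 r hr)).2)
        (fun r hr => hxrρ r (hsub hr))
      have htt : t ∈ Icc 0 t := right_mem_Icc.2 ht.1
      -- Both strict inequalities come from `γ0 < γ0bar`: for the state together with the constraint
      -- linking `γ0bar` and `γ1`, for the input through the factor `‖ω⁻¹‖`, which is positive
      -- because `0 < m`.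
      refine max_lt (sub_neg.2 ((e1 t htt).trans_lt hκγ)) (sub_neg.2 ((e2 _ hb1 t htt).trans_lt ?_))
      rw [γ2]
      exact add_lt_add_right (mul_lt_mul_of_pos_left hγ0 hω) _
  have hb1 : ∀ t ∈ Icc 0 τ, ‖xr t - x t‖ ≤ S.γ1 := fun t ht =>
    sub_nonpos.1 ((le_max_left _ _).trans (hlt t ht).le)
  have hb2 : ∀ t ∈ Icc 0 τ, ‖ur t - u t‖ ≤ S.γ2 γ0bar := fun t ht =>
    sub_nonpos.1 ((le_max_right _ _).trans (hlt t ht).le)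
  obtain ⟨e1, e2⟩ := norm_error_le hS hf hθ hn hT hτ hρ0 hgain hsol href
    (fun r hr => (hbound r hr (hb1 r hr) (hb2 r hr)).1)
    (fun r hr => (hbound r hr (hb1 r hr) (hb2 r hr)).2) hxrρ
  intro t ht
  obtain ⟨h1, h2⟩ := hbound t ht (hb1 t ht) (hb2 t ht)
  exact ⟨h1, h2, hb1 t ht, hb2 t ht, e1 t ht, e2 _ e1 t ht⟩

theorem norm_output_sub_le (hS : S.Assumptions) (hθ : θ ∈ S.adm) {T : ℝ} {x₀ xh₀ : Vec n}
    {J : Set ℝ} (hJ : J ⊆ Ici 0) {x xr : ℝ → Vec n} {u ur : ℝ → Vec m} {y yr : ℝ → Vec p}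
    (hsol : S.AdaptiveSolution T f θ x₀ xh₀ J x u y)
    (href : S.ReferenceSolution f θ x₀ J xr ur yr) {t b : ℝ} (ht : t ∈ J)
    (hb : ‖xr t - x t‖ ≤ b) : ‖yr t - y t‖ ≤ S.bC * b := by
  obtain ⟨_, _, _, _, _, _, -, hy, -⟩ := hsol
  obtain ⟨_, _, _, _, -, -, -, -, -, hyr⟩ := href
  rw [hy t ht, hyr t ht, ← map_sub]
  exact ContinuousLinearMap.le_of_opNorm_le_of_le _ (hS.norm_C_le (mem_Θ hθ (hJ ht))) hb

/-- Pointwise bounds on compact intervals, valid for all runs, hold on every time interval. -/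
theorem forAllRuns_of_Icc {T : ℝ}
    {Q : Set ℝ → (ℝ → Vec n) → (ℝ → Vec m) → (ℝ → Vec p) →
      (ℝ → Vec n) → (ℝ → Vec m) → (ℝ → Vec p) → Prop}
    {R : Vec n → Vec m → Vec n → Vec m → Prop}
    (hR : ∀ θ ∈ S.adm, ∀ f, S.Uncertainty f → ∀ x₀ xh₀ : Vec n, ‖x₀‖ ≤ S.ρ0 → ∀ τ : ℝ, 0 ≤ τ →
      ∀ x u y, S.AdaptiveSolution T f θ x₀ xh₀ (Icc 0 τ) x u y →
      ∀ xr ur yr, S.ReferenceSolution f θ x₀ (Icc 0 τ) xr ur yr →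
      ∀ t ∈ Icc 0 τ, R (x t) (u t) (xr t) (ur t))
    (hQ : ∀ θ ∈ S.adm, ∀ f x₀ xh₀ J x u y xr ur yr, J ⊆ Ici 0 →
      S.AdaptiveSolution T f θ x₀ xh₀ J x u y → S.ReferenceSolution f θ x₀ J xr ur yr →
      (∀ t ∈ J, R (x t) (u t) (xr t) (ur t)) → Q J x u y xr ur yr) :
    S.ForAllRuns T Q := by
  intro θ hθ f hf x₀ xh₀ hx₀ J hJ h0 hJ0 x u y hsol xr ur yr href
  refine hQ θ hθ f x₀ xh₀ J x u y xr ur yr hJ0 hsol href fun t ht => ?_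
  have hsub : Icc 0 t ⊆ J := hJ.out h0 ht
  exact hR θ hθ f hf x₀ xh₀ hx₀ t (hJ0 ht) x u y (hsol.mono hsub) xr ur yr (href.mono hsub) t
    (right_mem_Icc.2 (hJ0 ht))

/-! ### Small sampling times -/

/-- With `ρ` and `R` fixed, `γ0` is continuous in `T`, and at `T = 0` both `beta` and `bσtil`
vanish. -/
theorem tendsto_γ0 (S : Setup n m p s nH nF) (ρ R : ℝ) :
    Tendsto (fun T => S.γ0 T ρ R) (𝓝[>] 0) (𝓝 0) := by
  have hc : Continuous fun T => S.γ0 T ρ R := by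
    unfold γ0 beta bσtil bu' bσhatc
    fun_prop
  have h0 : S.γ0 0 ρ R = 0 := by simp [γ0, beta, bσtil]
  have := hc.tendsto 0
  rw [h0] at this
  exact this.mono_left nhdsWithin_le_nhds

theorem exists_gammaConstraint (hS : S.Assumptions) (hγ1 : 0 < S.γ1) (h : S.loopGain < 1) :
    ∃ γ0bar, 0 < γ0bar ∧ S.GammaConstraint γ0bar := by
  have hκ := errorGain_pos hS h
  refine ⟨S.γ1 / (2 * S.errorGain), by positivity, gammaConstraint_iff.2 ?_⟩
  rw [mul_div_assoc', div_lt_iff₀ (by positivity)]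
  nlinarith [mul_pos hκ hγ1]

end Setup

end LPV

/-! ### Assembly of the theorem -/

theorem mainTheorem1 {n m p s nH nF : ℕ} (hm : 0 < m) (S : LPV.Setup n m p s nH nF)
    (hS : S.Assumptions) (hρr : 0 < S.ρr) (hγ1 : 0 < S.γ1) (hstab : S.StabilityCondition) :
    (∀ γ0bar : ℝ, 0 < γ0bar → S.GammaConstraint γ0bar →
      ∀ T : ℝ, 0 < T → S.γ0 T S.ρ (S.ρu γ0bar) < γ0bar →
        S.ForAllRuns T fun J x u y xr ur yr =>
          LPV.linf J x ≤ ENNReal.ofReal S.ρ ∧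
          LPV.linf J u ≤ ENNReal.ofReal (S.ρu γ0bar) ∧
          LPV.linf J (fun t => xr t - x t) ≤ ENNReal.ofReal S.γ1 ∧
          LPV.linf J (fun t => ur t - u t) ≤ ENNReal.ofReal (S.γ2 γ0bar) ∧
          LPV.linf J (fun t => yr t - y t) ≤ ENNReal.ofReal (S.bC * S.γ1)) ∧
    (∀ γ0bar : ℝ, Tendsto (fun T => S.γ0 T S.ρ (S.ρu γ0bar)) (𝓝[>] 0) (𝓝 0)) ∧
    (∀ ε : ℝ, 0 < ε → ∃ T₀ : ℝ, 0 < T₀ ∧ ∀ T : ℝ, 0 < T → T < T₀ →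
      S.ForAllRuns T fun J x u y xr ur yr =>
        LPV.linf J (fun t => xr t - x t) ≤ ENNReal.ofReal ε ∧
        LPV.linf J (fun t => ur t - u t) ≤ ENNReal.ofReal ε ∧
        LPV.linf J (fun t => yr t - y t) ≤ ENNReal.ofReal ε) := by
  refine ⟨fun γ0bar hγ0bar hγ T hT hγ0 => ?_, fun γ0bar => LPV.Setup.tendsto_γ0 S _ _,
    fun ε hε => ?_⟩
  · refine LPV.Setup.forAllRuns_of_Icc
      (R := fun x u xr ur => ‖x‖ ≤ S.ρ ∧ ‖u‖ ≤ S.ρu γ0bar ∧ ‖xr - x‖ ≤ S.γ1 ∧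
        ‖ur - u‖ ≤ S.γ2 γ0bar) ?_ ?_
    · intro θ hθ f hf x₀ xh₀ hx₀ τ hτ x u y hsol xr ur yr href t ht
      obtain ⟨h1, h2, h3, h4, -⟩ := LPV.Setup.forall_norm_le hm hS hf hθ hρr hγ1 hstab hγ0bar hγ
        hT hγ0 hx₀ hτ hsol href t ht
      exact ⟨h1, h2, h3, h4⟩
    · intro θ hθ f x₀ xh₀ J x u y xr ur yr hJ hsol href h
      exact ⟨LPV.linf_le_ofReal fun t ht => (h t ht).1,
        LPV.linf_le_ofReal fun t ht => (h t ht).2.1,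
        LPV.linf_le_ofReal fun t ht => (h t ht).2.2.1,
        LPV.linf_le_ofReal fun t ht => (h t ht).2.2.2,
        LPV.linf_le_ofReal fun t ht =>
          LPV.Setup.norm_output_sub_le hS hθ hJ hsol href ht (h t ht).2.2.1⟩
  -- If no uncertainty satisfies the assumptions, the claim is vacuous. Otherwise one of them yields
  -- `0 ≤ bf0`, on which `loopGain < 1` rests.
  · by_cases hne : ∃ f, S.Uncertainty f
    swap
    · exact ⟨1, one_pos, fun T _ _ θ _ f hf => (hne ⟨f, hf⟩).elim⟩
    obtain ⟨f₀, hf₀⟩ := hne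
    -- A single `γ0bar` is fixed before `T` is chosen. It fixes `ρu`, so every deviation bound is a
    -- constant multiple of `γ0 T`.
    obtain ⟨γ0bar, hγ0bar, hγ⟩ :=
      LPV.Setup.exists_gammaConstraint hS hγ1 (hstab.loopGain_lt_one hS hf₀ hρr)
    have hlim := LPV.Setup.tendsto_γ0 S S.ρ (S.ρu γ0bar)
    have hx := hlim.const_mul S.errorGain
    have hu := (hx.const_mul S.inputGain).add (hlim.const_mul ‖S.ωinv‖)
    have hy := hx.const_mul S.bC
    simp only [mul_zero, add_zero] at hx hu hy
    obtain ⟨T₀, hT₀, hsub⟩ := mem_nhdsGT_iff_exists_Ioo_subset.1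
      ((hlim.eventually_lt_const hγ0bar).and ((hx.eventually_lt_const hε).and
        ((hu.eventually_lt_const hε).and (hy.eventually_lt_const hε))))
    refine ⟨T₀, hT₀, fun T hT hTT₀ => ?_⟩
    obtain ⟨hγ0, hxε, huε, hyε⟩ := hsub ⟨hT, hTT₀⟩
    -- The state deviation is kept as a multiple of `γ0` instead of `ε`, since the output bound
    -- multiplies it by `bC`, and the product was made smaller than `ε` separately.
    refine LPV.Setup.forAllRuns_of_Icc
      (R := fun x u xr ur => ‖xr - x‖ ≤ S.errorGain * S.γ0 T S.ρ (S.ρu γ0bar) ∧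
        ‖ur - u‖ ≤ ε) ?_ ?_
    · intro θ hθ f hf x₀ xh₀ hx₀ τ hτ x u y hsol xr ur yr href t ht
      obtain ⟨-, -, -, -, h1, h2⟩ := LPV.Setup.forall_norm_le hm hS hf hθ hρr hγ1 hstab hγ0bar hγ
        hT hγ0 hx₀ hτ hsol href t ht
      exact ⟨h1, h2.trans huε.le⟩
    · intro θ hθ f x₀ xh₀ J x u y xr ur yr hJ hsol href h
      exact ⟨LPV.linf_le_ofReal fun t ht => (h t ht).1.trans hxε.le,
        LPV.linf_le_ofReal fun t ht => (h t ht).2,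
        LPV.linf_le_ofReal fun t ht =>
          (LPV.Setup.norm_output_sub_le hS hθ hJ hsol href ht (h t ht).1).trans hyε.le⟩
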